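/- Let $l>1$, let $t_1<\dots<t_l$ be real numbers, and let each interval $(t_j,t_{j+1})$, $1\le j\le l-1$, be labelled $0$ (compact) or $1$ (non-compact). Let $n=l+1$, or, if all labels are $0$, let $n\in\{l,l+1\}$. Then there are $L\ge 1$, real polynomials $f_1,\dots,f_L$ in $n$ variables, sets $S_1,\dots,S_L\subset\mathbb{R}^n$ and a nonempty connected open set $D\subset\mathbb{R}^n$ such that the following hold. (A) $D$ is a normal and convenient (NC) semi-algebraic set: $D=\bigcap_j\{f_j>0\}$ and $\overline D=\bigcap_j\{f_j\ge 0\}$; $S_j$ is a union of connected components of $\{f_j=0\}$, $df_j\neq 0$ at each point of $S_j$, and $\{f_j=0\}\setminus S_j$ is disjoint from $\overline D$; for each nonempty $\Lambda\subset\{1,\dots,L\}$, the set $\bigcap_{j\in\Lambda}S_j$ is empty or a non-singular real algebraic manifold without boundary of dimension $n-|\Lambda|$, and at each of its points its tangent space is the intersection of the tangent spaces of the $S_j$, $j\in\Lambda$. (B) $\overline D\setminus D=\bigcup_j (S_j\cap\overline D)$; each $S_j\cap\overline D$ is a nonempty connected smooth $(n-1)$-dimensional submanifold (with corners) of $S_j$;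 each $S_j$ is a connected component of the real algebraic set defined by a single real polynomial of degree at most $2$, and it is the product of a connected component of a hyperbola $(x_1-a)(x_k-b)=c$, $c\neq0$, in the plane of the coordinates $(x_1,x_k)$ for some $k\ge 2$, and the copy of $\mathbb{R}^{n-2}$ given by the other coordinates. (C) For every sufficiently large integer $m$ there are integers $d_j>0$ with $n+\sum_j d_j=m+L$ such that the set $$M=\{(x,y_1,\dots,y_L)\in\overline D\times\mathbb{R}^{d_1}\times\dots\times\mathbb{R}^{d_L}\mid f_j(x)-\|y_j\|^2=0\ (1\le j\le L)\},$$ the projection $f_D:M\to\mathbb{R}^n$, $(x,y)\mapsto x$, and the function $f=\pi_{n,1}\circ f_D:M\to\mathbb{R}$, $(x,y)\mapsto x_1$, have the following properties. (C1) $M$ is an $m$-dimensional ($m\ge n$) non-singular connected real algebraic manifold without boundary, and it is a connected component of the real algebraic set defined by the polynomials $f_j(x)-\|y_j\|^2$. The map $f_D$ is real algebraic, $f_D(M)=\overline D$, and the set of singular points of $f_D$ has image $\overline D\setminus D$. Each preimage $f_D^{-1}(p)$ is homeomorphic to a CW complex of dimension at most $m-n$, and for $p\in D$ it is a smooth submanifold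 of dimension $m-n$ diffeomorphic to a product of finitely many unit spheres. (C2) $f$ is a smooth real algebraic function, $f(M)=[t_1,t_l]$, and its set of singular values is exactly $\{t_1,\dots,t_l\}$. For each $t\in f(M)$ the preimage $f^{-1}(t)$ is connected and homeomorphic to a CW complex of dimension at most $m-1$. For $t\in(t_j,t_{j+1})$ the preimage $f^{-1}(t)$ is a smooth submanifold of dimension $m-1$ without boundary, which is compact if the label of $(t_j,t_{j+1})$ is $0$ and non-compact if it is $1$. Here a point of a $d$-dimensional manifold is a singular point of a smooth map to $\mathbb{R}^k$ if the rank of the differential there is less than $\min(d,k)$, and a singular value is the image of a singular point. A non-singular real algebraic manifold of dimension $d$ in $\mathbb{R}^N$ is a union of connected components of the zero set of $N-d$ real polynomials whose differentials are linearly independent at each of its points. -/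

import Mathlib

open Set
open scoped ContDiff

noncomputable section

namespace HypRAG

/-! ## Real algebraic sets and smooth submanifolds of Euclidean spaces -/

/-- The real polynomial function `ℝ^ι → ℝ` defined by a polynomial. -/
def polyFun {ι : Type} (P : MvPolynomial ι ℝ) (x : EuclideanSpace ℝ ι) : ℝ :=
  MvPolynomial.eval (fun i => x i) P

/-- The real algebraic set defined by a family of real polynomials. -/
def zeroSet {ι κ : Type} (F : κ → MvPolynomial ι ℝ) : Set (EuclideanSpace ℝ ι) :=
  {x | ∀ j, polyFun (F j) x = 0}

/-- The real algebraic set defined by a single real polynomial. -/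
def hyperZeroSet {ι : Type} (P : MvPolynomial ι ℝ) : Set (EuclideanSpace ℝ ι) :=
  {x | polyFun P x = 0}

/-- `M` is the union of some of the connected components of `Z`. -/
def IsUnionOfComponents {X : Type} [TopologicalSpace X] (M Z : Set X) : Prop :=
  M ⊆ Z ∧ ∀ p ∈ M, connectedComponentIn Z p ⊆ M

/-- `M` is one connected component of `Z`. -/
def IsComponent {X : Type} [TopologicalSpace X] (M Z : Set X) : Prop :=
  ∃ p ∈ Z, M = connectedComponentIn Z p

/-- `M ⊆ ℝ^ι` is a non-singular real algebraic manifold (without boundary) of dimension `d`: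
a union of connected components of the real algebraic set defined by `r = |ι| - d` polynomials
such that the map given by these polynomials has rank `r` at each point of `M`. -/
def IsNonsingularAlgebraic {ι : Type} [Fintype ι] (M : Set (EuclideanSpace ℝ ι)) (d : ℕ) : Prop :=
  ∃ r : ℕ, r + d = Fintype.card ι ∧ ∃ F : Fin r → MvPolynomial ι ℝ,
    IsUnionOfComponents M (zeroSet F) ∧
    ∀ p ∈ M, LinearIndependent ℝ (fun j => fderiv ℝ (polyFun (F j)) p)

/-- On `M`, the map `g` is given by real polynomials. -/
def IsRealAlgebraicMapOn {ι κ : Type} (M : Set (EuclideanSpace ℝ ι))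
    (g : EuclideanSpace ℝ ι → EuclideanSpace ℝ κ) : Prop :=
  ∃ P : κ → MvPolynomial ι ℝ, ∀ x ∈ M, ∀ i, g x i = polyFun (P i) x

/-- On `M`, the function `g` is given by a real polynomial. -/
def IsRealAlgebraicFunctionOn {ι : Type} (M : Set (EuclideanSpace ℝ ι))
    (g : EuclideanSpace ℝ ι → ℝ) : Prop :=
  ∃ P : MvPolynomial ι ℝ, ∀ x ∈ M, g x = polyFun P x

section Smooth

variable {E : Type} [NormedAddCommGroup E] [NormedSpace ℝ E]
variable {F : Type} [NormedAddCommGroup F] [NormedSpace ℝ F]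

/-- `N` is a smooth submanifold of dimension `d` with corners: near each of its points, it is
`{g = 0, h₁ ≥ 0, …, hᵣ ≥ 0}` with `(g, h)` smooth and submersive at the point, `g` having
`dim E - d` components. -/
def IsSubmanifoldWithCorners (N : Set E) (d : ℕ) : Prop :=
  ∀ p ∈ N, ∃ U : Set E, IsOpen U ∧ p ∈ U ∧ ∃ k r : ℕ, k + d = Module.finrank ℝ E ∧
    ∃ (g : E → EuclideanSpace ℝ (Fin k)) (h : E → EuclideanSpace ℝ (Fin r)),
      ContDiffOn ℝ ∞ g U ∧ ContDiffOn ℝ ∞ h U ∧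
      Function.Surjective (fun v : E => (fderiv ℝ g p v, fderiv ℝ h p v)) ∧
      N ∩ U = {x ∈ U | g x = 0 ∧ ∀ i, 0 ≤ h x i}

/-- `N` is a smooth submanifold of dimension `d` without boundary: near each of its points, it is
the zero set of a smooth map to `ℝ^(dim E - d)` which is submersive at the point. -/
def IsSmoothSubmanifold (N : Set E) (d : ℕ) : Prop :=
  ∀ p ∈ N, ∃ U : Set E, IsOpen U ∧ p ∈ U ∧ ∃ k : ℕ, k + d = Module.finrank ℝ E ∧
    ∃ g : E → EuclideanSpace ℝ (Fin k),
      ContDiffOn ℝ ∞ g U ∧ Function.Surjective (fderiv ℝ g p) ∧ N ∩ U = {x ∈ U | g x = 0}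

/-- The tangent space of `N` at `p`: the span of the velocities at `p` of the smooth curves
in `N` through `p`. -/
def tangentSpaceAt (N : Set E) (p : E) : Submodule ℝ E :=
  Submodule.span ℝ {v | ∃ (ε : ℝ) (γ : ℝ → E), 0 < ε ∧ ContDiffOn ℝ ∞ γ (Ioo (-ε) ε) ∧
    (∀ s ∈ Ioo (-ε) ε, γ s ∈ N) ∧ γ 0 = p ∧ HasDerivAt γ v 0}

/-- The set of singular points of the restriction to the `m`-dimensional submanifold `M` of a
smooth map `g`: the rank of the differential of `g|_M` is less than `min m (dim F)`. -/
def singularSet (M : Set E) (m : ℕ) (g : E → F) : Set E :=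
  {x ∈ M | Module.finrank ℝ ((tangentSpaceAt M x).map (fderiv ℝ g x : E →ₗ[ℝ] F)) <
    min m (Module.finrank ℝ F)}

/-- `N` and `N'` are diffeomorphic, by maps that extend smoothly to open neighbourhoods. -/
def AreDiffeomorphic (N : Set E) (N' : Set F) : Prop :=
  ∃ (φ : E → F) (ψ : F → E) (U : Set E) (V : Set F),
    IsOpen U ∧ N ⊆ U ∧ ContDiffOn ℝ ∞ φ U ∧ IsOpen V ∧ N' ⊆ V ∧ ContDiffOn ℝ ∞ ψ V ∧
    MapsTo φ N N' ∧ MapsTo ψ N' N ∧ (∀ x ∈ N, ψ (φ x) = x) ∧ (∀ y ∈ N', φ (ψ y) = y)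

end Smooth

/-- The product of unit spheres `S^{k_1} × ⋯ × S^{k_r}` in `ℝ^{k_1+1} × ⋯ × ℝ^{k_r+1}`. -/
def sphereProduct {r : ℕ} (k : Fin r → ℕ) :
    Set (EuclideanSpace ℝ (Σ j : Fin r, Fin (k j + 1))) :=
  {y | ∀ j, ∑ i, y ⟨j, i⟩ ^ 2 = 1}

/-- `C` is homeomorphic to a CW complex of dimension at most `d`. -/
def HasCWDimLE {X : Type} [TopologicalSpace X] (C : Set X) (d : ℕ) : Prop :=
  ∃ (Y : Type) (_ : TopologicalSpace Y) (_ : T2Space Y) (K : Set Y)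
    (cw : Topology.CWComplex K), (∀ k, d < k → IsEmpty (cw.cell k)) ∧ Nonempty (C ≃ₜ K)

/-! ## Hyperbolas and NC semi-algebraic sets -/

/-- The canonical projection `π_{n,1} : ℝ^n → ℝ`, `x ↦ x_1`. -/
def firstCoord {n : ℕ} (hn : 0 < n) (x : EuclideanSpace ℝ (Fin n)) : ℝ := x ⟨0, hn⟩

/-- `S ⊆ ℝ^n` is the product of one of the two connected components (`x_k > b` or `x_k < b`) of a
hyperbola `(x_1 - a)(x_k - b) = c` in the `(x_1, x_k)`-plane, `c ≠ 0`, and the copy of `ℝ^{n-2}`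
given by the other coordinates. -/
def IsHyperbolaCylinder {n : ℕ} (hn : 0 < n) (S : Set (EuclideanSpace ℝ (Fin n))) : Prop :=
  ∃ (a b c : ℝ) (k : Fin n), c ≠ 0 ∧ k ≠ ⟨0, hn⟩ ∧
    (S = {x | (firstCoord hn x - a) * (x k - b) = c ∧ b < x k} ∨
     S = {x | (firstCoord hn x - a) * (x k - b) = c ∧ x k < b})

/-- `D` is a normal and convenient (NC) semi-algebraic set in `ℝ^n`, with the family `f` of
defining polynomials and the family `S` of hypersurfaces surrounding it. -/
structure IsNC {n L : ℕ} (D : Set (EuclideanSpace ℝ (Fin n)))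
    (f : Fin L → MvPolynomial (Fin n) ℝ) (S : Fin L → Set (EuclideanSpace ℝ (Fin n))) : Prop where
  pos : 0 < L
  isOpen : IsOpen D
  isConnected : IsConnected D
  eq_inter : D = {x | ∀ j, 0 < polyFun (f j) x}
  closure_eq : closure D = {x | ∀ j, 0 ≤ polyFun (f j) x}
  components : ∀ j, IsUnionOfComponents (S j) (hyperZeroSet (f j))
  nonsingular : ∀ j, ∀ p ∈ S j, fderiv ℝ (polyFun (f j)) p ≠ 0
  disjoint_rest : ∀ j, Disjoint (hyperZeroSet (f j) \ S j) (closure D)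
  inter_nonsingular : ∀ Λ : Finset (Fin L), Λ.Nonempty → (⋂ j ∈ Λ, S j) = ∅ ∨
    ∃ d : ℕ, d + Λ.card = n ∧ IsNonsingularAlgebraic (⋂ j ∈ Λ, S j) d
  transversal : ∀ Λ : Finset (Fin L), Λ.Nonempty → ∀ p ∈ ⋂ j ∈ Λ, S j,
    tangentSpaceAt (⋂ j ∈ Λ, S j) p = ⨅ j ∈ Λ, tangentSpaceAt (S j) p

/-- The boundary `closure D \ D` is the union of the pieces `S j ∩ closure D`, each of which is a
nonempty connected `(n-1)`-dimensional smooth submanifold (with corners) of the hypersurface `S j`,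
and each `S j` is a connected component of the real algebraic set defined by a single real
polynomial of degree at most `2`. -/
structure IsSurroundedBy {n L : ℕ} (D : Set (EuclideanSpace ℝ (Fin n)))
    (S : Fin L → Set (EuclideanSpace ℝ (Fin n))) : Prop where
  boundary_eq : closure D \ D = ⋃ j, S j ∩ closure D
  piece_connected : ∀ j, IsConnected (S j ∩ closure D)
  piece_submanifold : ∀ j, IsSubmanifoldWithCorners (S j ∩ closure D) (n - 1)
  degree_le_two : ∀ j, ∃ q : MvPolynomial (Fin n) ℝ, q.totalDegree ≤ 2 ∧
    IsComponent (S j) (hyperZeroSet q)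

/-! ## The manifold and the map over an NC semi-algebraic set -/

/-- `ℝ^n × ℝ^{d_1} × ⋯ × ℝ^{d_L}`, with points `(x, y_1, …, y_L)`. -/
abbrev TotalSpace (n : ℕ) {L : ℕ} (d : Fin L → ℕ) : Type :=
  EuclideanSpace ℝ (Fin n ⊕ (Σ j : Fin L, Fin (d j)))

/-- The canonical projection `(x, y_1, …, y_L) ↦ x`. -/
def baseProj {n L : ℕ} {d : Fin L → ℕ} (z : TotalSpace n d) : EuclideanSpace ℝ (Fin n) :=
  WithLp.toLp 2 (fun i => z (Sum.inl i))

/-- The polynomial `f_j(x_1, …, x_n) - ‖y_j‖²`. -/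
def totalPoly {n L : ℕ} (f : Fin L → MvPolynomial (Fin n) ℝ) (d : Fin L → ℕ) (j : Fin L) :
    MvPolynomial (Fin n ⊕ (Σ j : Fin L, Fin (d j))) ℝ :=
  MvPolynomial.rename Sum.inl (f j) - ∑ i : Fin (d j), MvPolynomial.X (Sum.inr ⟨j, i⟩) ^ 2

/-- `M = {(x, y) | x ∈ closure D, f_j(x) - ‖y_j‖² = 0 for all j}`. -/
def totalManifold {n L : ℕ} (D : Set (EuclideanSpace ℝ (Fin n)))
    (f : Fin L → MvPolynomial (Fin n) ℝ) (d : Fin L → ℕ) : Set (TotalSpace n d) :=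
  {z | baseProj z ∈ closure D ∧ z ∈ zeroSet (totalPoly f d)}

/-- `M` is a connected non-singular real algebraic manifold of dimension `m`, a connected component
of the real algebraic set defined by the polynomials `F`, and `fD : M → ℝ^n` is a
smooth real algebraic map with image `closure D`, singular exactly over `closure D \ D`,
whose preimages are at most `(m-n)`-dimensional and are, over `D`, smooth submanifolds
diffeomorphic to products of unit spheres. -/
structure IsMapOver {n L : ℕ} {ι : Type} [Fintype ι] (D : Set (EuclideanSpace ℝ (Fin n))) (m : ℕ)
    (F : Fin L → MvPolynomial ι ℝ) (M : Set (EuclideanSpace ℝ ι))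
    (fD : EuclideanSpace ℝ ι → EuclideanSpace ℝ (Fin n)) : Prop where
  le_dim : n ≤ m
  isConnected : IsConnected M
  nonsingular : IsNonsingularAlgebraic M m
  isComponent : IsComponent M (zeroSet F)
  algebraic : IsRealAlgebraicMapOn M fD
  image_eq : fD '' M = closure D
  singular_image : fD '' singularSet M m fD = closure D \ D
  fibre_dim : ∀ p, HasCWDimLE (M ∩ fD ⁻¹' {p}) (m - n)
  fibre_spheres : ∀ p ∈ D, IsSmoothSubmanifold (M ∩ fD ⁻¹' {p}) (m - n) ∧
    ∃ (r : ℕ) (k : Fin r → ℕ), AreDiffeomorphic (M ∩ fD ⁻¹' {p}) (sphereProduct k)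

/-- `f : M → ℝ` is a smooth real algebraic function on an `m`-dimensional manifold with image
`[t_1, t_l]`, with the `t_j` as its singular values, with connected preimages which are CW complexes
of dimension at most `m - 1`, and whose preimages over `(t_j, t_{j+1})` are smooth submanifolds
without boundary, compact if the label of the interval is `0` and non-compact if it is `1`.
The sequence and the intervals are numbered from `0`. -/
structure RealizesData {l : ℕ} (hl : 1 < l) (t : Fin l → ℝ) (lab : Fin (l - 1) → Fin 2)
    {ι : Type} [Fintype ι] (m : ℕ) (M : Set (EuclideanSpace ℝ ι))
    (f : EuclideanSpace ℝ ι → ℝ) : Prop where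
  algebraic : IsRealAlgebraicFunctionOn M f
  image_eq : f '' M = Icc (t ⟨0, by omega⟩) (t ⟨l - 1, by omega⟩)
  singular_values : f '' singularSet M m f = range t
  fibre_connected : ∀ s ∈ f '' M, IsConnected (M ∩ f ⁻¹' {s})
  fibre_dim : ∀ s ∈ f '' M, HasCWDimLE (M ∩ f ⁻¹' {s}) (m - 1)
  fibre_regular : ∀ j : Fin (l - 1), ∀ s ∈ Ioo (t ⟨j, by omega⟩) (t ⟨j + 1, by omega⟩),
    IsSmoothSubmanifold (M ∩ f ⁻¹' {s}) (m - 1)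
  fibre_compact : ∀ j : Fin (l - 1), ∀ s ∈ Ioo (t ⟨j, by omega⟩) (t ⟨j + 1, by omega⟩),
    lab j = 0 → IsCompact (M ∩ f ⁻¹' {s})
  fibre_noncompact : ∀ j : Fin (l - 1), ∀ s ∈ Ioo (t ⟨j, by omega⟩) (t ⟨j + 1, by omega⟩),
    lab j = 1 → ¬ IsCompact (M ∩ f ⁻¹' {s})

end HypRAG

end

/-! Write s for the first coordinate and w for t_l - t_1 + 1. The domain D is cut out by hyperbolas
each of which involves only s and one other coordinate, so it is designed plane by plane. In the
plane of the first two coordinates, two branches enclose a lens around the diagonal, with tips over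
t_1 and t_l; this confines s to [t_1, t_l]. In every further plane, with coordinate y, an index i is
fixed and τ = t_i. Two lower branches cross over τ and produce a corner of the boundary (if τ = t_1,
one of them is omitted and there is no corner). Upper branches y = w/(τ - s) and y = w/(s - β) blow
up at τ and β, so y is unbounded above exactly over [τ, β]; here β = t_i for label 0 and β = t_{i+1}
for label 1. The interior t_i use up l - 2 planes. The first interval has no corner value of its
own, so a label 1 on it is served by one additional plane; this is why n = l + 1, and why n = l
suffices when all labels are 0.

For fixed s each defining function is affine in its second coordinate. Hence a slice of the closure
of D is a product of closed intervals, bounded below, and contracts along segments to a central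
curve `center`. This convexity gives connectedness of D, of the boundary pieces and of the slices,
and together with a shift along the central curve it gives the closure
(`IsArrangement.closure_domain`).

At a point of the closure the differentials of the vanishing functions are independent
(`IsArrangement.indep_dq`): a curve alone in its plane contributes its own direction, and at most
one pair in a common plane crosses, with nonzero determinant. So M is non-singular, and the
projection to ℝ^n maps its tangent space onto the common kernel of the vanishing df_j
(`IsRegularDomain.exists_tangent_iff`). The projection is therefore singular exactly over the
boundary. The function s is singular exactly where two curves of the same plane cross, since curves
in different planes can be followed simultaneously with ds = 1. The crossing values are the tips and
the corners, that is, the t_j.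

M is a family of products of spheres of radius √f_j, possibly degenerate. It is a continuous image
of the product of the closure of D with unit spheres, which gives connectedness of M and
connectedness and compactness of fibres from those of slices. For the CW structures, a slice is
decomposed into cubes on each of which every radius is identically zero or positive. A cell of the
family is a base cell with a choice of the spheres in which the top cell, rather than the base
point, is taken (`CellDecomp.bundle`).

`IsArrangement` isolates what is used of the curves: `IsArrangement.isNC`,
`IsArrangement.isSurroundedBy`, `IsRegularDomain.isMapOver` and `IsArrangement.realizesData` give
the conclusions, and `HypData.isArrangement` verifies the hypotheses by explicit inequalities. -/

noncomputable section
namespace HypRAG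

/-! ## Locally finite cubical decompositions -/

/-- The open cube `(-1, 1)^κ`. -/
def openCube (κ : Type) : Set (κ → ℝ) := {z | ∀ a, |z a| < 1}

/-- The closed cube `[-1, 1]^κ`. -/
def closedCube (κ : Type) : Set (κ → ℝ) := {z | ∀ a, |z a| ≤ 1}

lemma openCube_subset_closedCube (κ : Type) : openCube κ ⊆ closedCube κ :=
  fun _ hz a => (hz a).le

lemma isCompact_closedCube (κ : Type) : IsCompact (closedCube κ) := by
  have : closedCube κ = Set.pi univ fun _ => Icc (-1 : ℝ) 1 := by
    ext z; simp [closedCube, abs_le, Set.mem_pi, -Set.pi_univ_Icc]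
  rw [this]
  exact isCompact_univ_pi fun _ => isCompact_Icc

/-- A locally finite decomposition of a closed set into open cells, parametrized by cubes, such
that the boundary of each cell lies in the union of the cells of smaller dimension. -/
structure CellDecomp {X : Type} [TopologicalSpace X] (C : Set X) where
  /-- The set of cells. -/
  ι : Type
  /-- The coordinates of a cell. -/
  κ : ι → Type
  /-- The cells are finite dimensional. -/
  fin : ∀ i, Fintype (κ i)
  /-- The characteristic maps. -/
  χ : ∀ i, (κ i → ℝ) → X
  cont : ∀ i, Continuous (χ i)
  cover : ∀ x, x ∈ C ↔ ∃ i, ∃ z ∈ openCube (κ i), χ i z = x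
  inj : ∀ i, InjOn (χ i) (openCube (κ i))
  disj : ∀ i j, ∀ z ∈ openCube (κ i), ∀ w ∈ openCube (κ j), χ i z = χ j w → i = j
  bdry : ∀ i, ∀ z ∈ closedCube (κ i), z ∉ openCube (κ i) →
    ∃ j, ∃ w ∈ openCube (κ j), Nat.card (κ j) < Nat.card (κ i) ∧ χ j w = χ i z
  locfin : LocallyFinite fun i => χ i '' closedCube (κ i)

namespace CellDecomp

variable {X : Type} [TopologicalSpace X] {C : Set X} (K : CellDecomp C)

instance (i : K.ι) : Fintype (K.κ i) := K.fin i

/-- In products and bundles every point of the closed cube needs a carrier cell, not only the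
boundary points. A point of the open cube is carried by its own cell, with unchanged dimension. -/
lemma bdry' (i : K.ι) (z : K.κ i → ℝ) (hz : z ∈ closedCube (K.κ i)) :
    ∃ j, ∃ w ∈ openCube (K.κ j), K.χ j w = K.χ i z ∧ (Nat.card (K.κ j) < Nat.card (K.κ i) ∨
      ∃ h : j = i, z ∈ openCube (K.κ i) ∧ h ▸ w = z) := by
  by_cases h : z ∈ openCube (K.κ i)
  · exact ⟨i, z, h, rfl, Or.inr ⟨rfl, h, rfl⟩⟩
  · obtain ⟨j, w, hw, hc, he⟩ := K.bdry i z hz h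
    exact ⟨j, w, hw, he, Or.inl hc⟩

/-- Reindexing the coordinates of a cell of dimension `n` by `Fin n`. -/
def reindex {n : ℕ} (i : {i : K.ι // Nat.card (K.κ i) = n}) : Fin n ≃ K.κ i :=
  (finCongr i.2.symm).trans (Finite.equivFin (K.κ i)).symm

/-- The characteristic map on the cube with coordinates in `Fin n`. -/
def charMap {n : ℕ} (i : {i : K.ι // Nat.card (K.κ i) = n}) (z : Fin n → ℝ) : X :=
  K.χ i (z ∘ (K.reindex i).symm)

lemma comp_reindex_mem_openCube {n : ℕ} (i : {i : K.ι // Nat.card (K.κ i) = n}) (z : Fin n → ℝ) :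
    z ∘ (K.reindex i).symm ∈ openCube (K.κ i) ↔ z ∈ Metric.ball (0 : Fin n → ℝ) 1 := by
  rw [mem_ball_zero_iff, pi_norm_lt_iff one_pos]
  simp only [openCube, mem_ofPred_eq, Function.comp, Real.norm_eq_abs]
  exact (K.reindex i).symm.forall_congr_left.trans (by simp)

lemma comp_reindex_mem_closedCube {n : ℕ} (i : {i : K.ι // Nat.card (K.κ i) = n})
    (z : Fin n → ℝ) :
    z ∘ (K.reindex i).symm ∈ closedCube (K.κ i) ↔ z ∈ Metric.closedBall (0 : Fin n → ℝ) 1 := by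
  rw [mem_closedBall_zero_iff, pi_norm_le_iff_of_nonneg zero_le_one]
  simp only [closedCube, mem_ofPred_eq, Function.comp, Real.norm_eq_abs]
  exact (K.reindex i).symm.forall_congr_left.trans (by simp)

lemma image_charMap_ball {n : ℕ} (i : {i : K.ι // Nat.card (K.κ i) = n}) :
    K.charMap i '' Metric.ball 0 1 = K.χ i '' openCube (K.κ i) := by
  ext x
  constructor
  · rintro ⟨z, hz, rfl⟩
    exact ⟨_, (K.comp_reindex_mem_openCube i z).2 hz, rfl⟩
  · rintro ⟨z, hz, rfl⟩
    have : z = (z ∘ K.reindex i) ∘ (K.reindex i).symm := by ext; simp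
    exact ⟨z ∘ K.reindex i, (K.comp_reindex_mem_openCube i _).1 (this ▸ hz),
      by rw [charMap, ← this]⟩

lemma image_charMap_closedBall {n : ℕ} (i : {i : K.ι // Nat.card (K.κ i) = n}) :
    K.charMap i '' Metric.closedBall 0 1 = K.χ i '' closedCube (K.κ i) := by
  ext x
  constructor
  · rintro ⟨z, hz, rfl⟩
    exact ⟨_, (K.comp_reindex_mem_closedCube i z).2 hz, rfl⟩
  · rintro ⟨z, hz, rfl⟩
    have : z = (z ∘ K.reindex i) ∘ (K.reindex i).symm := by ext; simp
    exact ⟨z ∘ K.reindex i, (K.comp_reindex_mem_closedCube i _).1 (this ▸ hz),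
      by rw [charMap, ← this]⟩

lemma continuous_charMap {n : ℕ} (i : {i : K.ι // Nat.card (K.κ i) = n}) :
    Continuous (K.charMap i) :=
  (K.cont i).comp (by fun_prop)

lemma injOn_charMap {n : ℕ} (i : {i : K.ι // Nat.card (K.κ i) = n}) :
    InjOn (K.charMap i) (Metric.ball 0 1) := by
  intro z hz w hw h
  have := K.inj i ((K.comp_reindex_mem_openCube i z).2 hz)
    ((K.comp_reindex_mem_openCube i w).2 hw) h
  exact (K.reindex i).symm.surjective.injective_comp_right this

/-- The characteristic map as a partial equivalence. -/
def charEquiv {n : ℕ} (i : {i : K.ι // Nat.card (K.κ i) = n}) : PartialEquiv (Fin n → ℝ) X :=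
  (K.injOn_charMap i).bijOn_image.toPartialEquiv

lemma disjoint_cells {i j : K.ι} (h : i ≠ j) :
    Disjoint (K.χ i '' openCube (K.κ i)) (K.χ j '' openCube (K.κ j)) := by
  rw [Set.disjoint_left]
  rintro _ ⟨z, hz, rfl⟩ ⟨w, hw, e⟩
  exact h (K.disj i j z hz w hw e.symm)

/-- Closed subsets of the closed cube are compact, so their images are closed. Restricting such an
image to the open cell adds no points, because boundary points of the cube land in cells of smaller
dimension, which are disjoint from this one. -/
lemma continuousOn_charEquiv_symm [T2Space X] {n : ℕ} (i : {i : K.ι // Nat.card (K.κ i) = n}) :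
    ContinuousOn (K.charEquiv i).symm (K.charEquiv i).target := by
  rw [continuousOn_iff_isClosed]
  intro F hF
  refine ⟨K.charMap i '' (F ∩ Metric.closedBall 0 1),
    (((isCompact_closedBall _ _).inter_left hF).image (K.continuous_charMap i)).isClosed, ?_⟩
  have htar : (K.charEquiv i).target = K.charMap i '' Metric.ball 0 1 := rfl
  ext x
  constructor
  · rintro ⟨hx, hx'⟩
    refine ⟨⟨(K.charEquiv i).symm x, ⟨hx, Metric.ball_subset_closedBall
      ((K.charEquiv i).map_target hx')⟩, (K.charEquiv i).right_inv hx'⟩, hx'⟩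
  · rintro ⟨⟨z, ⟨hzF, hz⟩, rfl⟩, hx'⟩
    refine ⟨?_, hx'⟩
    have hzb : z ∈ Metric.ball (0 : Fin n → ℝ) 1 := by
      by_contra hzb
      obtain ⟨j, w, hw, hc, he⟩ := K.bdry i _ ((K.comp_reindex_mem_closedCube i z).2 hz)
        (fun h => hzb ((K.comp_reindex_mem_openCube i z).1 h))
      rw [htar, image_charMap_ball] at hx'
      obtain ⟨u, hu, hu'⟩ := hx'
      have : j = i := K.disj j i w hw u hu (he.trans hu'.symm)
      subst this
      exact lt_irrefl _ hc
    change (K.charEquiv i).symm (K.charEquiv i z) ∈ F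
    rwa [(K.charEquiv i).left_inv hzb]

lemma iUnion_closedCells :
    ⋃ (n : ℕ) (i : {i : K.ι // Nat.card (K.κ i) = n}), K.charEquiv i '' Metric.closedBall 0 1
      = C := by
  ext x
  simp only [mem_iUnion]
  constructor
  · rintro ⟨n, i, hx⟩
    obtain ⟨z, hz, rfl⟩ := (K.image_charMap_closedBall i).subset hx
    obtain ⟨j, w, hw, he, -⟩ := K.bdry' i z hz
    exact (K.cover _).2 ⟨j, w, hw, he⟩
  · intro hx
    obtain ⟨i, z, hz, rfl⟩ := (K.cover x).1 hx
    exact ⟨_, ⟨i, rfl⟩, (K.image_charMap_closedBall ⟨i, rfl⟩).superset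
      ⟨z, openCube_subset_closedCube _ hz, rfl⟩⟩

/-- A locally finite cubical decomposition is a CW complex. -/
@[reducible] def toCWComplex [T2Space X] : Topology.CWComplex C where
  cell n := {i : K.ι // Nat.card (K.κ i) = n}
  map _ i := K.charEquiv i
  source_eq _ _ := rfl
  continuousOn _ i := (K.continuous_charMap i).continuousOn
  continuousOn_symm _ i := K.continuousOn_charEquiv_symm i
  pairwiseDisjoint' := by
    rintro ⟨n, i⟩ - ⟨m, j⟩ - hne
    change Disjoint (K.charMap i '' _) (K.charMap j '' _)
    rw [image_charMap_ball, image_charMap_ball]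
    apply K.disjoint_cells
    intro h
    apply hne
    obtain ⟨i, rfl⟩ := i
    obtain ⟨j, rfl⟩ := j
    dsimp at h
    subst h
    rfl
  mapsTo' n i := by
    -- Closure finiteness: a closed cell is compact, and a locally finite family meets a compact set
    -- in finitely many members.
    have hfin := K.locfin.finite_nonempty_inter_compact
      ((isCompact_closedCube (K.κ i)).image (K.cont i))
    have hfin' : ∀ m, Set.Finite {j : {j : K.ι // Nat.card (K.κ j) = m} |
        (K.χ j '' closedCube (K.κ j) ∩ K.χ i '' closedCube (K.κ i)).Nonempty} :=
      fun m => Set.Finite.preimage (f := fun j : {j : K.ι // Nat.card (K.κ j) = m} => j.1)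
        Subtype.val_injective.injOn hfin
    refine ⟨fun m => (hfin' m).toFinset, ?_⟩
    intro z hz
    have hzc : z ∈ Metric.closedBall (0 : Fin n → ℝ) 1 := Metric.sphere_subset_closedBall hz
    have hzo : z ∉ Metric.ball (0 : Fin n → ℝ) 1 := fun h =>
      (Metric.sphere_disjoint_ball.le_bot ⟨hz, h⟩)
    obtain ⟨j, w, hw, hc, he⟩ := K.bdry i _ ((K.comp_reindex_mem_closedCube i z).2 hzc)
        (fun h => hzo ((K.comp_reindex_mem_openCube i z).1 h))
    have hw' := openCube_subset_closedCube _ hw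
    simp only [mem_iUnion]
    refine ⟨Nat.card (K.κ j), i.2 ▸ hc, ⟨j, rfl⟩, ?_, ?_⟩
    · simp only [Finite.mem_toFinset, mem_ofPred_eq]
      exact ⟨K.χ j w, ⟨w, hw', rfl⟩, ⟨_, (K.comp_reindex_mem_closedCube i z).2 hzc, he.symm⟩⟩
    · exact (K.image_charMap_closedBall ⟨j, rfl⟩).superset ⟨w, hw', he⟩
  closed' A hA h := by
    -- The weak topology: a union of a locally finite family of closed sets is closed.
    have : A = ⋃ i, A ∩ K.χ i '' closedCube (K.κ i) := by
      rw [← inter_iUnion, eq_comm, inter_eq_left]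
      intro x hx
      obtain ⟨i, z, hz, rfl⟩ := (K.cover x).1 (hA hx)
      exact mem_iUnion.2 ⟨i, z, openCube_subset_closedCube _ hz, rfl⟩
    rw [this]
    refine (K.locfin.subset fun i => inter_subset_right).isClosed_iUnion fun i => ?_
    have := h _ ⟨i, rfl⟩
    rwa [show K.charEquiv ⟨i, rfl⟩ '' Metric.closedBall 0 1 = _ from
      K.image_charMap_closedBall ⟨i, rfl⟩] at this
  union' := K.iUnion_closedCells

lemma hasCWDimLE [T2Space X] {d : ℕ} (hd : ∀ i, Nat.card (K.κ i) ≤ d) : HasCWDimLE C d :=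
  ⟨X, inferInstance, inferInstance, C, K.toCWComplex,
    fun _ hk => ⟨fun i => (hd i.1).not_gt (hk.trans_eq i.2.symm)⟩, ⟨Homeomorph.refl _⟩⟩

/-- The empty set has the empty decomposition. -/
def empty : CellDecomp (∅ : Set X) where
  ι := Empty
  κ := Empty.elim
  fin i := i.elim
  χ i := i.elim
  cont i := i.elim
  cover x := by simp
  inj i := i.elim
  disj i := i.elim
  bdry i := i.elim
  locfin := fun x => ⟨univ, Filter.univ_mem, Set.toFinite _⟩

end CellDecomp

end HypRAG

/-! ### Products of decompositions and decompositions of intervals -/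

namespace HypRAG
namespace CellDecomp

/-- The product of finitely many decompositions of subsets of the line. -/
def pi {τ : Type} [Fintype τ] {C : τ → Set ℝ} (K : ∀ k, CellDecomp (C k)) :
    CellDecomp {x : EuclideanSpace ℝ τ | ∀ k, x k ∈ C k} where
  ι := ∀ k, (K k).ι
  κ i := Σ k, (K k).κ (i k)
  fin i := inferInstance
  χ i z := WithLp.toLp 2 fun k => (K k).χ (i k) fun a => z ⟨k, a⟩
  cont i := by
    refine (PiLp.continuous_toLp 2 _).comp (continuous_pi fun k => ((K k).cont _).comp ?_)
    fun_prop
  cover x := by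
    constructor
    · intro hx
      choose i z hz h using fun k => ((K k).cover _).1 (hx k)
      exact ⟨i, fun a => z a.1 a.2, fun a => hz a.1 a.2, by ext k; exact h k⟩
    · rintro ⟨i, z, hz, rfl⟩ k
      exact ((K k).cover _).2 ⟨i k, _, fun a => hz ⟨k, a⟩, rfl⟩
  inj i z hz w hw h := by
    funext ⟨k, a⟩
    have hk := congrArg (fun x : EuclideanSpace ℝ τ => x k) h
    exact congrFun ((K k).inj (i k) (fun a => hz ⟨k, a⟩) (fun a => hw ⟨k, a⟩) hk) a
  disj i j z hz w hw h := by
    funext k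
    have hk := congrArg (fun x : EuclideanSpace ℝ τ => x k) h
    exact (K k).disj (i k) (j k) _ (fun a => hz ⟨k, a⟩) _ (fun a => hw ⟨k, a⟩) hk
  bdry i z hz hz' := by
    choose j w hw he hc using fun k => (K k).bdry' (i k) (fun a => z ⟨k, a⟩) (fun a => hz ⟨k, a⟩)
    refine ⟨j, fun a => w a.1 a.2, fun a => hw a.1 a.2, ?_, ?_⟩
    · simp only [Nat.card_sigma]
      -- In each factor the dimension drops or stays. If it dropped in none, every component of `z`
      -- would lie in its open cube, against `hz'`.
      refine Finset.sum_lt_sum (fun k _ => ?_) ?_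
      · rcases hc k with h | ⟨h, -⟩
        · exact h.le
        · rw [h]
      · by_contra hcon
        push Not at hcon
        apply hz'
        rintro ⟨k, a⟩
        rcases hc k with h | ⟨-, h, -⟩
        · exact absurd (hcon k (Finset.mem_univ _)) h.not_ge
        · exact h a
    · ext k
      exact he k
  locfin x := by
    choose U hU hfin using fun k => (K k).locfin (x k)
    refine ⟨{y | ∀ k, y k ∈ U k}, ?_, ?_⟩
    · have : {y : EuclideanSpace ℝ τ | ∀ k, y k ∈ U k} = ⋂ k, (fun y => y k) ⁻¹' U k := by
        ext; simp
      rw [this, Filter.iInter_mem]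
      intro k
      have : Continuous fun y : EuclideanSpace ℝ τ => y k := by fun_prop
      exact this.continuousAt (hU k)
    · refine (Set.Finite.pi' hfin).subset ?_
      rintro i ⟨_, ⟨z, hz, rfl⟩, hy⟩ k
      exact ⟨_, ⟨_, fun a => hz ⟨k, a⟩, rfl⟩, hy k⟩

/-- The cells of the half-line or segment subdivided at `v + i δ`, `i ≤ N`. -/
def lineDecomp (v δ : ℝ) (hδ : 0 < δ) (N : ℕ∞) :
    CellDecomp {x : ℝ | v ≤ x ∧ ∀ k : ℕ, N = k → x ≤ v + k * δ} where
  -- Vertices, and edges labelled by their left ends. For N = ⊤ the upper bound on x is vacuous and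
  -- the set is a half-line.
  ι := {i : ℕ // (i : ℕ∞) ≤ N} ⊕ {i : ℕ // ((i + 1 : ℕ) : ℕ∞) ≤ N}
  κ := Sum.elim (fun _ => Empty) (fun _ => Unit)
  fin := by rintro (i | i) <;> dsimp <;> infer_instance
  χ
    | .inl i => fun _ => v + i.1 * δ
    | .inr i => fun z => v + (i.1 + (z () + 1) / 2) * δ
  cont := by
    rintro (i | i)
    · exact continuous_const
    · have : Continuous fun z : Unit → ℝ => v + (i.1 + (z () + 1) / 2) * δ := by fun_prop
      exact this
  cover x := by
    constructor
    · rintro ⟨hx, hN⟩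
      set y := (x - v) / δ with hy
      have hxy : x = v + y * δ := by rw [hy]; field_simp; ring
      have hy0 : 0 ≤ y := div_nonneg (by linarith) hδ.le
      have hyN : ∀ k : ℕ, N = k → y ≤ k := by
        intro k hk
        have := hN k hk
        rw [hxy] at this
        exact le_of_mul_le_mul_right (by linarith) hδ
      have h1 := Nat.floor_le hy0
      have h2 := Nat.lt_floor_add_one y
      rcases h1.eq_or_lt with h | h
      · refine ⟨.inl ⟨⌊y⌋₊, ?_⟩, fun a => a.elim, fun a => a.elim, ?_⟩
        · induction N using ENat.recTopCoe with
          | top => exact le_top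
          | coe k => exact_mod_cast h.le.trans (hyN k rfl)
        · change v + (⌊y⌋₊ : ℝ) * δ = x
          rw [h, ← hxy]
      · refine ⟨.inr ⟨⌊y⌋₊, ?_⟩, fun _ => 2 * (y - ⌊y⌋₊) - 1, ?_, ?_⟩
        · induction N using ENat.recTopCoe with
          | top => exact le_top
          | coe k =>
            have := h.trans_le (hyN k rfl)
            exact_mod_cast Nat.succ_le_of_lt (by exact_mod_cast this)
        · intro a
          rw [abs_lt]
          constructor <;> linarith
        · change v + ((⌊y⌋₊ : ℝ) + (2 * (y - ⌊y⌋₊) - 1 + 1) / 2) * δ = x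
          rw [hxy]; ring
    · rintro ⟨i | i, z, hz, rfl⟩
      · change v ≤ v + i.1 * δ ∧ ∀ k : ℕ, N = k → v + i.1 * δ ≤ v + k * δ
        refine ⟨by nlinarith [(Nat.cast_nonneg i.1 : (0 : ℝ) ≤ _)], fun k hk => ?_⟩
        have : i.1 ≤ k := by exact_mod_cast i.2.trans_eq hk
        gcongr
      · have hz := abs_lt.1 (hz ())
        change v ≤ v + (i.1 + (z () + 1) / 2) * δ ∧
          ∀ k : ℕ, N = k → v + (i.1 + (z () + 1) / 2) * δ ≤ v + k * δ
        have h0 := (Nat.cast_nonneg i.1 : (0 : ℝ) ≤ _)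
        refine ⟨?_, fun k hk => ?_⟩
        · have : 0 ≤ (i.1 + (z () + 1) / 2) * δ := mul_nonneg (by linarith) hδ.le
          linarith
        · have : i.1 + 1 ≤ k := by exact_mod_cast i.2.trans_eq hk
          have : (i.1 : ℝ) + 1 ≤ k := by exact_mod_cast this
          gcongr
          linarith
  inj := by
    rintro (i | i) z hz w hw h
    · funext a; exact a.elim
    · funext a
      change v + (i.1 + (z () + 1) / 2) * δ = v + (i.1 + (w () + 1) / 2) * δ at h
      have := mul_right_cancel₀ hδ.ne' (add_left_cancel h)
      have : z () = w () := by linarith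
      exact this
  disj := by
    rintro (i | i) (j | j) z hz w hw h
    · change v + i.1 * δ = v + j.1 * δ at h
      have := mul_right_cancel₀ hδ.ne' (add_left_cancel h)
      have : i = j := Subtype.ext (by exact_mod_cast this)
      rw [this]
    · change v + i.1 * δ = v + (j.1 + (w () + 1) / 2) * δ at h
      have := mul_right_cancel₀ hδ.ne' (add_left_cancel h)
      have hw := abs_lt.1 (hw ())
      have h1 : (j.1 : ℝ) < i.1 := by linarith
      have h2 : (i.1 : ℝ) < j.1 + 1 := by linarith
      norm_cast at h1 h2
      omega
    · change v + (i.1 + (z () + 1) / 2) * δ = v + j.1 * δ at h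
      have := mul_right_cancel₀ hδ.ne' (add_left_cancel h)
      have hz := abs_lt.1 (hz ())
      have h1 : (i.1 : ℝ) < j.1 := by linarith
      have h2 : (j.1 : ℝ) < i.1 + 1 := by linarith
      norm_cast at h1 h2
      omega
    · change v + (i.1 + (z () + 1) / 2) * δ = v + (j.1 + (w () + 1) / 2) * δ at h
      have := mul_right_cancel₀ hδ.ne' (add_left_cancel h)
      have hz := abs_lt.1 (hz ())
      have hw := abs_lt.1 (hw ())
      have h1 : (i.1 : ℝ) < j.1 + 1 := by linarith
      have h2 : (j.1 : ℝ) < i.1 + 1 := by linarith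
      norm_cast at h1 h2
      have : i = j := Subtype.ext (by omega)
      rw [this]
  bdry := by
    rintro (i | i) z hz hz'
    · exact absurd (fun a => a.elim) hz'
    · have hz1 : |z ()| = 1 := by
        refine le_antisymm (hz ()) (not_lt.1 fun h => hz' fun _ => h)
      rcases eq_or_eq_neg_of_abs_eq hz1 with h | h
      · refine ⟨.inl ⟨i.1 + 1, i.2⟩, fun a => a.elim, fun a => a.elim, ?_, ?_⟩
        · change Nat.card Empty < Nat.card Unit
          simp
        · change v + ((i.1 + 1 : ℕ) : ℝ) * δ = v + (i.1 + (z () + 1) / 2) * δ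
          rw [h]; push_cast; ring
      · refine ⟨.inl ⟨i.1, le_trans (by exact_mod_cast Nat.le_succ _) i.2⟩, fun a => a.elim,
          fun a => a.elim, ?_, ?_⟩
        · change Nat.card Empty < Nat.card Unit
          simp
        · change v + (i.1 : ℝ) * δ = v + (i.1 + (z () + 1) / 2) * δ
          rw [h]; ring
  locfin x := by
    obtain ⟨m, hm⟩ := exists_nat_gt ((x + 1 - v) / δ)
    rw [div_lt_iff₀ hδ] at hm
    have key : ∀ i : ℕ, v + i * δ < x + 1 → i < m := by
      intro i hi
      have : (i : ℝ) * δ < m * δ := by linarith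
      exact_mod_cast lt_of_mul_lt_mul_right this hδ.le
    refine ⟨Iio (x + 1), Iio_mem_nhds (by linarith), ?_⟩
    have hf : (Iio m).Finite := Set.finite_Iio m
    refine (((hf.preimage Subtype.val_injective.injOn).image Sum.inl).union
      ((hf.preimage Subtype.val_injective.injOn).image Sum.inr)).subset ?_
    rintro (i | i) ⟨_, ⟨z, hz, rfl⟩, hy⟩
    · exact Or.inl ⟨i, key _ hy, rfl⟩
    · refine Or.inr ⟨i, key _ ?_, rfl⟩
      have hz := abs_le.1 (hz ())
      change v + (i.1 + (z () + 1) / 2) * δ < x + 1 at hy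
      refine lt_of_le_of_lt ?_ hy
      gcongr
      linarith

/-- A nonempty closed interval which is bounded below has a decomposition into points and open
intervals. -/
lemma exists_interval {I : Set ℝ} (hI : IsClosed I) (hc : I.OrdConnected) (hne : I.Nonempty)
    (hb : BddBelow I) : ∃ K : CellDecomp I, ∀ i, Nat.card (K.κ i) ≤ 1 ∧
      ((∀ z w, K.χ i z = K.χ i w) ∨
        ∀ z ∈ openCube (K.κ i), ∃ y₁ ∈ I, ∃ y₂ ∈ I, y₁ < K.χ i z ∧ K.χ i z < y₂) := by
  obtain ⟨v, hv, hle⟩ : ∃ v ∈ I, ∀ x ∈ I, v ≤ x :=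
    ⟨sInf I, hI.csInf_mem hne hb, fun x hx => csInf_le hb hx⟩
  -- N = 0, 1 or ⊤ according as the interval is a point, a segment or a half-line.
  obtain ⟨δ, hδ, N, rfl⟩ : ∃ δ, 0 < δ ∧ ∃ N : ℕ∞,
      I = {x : ℝ | v ≤ x ∧ ∀ k : ℕ, N = k → x ≤ v + k * δ} := by
    by_cases hba : BddAbove I
    · have hu : sSup I ∈ I := hI.csSup_mem hne hba
      rcases (hle _ hu).eq_or_lt with h | h
      · refine ⟨1, one_pos, 0, ?_⟩
        ext x
        constructor
        · intro hx
          refine ⟨hle x hx, fun k hk => ?_⟩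
          have : k = 0 := by exact_mod_cast hk.symm
          subst this
          have := le_csSup hba hx
          norm_num; linarith
        · rintro ⟨h1, h2⟩
          have := h2 0 rfl
          have : x = v := by norm_num at this; linarith
          rwa [this]
      · refine ⟨sSup I - v, by linarith, 1, ?_⟩
        ext x
        constructor
        · intro hx
          refine ⟨hle x hx, fun k hk => ?_⟩
          have : k = 1 := by exact_mod_cast hk.symm
          subst this
          have := le_csSup hba hx
          norm_num; linarith
        · rintro ⟨h1, h2⟩
          have := h2 1 rfl
          norm_num at this
          exact hc.out hv hu ⟨h1, this⟩
    · refine ⟨1, one_pos, ⊤, ?_⟩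
      ext x
      constructor
      · intro hx
        exact ⟨hle x hx, fun k hk => absurd hk (ENat.top_ne_natCast k)⟩
      · rintro ⟨h1, -⟩
        obtain ⟨y, hy, hxy⟩ := not_bddAbove_iff.1 hba x
        exact hc.out hv hy ⟨h1, hxy.le⟩
  refine ⟨lineDecomp v δ hδ N, ?_⟩
  rintro (i | i)
  · refine ⟨?_, Or.inl fun z w => rfl⟩
    change Nat.card Empty ≤ 1
    simp
  · refine ⟨?_, Or.inr fun z hz => ?_⟩
    · change Nat.card Unit ≤ 1
      simp
    have hz := abs_lt.1 (hz ())
    change ∃ y₁ ∈ _, ∃ y₂ ∈ _, y₁ < v + (i.1 + (z () + 1) / 2) * δ ∧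
      v + (i.1 + (z () + 1) / 2) * δ < y₂
    refine ⟨v + i.1 * δ, ((lineDecomp v δ hδ N).cover _).2
      ⟨.inl ⟨i.1, le_trans (by exact_mod_cast Nat.le_succ _) i.2⟩, fun a => a.elim,
        fun a => a.elim, rfl⟩, v + ((i.1 + 1 : ℕ) : ℝ) * δ, ((lineDecomp v δ hδ N).cover _).2
      ⟨.inl ⟨i.1 + 1, i.2⟩, fun a => a.elim, fun a => a.elim, rfl⟩, ?_, ?_⟩
    · gcongr; linarith
    · push_cast; gcongr; linarith

end CellDecomp

/-! ## A cell of the sphere -/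

/-- The characteristic map of the top cell of the sphere, in the coordinates `(2v, |v|² - 1)` of
the inverse of the stereographic projection, `v = w / (1 - ‖w‖)`. -/
def sphereCell {d : ℕ} (w : Fin d → ℝ) : Fin (d + 1) → ℝ :=
  Fin.cons ((∑ a, w a ^ 2 - (1 - ‖w‖) ^ 2) / (∑ a, w a ^ 2 + (1 - ‖w‖) ^ 2))
    fun a => 2 * (1 - ‖w‖) * w a / (∑ a, w a ^ 2 + (1 - ‖w‖) ^ 2)

lemma sphereCell_denom_pos {d : ℕ} (w : Fin d → ℝ) : 0 < ∑ a, w a ^ 2 + (1 - ‖w‖) ^ 2 := by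
  have h0 : 0 ≤ ∑ a, w a ^ 2 := Finset.sum_nonneg fun a _ => sq_nonneg _
  by_contra h
  have h1 : ∑ a, w a ^ 2 = 0 := by nlinarith [sq_nonneg (1 - ‖w‖)]
  have h2 : w = 0 := by
    funext a
    exact pow_eq_zero_iff two_ne_zero |>.1
      ((Finset.sum_eq_zero_iff_of_nonneg fun a _ => sq_nonneg (w a)).1 h1 a (Finset.mem_univ _))
  rw [h2] at h
  norm_num at h

lemma continuous_sphereCell {d : ℕ} : Continuous (sphereCell : (Fin d → ℝ) → _) := by
  refine continuous_pi fun a => ?_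
  have h := fun w : Fin d → ℝ => (sphereCell_denom_pos w).ne'
  refine Fin.cases ?_ (fun a => ?_) a
  · simp only [sphereCell, Fin.cons_zero]
    exact Continuous.div (by fun_prop) (by fun_prop) h
  · simp only [sphereCell, Fin.cons_succ]
    exact Continuous.div (by fun_prop) (by fun_prop) h

lemma sum_sphereCell_sq {d : ℕ} (w : Fin d → ℝ) : ∑ a, sphereCell w a ^ 2 = 1 := by
  have h := (sphereCell_denom_pos w).ne'
  rw [Fin.sum_univ_succ]
  simp only [sphereCell, Fin.cons_zero, Fin.cons_succ, div_pow, mul_pow]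
  rw [← Finset.sum_div, ← Finset.mul_sum, ← add_div, div_eq_one_iff_eq (pow_ne_zero _ h)]
  ring

lemma sphereCell_zero_ne_one {d : ℕ} {w : Fin d → ℝ} (hw : ‖w‖ < 1) : sphereCell w 0 ≠ 1 := by
  have h := sphereCell_denom_pos w
  simp only [sphereCell, Fin.cons_zero]
  rw [Ne, div_eq_one_iff_eq h.ne']
  intro h'
  have : 0 < (1 - ‖w‖) ^ 2 := by have : 0 < 1 - ‖w‖ := by linarith
                                 positivity
  linarith

/-- The factor 1 - ‖w‖ kills all coordinates but the polar one, so the boundary collapses to the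
pole. The norm is the supremum norm, whose unit ball is the cube, while the sphere is Euclidean; the
formula works because only the direction w / (1 - ‖w‖) enters. -/
lemma sphereCell_of_norm_eq_one {d : ℕ} {w : Fin d → ℝ} (hw : ‖w‖ = 1) :
    sphereCell w = Fin.cons 1 fun _ => 0 := by
  have h := (sphereCell_denom_pos w).ne'
  funext a
  refine Fin.cases ?_ (fun a => ?_) a
  · simp only [sphereCell, Fin.cons_zero]
    rw [hw] at h ⊢
    rw [div_eq_one_iff_eq h]; ring
  · simp [sphereCell, hw]

/-- Stereographic projection recovers v = w / (1 - ‖w‖); its norm ‖w‖ / (1 - ‖w‖) determines ‖w‖,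
and then v determines w. -/
lemma injOn_sphereCell {d : ℕ} : InjOn (sphereCell : (Fin d → ℝ) → _) {w | ‖w‖ < 1} := by
  have key : ∀ w : Fin d → ℝ, ‖w‖ < 1 → ∀ a,
      sphereCell w (Fin.succ a) / (1 - sphereCell w 0) = (1 - ‖w‖)⁻¹ * w a := by
    intro w hw a
    have h := (sphereCell_denom_pos w).ne'
    have hw' : (1 - ‖w‖) ≠ 0 := by linarith
    simp only [sphereCell, Fin.cons_zero, Fin.cons_succ]
    rw [one_sub_div h, div_div_div_cancel_right₀ h]
    field_simp
    ring
  intro w hw u hu h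
  have hv : (1 - ‖w‖)⁻¹ • w = (1 - ‖u‖)⁻¹ • u := by
    funext a
    have := key w hw a
    rw [h, key u hu a] at this
    simpa using this.symm
  have hn := congrArg norm hv
  have hw' : 0 < 1 - ‖w‖ := by simp only [mem_ofPred_eq] at hw; linarith
  have hu' : 0 < 1 - ‖u‖ := by simp only [mem_ofPred_eq] at hu; linarith
  rw [norm_smul, norm_smul, norm_inv, norm_inv, Real.norm_of_nonneg hw'.le,
    Real.norm_of_nonneg hu'.le] at hn
  field_simp at hn
  have : ‖w‖ = ‖u‖ := by linarith
  rw [this] at hv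
  exact smul_right_injective _ (inv_ne_zero hu'.ne') hv

/-- With v the stereographic projection of y from the pole, the preimage is v / (1 + ‖v‖), the
inverse of w ↦ w / (1 - ‖w‖). -/
lemma exists_sphereCell_eq {d : ℕ} (y : Fin (d + 1) → ℝ) (hy : ∑ a, y a ^ 2 = 1)
    (hne : y ≠ Fin.cons 1 fun _ => 0) : ∃ w : Fin d → ℝ, ‖w‖ < 1 ∧ sphereCell w = y := by
  rw [Fin.sum_univ_succ] at hy
  have hs : 0 ≤ ∑ a : Fin d, y a.succ ^ 2 := Finset.sum_nonneg fun a _ => sq_nonneg _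
  have h0 : y 0 ≠ 1 := by
    intro h
    apply hne
    have h1 : ∑ a : Fin d, y a.succ ^ 2 = 0 := by rw [h] at hy; linarith
    funext a
    refine Fin.cases h (fun a => ?_) a
    exact pow_eq_zero_iff two_ne_zero |>.1 ((Finset.sum_eq_zero_iff_of_nonneg
      fun a _ => sq_nonneg (y (Fin.succ a))).1 h1 a (Finset.mem_univ _))
  have h1 : 0 < 1 - y 0 := by
    have : y 0 ≤ 1 := by nlinarith
    exact sub_pos.2 (lt_of_le_of_ne this h0)
  set v : Fin d → ℝ := (1 - y 0)⁻¹ • fun a => y (Fin.succ a) with hv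
  have hvn : 0 < 1 + ‖v‖ := by positivity
  have hw : ‖(1 + ‖v‖)⁻¹ • v‖ = ‖v‖ / (1 + ‖v‖) := by
    rw [norm_smul, norm_inv, Real.norm_of_nonneg hvn.le]; field_simp
  have hw1 : 1 - ‖(1 + ‖v‖)⁻¹ • v‖ = (1 + ‖v‖)⁻¹ := by rw [hw]; field_simp; ring
  have hsum : ∑ a, v a ^ 2 = (1 + y 0) / (1 - y 0) := by
    simp only [hv, Pi.smul_apply, smul_eq_mul, mul_pow]
    rw [← Finset.mul_sum, show ∑ a : Fin d, y a.succ ^ 2 = (1 - y 0) * (1 + y 0) by linarith]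
    field_simp
  refine ⟨(1 + ‖v‖)⁻¹ • v, ?_, ?_⟩
  · rw [hw, div_lt_one hvn]; linarith
  have hden : ∑ a, ((1 + ‖v‖)⁻¹ • v) a ^ 2 = (1 + ‖v‖)⁻¹ ^ 2 * ((1 + y 0) / (1 - y 0)) := by
    simp only [Pi.smul_apply, smul_eq_mul, mul_pow]
    rw [← Finset.mul_sum, hsum]
  funext a
  refine Fin.cases ?_ (fun a => ?_) a
  · simp only [sphereCell, Fin.cons_zero]
    rw [hw1, hden]
    field_simp
    ring
  · simp only [sphereCell, Fin.cons_succ]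
    rw [hw1, hden]
    simp only [hv, Pi.smul_apply, smul_eq_mul]
    rw [← hv]
    field_simp
    ring

end HypRAG

/-! ### The total space and cell decompositions of sphere bundles -/

namespace HypRAG

/-- A decomposition of the unit sphere of `ℝ^d` into a point and one open cell. -/
structure SphereChart (d : ℕ) where
  /-- The characteristic map of the top cell. -/
  σ : (Fin (d - 1) → ℝ) → Fin d → ℝ
  /-- The base point. -/
  e : Fin d → ℝ
  cont : Continuous σ
  sum_sq : ∀ w, ∑ a, σ w a ^ 2 = 1
  base_sum_sq : ∑ a, e a ^ 2 = 1
  ne_base : ∀ w ∈ openCube (Fin (d - 1)), σ w ≠ e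
  eq_base : ∀ w ∈ closedCube (Fin (d - 1)), w ∉ openCube (Fin (d - 1)) → σ w = e
  inj : InjOn σ (openCube (Fin (d - 1)))
  surj : ∀ y, ∑ a, y a ^ 2 = 1 → y ≠ e → ∃ w ∈ openCube (Fin (d - 1)), σ w = y

lemma norm_lt_one_iff_mem_openCube {d : ℕ} {w : Fin d → ℝ} : ‖w‖ < 1 ↔ w ∈ openCube (Fin d) :=
  pi_norm_lt_iff one_pos

lemma nonempty_sphereChart {d : ℕ} (hd : 0 < d) : Nonempty (SphereChart d) := by
  obtain ⟨d, rfl⟩ := Nat.exists_eq_succ_of_ne_zero hd.ne'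
  exact ⟨{
    σ := sphereCell
    e := Fin.cons 1 fun _ => 0
    cont := continuous_sphereCell
    sum_sq := sum_sphereCell_sq
    base_sum_sq := by simp [Fin.sum_univ_succ]
    ne_base := fun w hw h => sphereCell_zero_ne_one (norm_lt_one_iff_mem_openCube.2 hw)
      (by rw [h]; rfl)
    eq_base := fun w hw hw' => sphereCell_of_norm_eq_one (le_antisymm
      ((pi_norm_le_iff_of_nonneg zero_le_one).2 hw)
      (not_lt.1 fun h => hw' (norm_lt_one_iff_mem_openCube.1 h)))
    inj := fun w hw u hu h => injOn_sphereCell (norm_lt_one_iff_mem_openCube.2 hw)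
      (norm_lt_one_iff_mem_openCube.2 hu) h
    surj := fun y hy hne => by
      obtain ⟨w, hw, h⟩ := exists_sphereCell_eq y hy hne
      exact ⟨w, norm_lt_one_iff_mem_openCube.1 hw, h⟩ }⟩

section

variable {n L : ℕ} {d : Fin L → ℕ}

/-- The coordinates `y_j` of a point of the total space. -/
def fibreCoord (z : TotalSpace n d) (j : Fin L) (a : Fin (d j)) : ℝ := z (Sum.inr ⟨j, a⟩)

/-- The point of the total space with given coordinates. -/
def totalPoint (x : EuclideanSpace ℝ (Fin n)) (y : ∀ j, Fin (d j) → ℝ) : TotalSpace n d :=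
  WithLp.toLp 2 (Sum.elim (fun i => x i) fun p => y p.1 p.2)

@[simp] lemma baseProj_totalPoint (x : EuclideanSpace ℝ (Fin n)) (y : ∀ j, Fin (d j) → ℝ) :
    baseProj (totalPoint x y) = x := rfl

@[simp] lemma fibreCoord_totalPoint (x : EuclideanSpace ℝ (Fin n)) (y : ∀ j, Fin (d j) → ℝ) :
    fibreCoord (totalPoint x y) = y := rfl

lemma totalPoint_eta (z : TotalSpace n d) : totalPoint (baseProj z) (fibreCoord z) = z := by
  ext (i | ⟨j, a⟩) <;> rfl

lemma totalSpace_ext {z w : TotalSpace n d} (h : baseProj z = baseProj w)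
    (h' : ∀ j, fibreCoord z j = fibreCoord w j) : z = w := by
  rw [← totalPoint_eta z, ← totalPoint_eta w, h, funext h']

lemma continuous_baseProj : Continuous (baseProj : TotalSpace n d → _) :=
  (PiLp.continuous_toLp 2 _).comp (by fun_prop)

lemma continuous_totalPoint {Y : Type*} [TopologicalSpace Y] {x : Y → EuclideanSpace ℝ (Fin n)}
    {y : Y → ∀ j, Fin (d j) → ℝ} (hx : Continuous x) (hy : Continuous y) :
    Continuous fun p => (totalPoint (x p) (y p) : TotalSpace n d) := by
  refine (PiLp.continuous_toLp 2 _).comp (continuous_pi ?_)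
  rintro (i | ⟨j, a⟩)
  · have : Continuous fun v : EuclideanSpace ℝ (Fin n) => v i := by fun_prop
    exact this.comp hx
  · exact (continuous_apply a).comp ((continuous_apply j).comp hy)

/-- The bundle over `B` whose fibre over `x` is the product of the spheres with radii `r_j(x)`. -/
def sphereBundle (d : Fin L → ℕ) (B : Set (EuclideanSpace ℝ (Fin n)))
    (r : Fin L → EuclideanSpace ℝ (Fin n) → ℝ) : Set (TotalSpace n d) :=
  {z | baseProj z ∈ B ∧ ∀ j, ∑ a, fibreCoord z j a ^ 2 = r j (baseProj z) ^ 2}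

namespace CellDecomp

variable {B : Set (EuclideanSpace ℝ (Fin n))} (K : CellDecomp B)
  (r : Fin L → EuclideanSpace ℝ (Fin n) → ℝ)

/-- The coordinate `y_j` of the characteristic map of a cell of a sphere bundle. -/
def bundleCoord (sp : ∀ j, SphereChart (d j)) (A : Finset (Fin L)) (x : EuclideanSpace ℝ (Fin n))
    (w : (Σ j : A, Fin (d j - 1)) → ℝ) (j : Fin L) : Fin (d j) → ℝ :=
  r j x • if h : j ∈ A then (sp j).σ fun b => w ⟨⟨j, h⟩, b⟩ else (sp j).e

lemma bundleCoord_sum_sq (sp : ∀ j, SphereChart (d j)) (A : Finset (Fin L))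
    (x : EuclideanSpace ℝ (Fin n)) (w : (Σ j : A, Fin (d j - 1)) → ℝ) (j : Fin L) :
    ∑ a, bundleCoord r sp A x w j a ^ 2 = r j x ^ 2 := by
  simp only [bundleCoord, Pi.smul_apply, smul_eq_mul, mul_pow, ← Finset.mul_sum]
  split_ifs
  · rw [(sp j).sum_sq, mul_one]
  · rw [(sp j).base_sum_sq, mul_one]

/-- A sphere can be removed from the set A without moving the point when its radius is zero or its
parameter is on the boundary of the cube: in both cases y_j already equals the radius times the base
point. This identifies the carrier cells in the boundary of a cell. -/
lemma bundleCoord_restrict (sp : ∀ j, SphereChart (d j)) {A A₀ : Finset (Fin L)} (hsub : A₀ ⊆ A)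
    (x : EuclideanSpace ℝ (Fin n)) (w : (Σ j : A, Fin (d j - 1)) → ℝ) (hw : w ∈ closedCube _)
    (h : ∀ j (hj : j ∈ A), j ∉ A₀ → r j x = 0 ∨
      (fun b => w ⟨⟨j, hj⟩, b⟩) ∉ openCube (Fin (d j - 1))) (j : Fin L) :
    bundleCoord r sp A₀ x (fun p => w ⟨⟨p.1, hsub p.1.2⟩, p.2⟩) j = bundleCoord r sp A x w j := by
  simp only [bundleCoord]
  by_cases hj₀ : j ∈ A₀
  · simp only [hj₀, hsub hj₀, dite_true]
  · simp only [hj₀, dite_false]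
    by_cases hj : j ∈ A
    · simp only [hj, dite_true]
      rcases h j hj hj₀ with h | h
      · rw [h, zero_smul, zero_smul]
      · rw [(sp j).eq_base _ (fun b => hw ⟨⟨j, hj⟩, b⟩) h]
    · simp only [hj, dite_false]

set_option maxHeartbeats 1000000 in
/-- The decomposition of a sphere bundle over a decomposed set on each of whose cells each of the
radii vanishes or has no zeros. -/
def bundle (hc : ∀ j, Continuous (r j)) (sp : ∀ j, SphereChart (d j))
    (hr : ∀ i j, (∀ z ∈ openCube (K.κ i), 0 < r j (K.χ i z)) ∨
      ∀ z ∈ openCube (K.κ i), r j (K.χ i z) = 0) : CellDecomp (sphereBundle d B r) where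
  ι := Σ i : K.ι, {A : Finset (Fin L) // ∀ j ∈ A, ∀ z ∈ openCube (K.κ i), 0 < r j (K.χ i z)}
  κ i := K.κ i.1 ⊕ Σ j : i.2.1, Fin (d j - 1)
  fin i := inferInstance
  χ i z := totalPoint (K.χ i.1 (z ∘ Sum.inl))
    (bundleCoord r sp i.2.1 (K.χ i.1 (z ∘ Sum.inl)) (z ∘ Sum.inr))
  cont i := by
    have h1 : Continuous fun z : K.κ i.1 ⊕ (Σ j : i.2.1, Fin (d j - 1)) → ℝ =>
        K.χ i.1 (z ∘ Sum.inl) := (K.cont _).comp (by fun_prop)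
    refine continuous_totalPoint h1 (continuous_pi fun j => ((hc j).comp h1).smul ?_)
    by_cases h : j ∈ i.2.1
    · simp only [h, dite_true]
      exact (sp j).cont.comp (by fun_prop)
    · simp only [h, dite_false]
      fun_prop
  cover x := by
    constructor
    · rintro ⟨hx, hy⟩
      obtain ⟨i, z, hz, hzx⟩ := (K.cover _).1 hx
      classical
      -- The spheres in which the normalized point lies in the top cell. A sphere of radius zero
      -- counts as being at its base point, which makes the cells disjoint.
      let A : Finset (Fin L) := {j | (0 < r j (K.χ i z)) ∧
        (r j (K.χ i z))⁻¹ • fibreCoord x j ≠ (sp j).e}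
      have hA : ∀ j ∈ A, ∀ z ∈ openCube (K.κ i), 0 < r j (K.χ i z) := by
        intro j hj
        rcases hr i j with h | h
        · exact h
        · exact absurd (h z hz) ((Finset.mem_filter.1 hj).2.1).ne'
      have hw : ∀ j : A, ∃ w ∈ openCube (Fin (d j - 1)),
          (sp j).σ w = (r j (K.χ i z))⁻¹ • fibreCoord x j := by
        intro j
        refine (sp j).surj _ ?_ (Finset.mem_filter.1 j.2).2.2
        have := hy j
        rw [← hzx] at this
        simp only [Pi.smul_apply, smul_eq_mul, mul_pow, ← Finset.mul_sum, this]
        rw [← mul_pow, inv_mul_cancel₀ ((Finset.mem_filter.1 j.2).2.1).ne', one_pow]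
      choose w hw hw' using hw
      refine ⟨⟨i, A, hA⟩, Sum.elim z fun p => w p.1 p.2, ?_, ?_⟩
      · rintro (a | a)
        · exact hz a
        · exact hw a.1 a.2
      · refine totalSpace_ext hzx fun j => ?_
        simp only [fibreCoord_totalPoint, Sum.elim_comp_inl, bundleCoord, Function.comp_apply,
          Sum.elim_inr]
        split_ifs with h
        · rw [hw' ⟨j, h⟩, smul_inv_smul₀ ((Finset.mem_filter.1 h).2.1).ne']
        · rcases hr i j with h1 | h1
          · have h2 : (r j (K.χ i z))⁻¹ • fibreCoord x j = (sp j).e := by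
              by_contra h3
              exact h (Finset.mem_filter.2 ⟨Finset.mem_univ _, h1 z hz, h3⟩)
            rw [← h2, smul_inv_smul₀ (h1 z hz).ne']
          · have := hy j
            rw [← hzx, h1 z hz, zero_pow two_ne_zero,
              Finset.sum_eq_zero_iff_of_nonneg fun a _ => sq_nonneg _] at this
            rw [h1 z hz, zero_smul]
            funext a
            exact (pow_eq_zero_iff two_ne_zero |>.1 (this a (Finset.mem_univ _))).symm
    · rintro ⟨i, z, hz, rfl⟩
      exact ⟨(K.cover _).2 ⟨i.1, _, fun a => hz (Sum.inl a), rfl⟩,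
        fun j => bundleCoord_sum_sq r sp _ _ _ j⟩
  inj := by
    rintro ⟨i, A, hA⟩ z hz w hw h
    have h1 := K.inj i (fun a => hz (Sum.inl a)) (fun a => hw (Sum.inl a)) (congrArg baseProj h)
    funext p
    rcases p with a | ⟨j, b⟩
    · exact congrFun h1 a
    · have h2 := congrFun (congrArg fibreCoord h) j
      simp only [fibreCoord_totalPoint, bundleCoord] at h2
      rw [show z ∘ Sum.inl = w ∘ Sum.inl from h1] at h2
      simp only [j.2, dite_true] at h2
      have h3 := smul_right_injective _ (hA j j.2 _ fun a => hw (Sum.inl a)).ne' h2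
      exact congrFun ((sp j).inj (fun b => hz (Sum.inr ⟨j, b⟩)) (fun b => hw (Sum.inr ⟨j, b⟩)) h3) b
  disj := by
    rintro ⟨i, A, hA⟩ ⟨i', A', hA'⟩ z hz w hw h
    obtain rfl : i = i' := K.disj i i' _ (fun a => hz (Sum.inl a)) _ (fun a => hw (Sum.inl a))
      (congrArg baseProj h)
    have h1 := K.inj i (fun a => hz (Sum.inl a)) (fun a => hw (Sum.inl a)) (congrArg baseProj h)
    have h1 : z ∘ Sum.inl = w ∘ Sum.inl := h1
    have : A = A' := by
      ext j
      have h2 := congrFun (congrArg fibreCoord h) j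
      simp only [fibreCoord_totalPoint, bundleCoord] at h2
      rw [h1] at h2
      by_cases hj : j ∈ A <;> by_cases hj' : j ∈ A' <;> simp only [hj, hj', dite_true, dite_false]
        at h2 ⊢
      · have h3 := smul_right_injective _ (hA j hj _ fun a => hw (Sum.inl a)).ne' h2
        exact absurd h3 ((sp j).ne_base _ fun b => hz (Sum.inr ⟨⟨j, hj⟩, b⟩))
      · have h3 := smul_right_injective _ (hA' j hj' _ fun a => hw (Sum.inl a)).ne' h2
        exact absurd h3.symm ((sp j).ne_base _ fun b => hw (Sum.inr ⟨⟨j, hj'⟩, b⟩))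
    subst this
    rfl
  bdry := by
    rintro ⟨i, A, hA⟩ z hz hz'
    obtain ⟨i₀, z₀, hz₀, he, hc⟩ := K.bdry' i (z ∘ Sum.inl) fun a => hz (Sum.inl a)
    classical
    -- Of the spheres in A, those survive whose parameter is interior and whose radius is still
    -- positive on the new base cell.
    let A₀ : Finset (Fin L) := {j ∈ A | (∀ h : j ∈ A, (fun b => z (Sum.inr ⟨⟨j, h⟩, b⟩)) ∈
      openCube (Fin (d j - 1))) ∧ ∀ z ∈ openCube (K.κ i₀), 0 < r j (K.χ i₀ z)}
    have hmem : ∀ {j} (hj : j ∈ A), (fun b => z (Sum.inr ⟨⟨j, hj⟩, b⟩)) ∈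
        openCube (Fin (d j - 1)) → (∀ z ∈ openCube (K.κ i₀), 0 < r j (K.χ i₀ z)) → j ∈ A₀ :=
      fun hj ho h => Finset.mem_filter.2 ⟨hj, fun _ => ho, h⟩
    have hsub : ∀ {j}, j ∈ A₀ → j ∈ A := fun hj => (Finset.mem_filter.1 hj).1
    refine ⟨⟨i₀, A₀, fun j hj => (Finset.mem_filter.1 hj).2.2⟩,
      Sum.elim z₀ fun p => z (Sum.inr ⟨⟨p.1, hsub p.1.2⟩, p.2⟩), ?_, ?_, ?_⟩
    · rintro (a | ⟨j, b⟩)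
      · exact hz₀ a
      · exact (Finset.mem_filter.1 j.2).2.1 (hsub j.2) b
    · have hsum : ∀ A : Finset (Fin L), Nat.card (Σ j : A, Fin (d j - 1)) =
          ∑ j ∈ A, (d j - 1) := by
        intro A
        rw [Nat.card_sigma, ← Finset.sum_coe_sort A fun j => d j - 1]
        simp
      change Nat.card (K.κ i₀ ⊕ Σ j : A₀, Fin (d j - 1)) < Nat.card (K.κ i ⊕ Σ j : A, Fin (d j - 1))
      rw [Nat.card_sum, Nat.card_sum, hsum, hsum]
      have hle : ∑ j ∈ A₀, (d j - 1) ≤ ∑ j ∈ A, (d j - 1) :=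
        Finset.sum_le_sum_of_subset fun j hj => hsub hj
      -- Either the base cell drops in dimension, or the base parameter is interior and some sphere
      -- parameter is on the boundary. In the latter case that sphere leaves A, and it had positive
      -- dimension because it has the coordinate `b`.
      rcases hc with hc | ⟨rfl, hzo, -⟩
      · omega
      · obtain ⟨p, hp⟩ : ∃ p, ¬ |z p| < 1 := by
          by_contra h
          push Not at h
          exact hz' h
        rcases p with a | ⟨j, b⟩
        · exact absurd (hzo a) hp
        · have : ∑ j ∈ A₀, (d j - 1) < ∑ j ∈ A, (d j - 1) := by
            refine Finset.sum_lt_sum_of_subset (fun j hj => hsub hj) j.2 (fun hj => ?_) ?_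
              fun _ _ _ => Nat.zero_le _
            · exact hp ((Finset.mem_filter.1 hj).2.1 j.2 b)
            · exact (Nat.zero_le _).trans_lt b.2
          omega
    · refine totalSpace_ext he fun j => ?_
      change bundleCoord r sp A₀ (K.χ i₀ z₀) _ j =
        bundleCoord r sp A (K.χ i (z ∘ Sum.inl)) (z ∘ Sum.inr) j
      rw [he]
      refine bundleCoord_restrict r sp (fun _ hj => hsub hj) _ (z ∘ Sum.inr)
        (fun p => hz (Sum.inr p)) (fun j hj hj₀ => ?_) j
      rcases hr i₀ j with h | h
      · exact Or.inr fun ho => hj₀ (hmem hj ho h)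
      · exact Or.inl (he ▸ h z₀ hz₀)
  locfin z := by
    obtain ⟨U, hU, hfin⟩ := K.locfin (baseProj z)
    refine ⟨baseProj ⁻¹' U, continuous_baseProj.continuousAt hU, ?_⟩
    refine (hfin.preimage' (f := fun i : Σ i : K.ι, {A : Finset (Fin L) // ∀ j ∈ A,
      ∀ z ∈ openCube (K.κ i), 0 < r j (K.χ i z)} => i.1) fun i _ => ?_).subset ?_
    · refine (Set.finite_range fun A => (⟨i, A⟩ : Σ i : K.ι, {A : Finset (Fin L) // ∀ j ∈ A,
        ∀ z ∈ openCube (K.κ i), 0 < r j (K.χ i z)})).subset ?_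
      rintro ⟨i', A⟩ rfl
      exact ⟨A, rfl⟩
    · rintro ⟨i, A⟩ ⟨_, ⟨w, hw, rfl⟩, hwU⟩
      exact ⟨_, ⟨_, fun a => hw (Sum.inl a), rfl⟩, hwU⟩

lemma card_bundle_le (hc : ∀ j, Continuous (r j)) (sp : ∀ j, SphereChart (d j))
    (hr : ∀ i j, (∀ z ∈ openCube (K.κ i), 0 < r j (K.χ i z)) ∨
      ∀ z ∈ openCube (K.κ i), r j (K.χ i z) = 0) (i : (K.bundle r hc sp hr).ι) :
    Nat.card ((K.bundle r hc sp hr).κ i) ≤ Nat.card (K.κ i.1) + ∑ j, (d j - 1) := by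
  change Nat.card (K.κ i.1 ⊕ Σ j : i.2.1, Fin (d j - 1)) ≤ _
  rw [Nat.card_sum, Nat.card_sigma]
  simp only [Nat.card_eq_fintype_card, Fintype.card_fin]
  rw [Finset.sum_coe_sort i.2.1 fun j => d j - 1]
  gcongr
  exact Finset.subset_univ _

end CellDecomp

end

lemma hasCWDimLE_sphereBundle {n L : ℕ} {d : Fin L → ℕ} (hd : ∀ j, 0 < d j)
    {B : Set (EuclideanSpace ℝ (Fin n))} (K : CellDecomp B)
    (r : Fin L → EuclideanSpace ℝ (Fin n) → ℝ) (hc : ∀ j, Continuous (r j))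
    (hr : ∀ i j, (∀ z ∈ openCube (K.κ i), 0 < r j (K.χ i z)) ∨
      ∀ z ∈ openCube (K.κ i), r j (K.χ i z) = 0) {N m : ℕ} (hN : ∀ i, Nat.card (K.κ i) ≤ N)
    (hm : N + ∑ j, (d j - 1) ≤ m) : HasCWDimLE (sphereBundle d B r) m :=
  (K.bundle r hc (fun j => (nonempty_sphereChart (hd j)).some) hr).hasCWDimLE fun i =>
    (K.card_bundle_le r hc _ hr i).trans ((Nat.add_le_add_right (hN _) _).trans hm)

end HypRAG

/-! ### Polynomial functions, tangent spaces of level sets, separation of components -/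

namespace HypRAG

open Topology Filter

lemma contDiff_polyFun {ι : Type} [Fintype ι] (P : MvPolynomial ι ℝ) :
    ContDiff ℝ ω (polyFun P) := by
  have h1 : ContDiff ℝ ω fun x : ι → ℝ => MvPolynomial.eval x P :=
    (AnalyticOnNhd.eval_mvPolynomial P).contDiff
  have h2 : ContDiff ℝ ω fun x : EuclideanSpace ℝ ι => fun i => x i := by fun_prop
  exact h1.comp h2

lemma continuous_polyFun {ι : Type} [Fintype ι] (P : MvPolynomial ι ℝ) :
    Continuous (polyFun P) := (contDiff_polyFun P).continuous

lemma differentiable_polyFun {ι : Type} [Fintype ι] (P : MvPolynomial ι ℝ) :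
    Differentiable ℝ (polyFun P) := (contDiff_polyFun P).differentiable (by simp)

/-- Linearly independent functionals have linearly independent values. -/
lemma surjective_of_linearIndependent {V κ : Type} [AddCommGroup V] [Module ℝ V] [Fintype κ]
    {φ : κ → V →ₗ[ℝ] ℝ} (h : LinearIndependent ℝ φ) :
    Function.Surjective fun v j => φ j v := by
  classical
  set T : V →ₗ[ℝ] κ → ℝ := LinearMap.pi φ with hT
  change Function.Surjective T
  rw [← LinearMap.range_eq_top]
  by_contra hne
  -- If the range were proper, a nonzero functional would vanish on it, and its values on the
  -- standard basis would be a linear relation between the φ_j.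
  obtain ⟨g, hg, hker⟩ := Submodule.exists_le_ker_of_lt_top _ (lt_top_iff_ne_top.2 hne)
  apply hg
  have hz : ∀ j, g (Pi.single j 1) = 0 := by
    refine Fintype.linearIndependent_iff.1 h _ ?_
    ext v
    have : g (T v) = 0 := hker ⟨v, rfl⟩
    rw [LinearMap.pi_apply_eq_sum_univ] at this
    have hsingle : ∀ x, (Pi.single x (1 : ℝ) : κ → ℝ) = fun j => if x = j then 1 else 0 := by
      intro x; ext j; simp [Pi.single_apply, eq_comm]
    simpa [hT, mul_comm, hsingle] using this
  refine LinearMap.pi_ext' fun j => ?_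
  ext
  simpa using hz j

lemma surjective_of_linearIndependent' {V κ : Type} [NormedAddCommGroup V] [NormedSpace ℝ V]
    [Fintype κ] {φ : κ → V →L[ℝ] ℝ} (h : LinearIndependent ℝ φ) :
    Function.Surjective fun v j => φ j v := by
  refine surjective_of_linearIndependent (φ := fun j => (φ j : V →ₗ[ℝ] ℝ)) ?_
  exact h.map' (ContinuousLinearMap.coeLM ℝ : (V →L[ℝ] ℝ) →ₗ[ℝ] V →ₗ[ℝ] ℝ)
    (LinearMap.ker_eq_bot.2 ContinuousLinearMap.coe_injective)

section

variable {E : Type} [NormedAddCommGroup E] [NormedSpace ℝ E]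
variable {G : Type} [NormedAddCommGroup G] [NormedSpace ℝ G] [FiniteDimensional ℝ G]

/-- Every vector in the kernel of the derivative is the velocity of a curve in the level set. -/
lemma exists_curve_of_mem_ker {F : E → G} {p v : E} (hF : ContDiffAt ℝ ω F p)
    (hs : Function.Surjective (fderiv ℝ F p)) (hp : F p = 0) (hv : fderiv ℝ F p v = 0) :
    ∃ γ : ℝ → E, ContDiffAt ℝ ω γ 0 ∧ γ 0 = p ∧ HasDerivAt γ v 0 ∧ ∀ᶠ s in 𝓝 0, F (γ s) = 0 := by
  obtain ⟨B₀, hB₀⟩ := (fderiv ℝ F p : E →ₗ[ℝ] G).exists_rightInverse_of_surjective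
    (LinearMap.range_eq_top.2 hs)
  set B : G →L[ℝ] E := LinearMap.toContinuousLinearMap B₀
  have hB : ∀ w, fderiv ℝ F p (B w) = w := fun w => LinearMap.congr_fun hB₀ w
  let A : ℝ × G →L[ℝ] E := (ContinuousLinearMap.fst ℝ ℝ G).smulRight v +
    B.comp (ContinuousLinearMap.snd ℝ ℝ G)
  have hA : ∀ q, A q = q.1 • v + B q.2 := fun q => by simp [A]
  -- Here p + A(s, w) = p + s v + B w with B a right inverse of dF. Since dF(v) = 0, the derivative
  -- of Θ at 0 is the identity, and the curve is p + A(Θ⁻¹(s, 0)).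
  let Θ : ℝ × G → ℝ × G := fun q => (q.1, F (p + A q))
  have hpA : p + A 0 = p := by simp
  have hd : HasFDerivAt Θ ((ContinuousLinearEquiv.refl ℝ (ℝ × G) : ℝ × G →L[ℝ] ℝ × G)) 0 := by
    have h1 : HasFDerivAt F (fderiv ℝ F p) (p + A 0) := by
      rw [hpA]; exact (hF.differentiableAt (by simp)).hasFDerivAt
    have h2 : HasFDerivAt (fun q => p + A q) A 0 := A.hasFDerivAt.const_add p
    have h3 := (hasFDerivAt_fst (𝕜 := ℝ) (E := ℝ) (F := G) (p := 0)).prodMk (h1.comp 0 h2)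
    refine h3.congr_fderiv ?_
    ext q <;> simp [hA, hv, hB]
  have hΘ : ContDiffAt ℝ ω Θ 0 := by
    have h1 : ContDiffAt ℝ ω F (p + A 0) := by rwa [hpA]
    have h2 : ContDiffAt ℝ ω (fun q => p + A q) 0 := (contDiff_const.add A.contDiff).contDiffAt
    exact contDiffAt_fst.prodMk (h1.comp 0 h2)
  have hΘ0 : Θ 0 = 0 := by simp [Θ, hp]
  have hω : (ω : WithTop ℕ∞) ≠ 0 := by simp
  let Ψ := hΘ.localInverse hd hω
  have hΨ0 : Ψ 0 = 0 := by
    have := hΘ.localInverse_apply_image hd hω; rwa [hΘ0] at this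
  have hΨ : ContDiffAt ℝ ω Ψ 0 := by
    have := hΘ.to_localInverse hd hω; rwa [hΘ0] at this
  have hinv : ∀ᶠ q in 𝓝 0, Θ (Ψ q) = q := by
    have := (hΘ.hasStrictFDerivAt' hd hω).eventually_right_inverse; rwa [hΘ0] at this
  have hΨd : HasFDerivAt Ψ (ContinuousLinearMap.id ℝ (ℝ × G)) 0 := by
    have := (hΘ.hasStrictFDerivAt' hd hω).to_localInverse.hasFDerivAt
    rw [hΘ0] at this
    exact this.congr_fderiv (by ext <;> simp)
  let ι : ℝ → ℝ × G := fun s => (s, 0)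
  have hι : ContDiff ℝ ω ι := contDiff_id.prodMk contDiff_const
  have hι0 : ι 0 = 0 := rfl
  have hιd : HasDerivAt ι (1, 0) 0 := (hasDerivAt_id 0).prodMk (hasDerivAt_const 0 0)
  refine ⟨fun s => p + A (Ψ (ι s)), ?_, ?_, ?_, ?_⟩
  · have hΨι : ContDiffAt ℝ ω (fun s => Ψ (ι s)) 0 :=
      ContDiffAt.comp (g := Ψ) (0 : ℝ) (by rwa [hι0]) hι.contDiffAt
    exact contDiffAt_const.add (A.contDiff.contDiffAt.comp 0 hΨι)
  · simp [hι0, hΨ0]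
  · have h1 : HasDerivAt (Ψ ∘ ι) ((1 : ℝ), (0 : G)) 0 :=
      HasFDerivAt.comp_hasDerivAt (l := Ψ) 0 (l' := ContinuousLinearMap.id ℝ (ℝ × G)) hΨd hιd
    have h2 := (A.hasFDerivAt.comp_hasDerivAt 0 h1).const_add p
    simpa [hA] using h2
  · have : Tendsto ι (𝓝 0) (𝓝 0) := hι.continuous.continuousAt
    filter_upwards [this.eventually hinv] with s hs
    exact congrArg Prod.snd hs

/-- The tangent space of a regular level set is the kernel of the derivative. -/
lemma tangentSpaceAt_eq_ker {N U : Set E} {F : E → G} {p : E} (hU : U ∈ 𝓝 p)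
    (hF : ContDiffAt ℝ ω F p) (hs : Function.Surjective (fderiv ℝ F p))
    (hN : N ∩ U = {x ∈ U | F x = 0}) (hp : p ∈ N) :
    tangentSpaceAt N p = LinearMap.ker (fderiv ℝ F p : E →ₗ[ℝ] G) := by
  have hmem : ∀ x ∈ U, x ∈ N ↔ F x = 0 := fun x hx => by
    have := Set.ext_iff.1 hN x
    simp only [mem_inter_iff, mem_ofPred_eq, hx, and_true, true_and] at this
    exact this
  have hFp : F p = 0 := (hmem p (mem_of_mem_nhds hU)).1 hp
  apply le_antisymm
  · refine Submodule.span_le.2 ?_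
    rintro v ⟨ε, γ, hε, -, hγN, hγ0, hγ⟩
    have h1 : HasFDerivAt F (fderiv ℝ F p) (γ 0) := by
      rw [hγ0]; exact (hF.differentiableAt (by simp)).hasFDerivAt
    have h2 := h1.comp_hasDerivAt 0 hγ
    have h3 : F ∘ γ =ᶠ[𝓝 0] fun _ => 0 := by
      have hU' : ∀ᶠ s in 𝓝 0, γ s ∈ U := hγ.continuousAt (by rwa [hγ0])
      filter_upwards [hU', Ioo_mem_nhds (neg_lt_zero.2 hε) hε] with s hs hs'
      exact (hmem _ hs).1 (hγN s hs')
    exact (h2.congr_of_eventuallyEq h3.symm).unique (hasDerivAt_const 0 (0 : G))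
  · intro v hv
    obtain ⟨γ, hγc, hγ0, hγd, hγF⟩ := exists_curve_of_mem_ker hF hs hFp hv
    have hU' : ∀ᶠ s in 𝓝 0, γ s ∈ U := hγd.continuousAt (by rwa [hγ0])
    -- Analyticity at a point passes to a neighbourhood, which `ContDiffAt ℝ ∞` at a point would
    -- not; hence the regularity ω.
    obtain ⟨ε, hε, h⟩ := Metric.eventually_nhds_iff.1
      ((hγc.eventually (by simp)).and (hU'.and hγF))
    have h' : ∀ s ∈ Ioo (-ε) ε, dist s 0 < ε := fun s hs => by
      rw [Real.dist_eq, sub_zero]; exact abs_lt.2 hs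
    refine Submodule.subset_span ⟨ε, γ, hε, fun s hs => ?_, fun s hs => ?_, hγ0, hγd⟩
    · exact ((h (h' s hs)).1.of_le (by simp)).contDiffWithinAt
    · exact (hmem _ (h (h' s hs)).2.1).2 (h (h' s hs)).2.2

end

/-- A relatively clopen subset contains the connected components of its points. -/
lemma connectedComponentIn_subset_of_separation {X : Type} [TopologicalSpace X] {Z S U V : Set X}
    (hU : IsOpen U) (hV : IsOpen V) (hUV : Disjoint U V) (hZ : Z ⊆ U ∪ V) (hS : Z ∩ U ⊆ S) {p : X}
    (hpZ : p ∈ Z) (hpU : p ∈ U) : connectedComponentIn Z p ⊆ S := fun _ hx =>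
  hS ⟨connectedComponentIn_subset Z p hx,
    IsPreconnected.subset_left_of_subset_union hU hV hUV
      ((connectedComponentIn_subset Z p).trans hZ) ⟨p, mem_connectedComponentIn hpZ, hpU⟩
      isPreconnected_connectedComponentIn hx⟩

end HypRAG

/-! ### Regular domains: smoothness and singular points of the total manifold -/

namespace HypRAG

open Topology Filter

/-- A regular level set is a smooth submanifold. -/
lemma isSmoothSubmanifold_of_levelSet {E : Type} [NormedAddCommGroup E] [NormedSpace ℝ E]
    {κ : Type} [Fintype κ] {N : Set E} {g : E → κ → ℝ} {d : ℕ} (hg : ContDiff ℝ ∞ g)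
    (hs : ∀ p ∈ N, Function.Surjective (fderiv ℝ g p)) (hN : ∀ x, x ∈ N ↔ g x = 0)
    (hd : Fintype.card κ + d = Module.finrank ℝ E) : IsSmoothSubmanifold N d := by
  intro p hp
  let e : (κ → ℝ) ≃L[ℝ] EuclideanSpace ℝ (Fin (Fintype.card κ)) :=
    (ContinuousLinearEquiv.piCongrLeft ℝ (fun _ => ℝ) (Fintype.equivFin κ)).trans
      (EuclideanSpace.equiv _ ℝ).symm
  refine ⟨univ, isOpen_univ, mem_univ _, _, hd, fun x => e (g x),
    (e.contDiff.comp hg).contDiffOn, ?_, ?_⟩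
  · have : fderiv ℝ (fun x => e (g x)) p = (e : _ →L[ℝ] _).comp (fderiv ℝ g p) :=
      (e.hasFDerivAt.comp p (hg.differentiable (by simp) p).hasFDerivAt).fderiv
    rw [this]
    exact e.surjective.comp (hs p hp)
  · ext x
    simp [hN]

section

variable {n L : ℕ} {d : Fin L → ℕ}

/-- The projection to the base as a continuous linear map. -/
def baseProjL : TotalSpace n d →L[ℝ] EuclideanSpace ℝ (Fin n) :=
  LinearMap.toContinuousLinearMap
    { toFun := baseProj, map_add' := fun _ _ => rfl, map_smul' := fun _ _ => rfl }

@[simp] lemma baseProjL_apply (z : TotalSpace n d) : baseProjL z = baseProj z := rfl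

lemma fderiv_baseProj (z : TotalSpace n d) : fderiv ℝ baseProj z = baseProjL :=
  baseProjL.hasFDerivAt.fderiv

lemma polyFun_totalPoly (f : Fin L → MvPolynomial (Fin n) ℝ) (j : Fin L) (z : TotalSpace n d) :
    polyFun (totalPoly f d j) z = polyFun (f j) (baseProj z) - ∑ a, fibreCoord z j a ^ 2 := by
  simp only [polyFun, totalPoly, map_sub, MvPolynomial.eval_rename, map_sum, map_pow,
    MvPolynomial.eval_X]
  rfl

lemma fderiv_polyFun_totalPoly (f : Fin L → MvPolynomial (Fin n) ℝ) (j : Fin L)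
    (z v : TotalSpace n d) :
    fderiv ℝ (polyFun (totalPoly f d j)) z v =
      fderiv ℝ (polyFun (f j)) (baseProj z) (baseProj v) -
        2 * ∑ a, fibreCoord z j a * fibreCoord v j a := by
  have h1 : HasFDerivAt (fun z : TotalSpace n d => polyFun (f j) (baseProj z))
      ((fderiv ℝ (polyFun (f j)) (baseProj z)).comp baseProjL) z :=
    (differentiable_polyFun (f j) (baseProj z)).hasFDerivAt.comp z baseProjL.hasFDerivAt
  let c : Fin (d j) → TotalSpace n d →L[ℝ] ℝ := fun a => EuclideanSpace.proj (Sum.inr ⟨j, a⟩)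
  have h2 : HasFDerivAt (fun z : TotalSpace n d => ∑ a, fibreCoord z j a ^ 2)
      (∑ a, (2 * fibreCoord z j a) • c a) z := by
    refine HasFDerivAt.fun_sum fun a _ => ?_
    have := ((c a).hasFDerivAt (x := z)).pow 2
    simpa [c, fibreCoord] using this
  have h3 : polyFun (totalPoly f d j) = fun z : TotalSpace n d =>
      polyFun (f j) (baseProj z) - ∑ a, fibreCoord z j a ^ 2 := funext (polyFun_totalPoly f j)
  rw [h3, (h1.fun_sub h2).fderiv]
  simp only [_root_.sub_apply, ContinuousLinearMap.comp_apply, baseProjL_apply,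
    _root_.sum_apply, _root_.smul_apply, smul_eq_mul, Finset.mul_sum]
  congr 1
  exact Finset.sum_congr rfl fun a _ => by simp [c, fibreCoord]; ring

/-- `D` is given by strict inequalities `f_j > 0`, its closure by `f_j ≥ 0`, and at each point of
the closure the differentials of the vanishing `f_j` are linearly independent. -/
structure IsRegularDomain (D : Set (EuclideanSpace ℝ (Fin n)))
    (f : Fin L → MvPolynomial (Fin n) ℝ) : Prop where
  eq_inter : D = {x | ∀ j, 0 < polyFun (f j) x}
  closure_eq : closure D = {x | ∀ j, 0 ≤ polyFun (f j) x}
  indep : ∀ p ∈ closure D, ∀ g : Fin L → ℝ, (∀ j, polyFun (f j) p ≠ 0 → g j = 0) →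
    ∑ j, g j • fderiv ℝ (polyFun (f j)) p = 0 → g = 0

/-- The radii of the spheres in the fibres of the total space. -/
def radius (f : Fin L → MvPolynomial (Fin n) ℝ) (j : Fin L) (x : EuclideanSpace ℝ (Fin n)) : ℝ :=
  √(polyFun (f j) x)

lemma continuous_radius (f : Fin L → MvPolynomial (Fin n) ℝ) (j : Fin L) :
    Continuous (radius f j) :=
  (continuous_polyFun _).sqrt

namespace IsRegularDomain

variable {D : Set (EuclideanSpace ℝ (Fin n))} {f : Fin L → MvPolynomial (Fin n) ℝ}

/-- The condition on the base point is automatic: the equations make each f_j a sum of squares, and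
the closure is given by f_j ≥ 0. So M is the whole zero set. -/
lemma mem_totalManifold_iff (h : IsRegularDomain D f) {z : TotalSpace n d} :
    z ∈ totalManifold D f d ↔ ∀ j, polyFun (f j) (baseProj z) = ∑ a, fibreCoord z j a ^ 2 := by
  simp only [totalManifold, zeroSet, mem_ofPred_eq, polyFun_totalPoly, sub_eq_zero]
  refine ⟨fun hz => hz.2, fun hz => ⟨?_, hz⟩⟩
  rw [h.closure_eq]
  intro j
  rw [hz j]
  exact Finset.sum_nonneg fun a _ => sq_nonneg _

lemma totalManifold_eq_zeroSet (h : IsRegularDomain D f) : totalManifold D f d = zeroSet (totalPoly f d) := by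
  ext z
  rw [h.mem_totalManifold_iff]
  simp only [zeroSet, mem_ofPred_eq, polyFun_totalPoly, sub_eq_zero]

lemma totalManifold_inter_preimage (h : IsRegularDomain D f) (B : Set (EuclideanSpace ℝ (Fin n))) :
    totalManifold D f d ∩ baseProj ⁻¹' B = sphereBundle d (closure D ∩ B) (radius f) := by
  ext z
  rw [mem_inter_iff, h.mem_totalManifold_iff]
  constructor
  · rintro ⟨hz, hzB⟩
    refine ⟨⟨(h.mem_totalManifold_iff.2 hz).1, hzB⟩, fun j => ?_⟩
    rw [radius, Real.sq_sqrt, hz j]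
    rw [hz j]
    exact Finset.sum_nonneg fun a _ => sq_nonneg _
  · rintro ⟨⟨hz, hzB⟩, hy⟩
    rw [h.closure_eq] at hz
    refine ⟨fun j => ?_, hzB⟩
    rw [hy j, radius, Real.sq_sqrt (hz j)]

lemma fibreCoord_eq_zero (h : IsRegularDomain D f) {z : TotalSpace n d} (hz : z ∈ totalManifold D f d) {j : Fin L}
    (hj : polyFun (f j) (baseProj z) = 0) (a : Fin (d j)) : fibreCoord z j a = 0 := by
  have := h.mem_totalManifold_iff.1 hz j
  rw [hj, eq_comm, Finset.sum_eq_zero_iff_of_nonneg fun a _ => sq_nonneg _] at this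
  exact pow_eq_zero_iff two_ne_zero |>.1 (this a (Finset.mem_univ _))

/-- Evaluating a relation at the vertical vector (0, y_j) gives -2 g_j f_j = 0, so only the j with
f_j = 0 remain. Horizontal vectors turn it into a relation between the df_j, and regularity of the
domain applies. -/
lemma linearIndependent_fderiv (h : IsRegularDomain D f) {z : TotalSpace n d} (hz : z ∈ totalManifold D f d) :
    LinearIndependent ℝ fun j => fderiv ℝ (polyFun (totalPoly f d j)) z := by
  rw [Fintype.linearIndependent_iff]
  intro g hg
  refine congrFun (h.indep (baseProj z) hz.1 g (fun j hj => ?_) ?_)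
  · have h1 := congrArg (fun φ : TotalSpace n d →L[ℝ] ℝ =>
      φ (totalPoint 0 (Pi.single j (fibreCoord z j)))) hg
    simp only [_root_.sum_apply, _root_.smul_apply, smul_eq_mul,
      fderiv_polyFun_totalPoly, baseProj_totalPoint, fibreCoord_totalPoint, map_zero, zero_sub,
      _root_.zero_apply] at h1
    rw [Finset.sum_eq_single j] at h1
    · rw [Pi.single_eq_same] at h1
      have h2 := h.mem_totalManifold_iff.1 hz j
      simp only [← pow_two, ← h2] at h1
      rcases mul_eq_zero.1 h1 with h3 | h3
      · exact h3
      · exact absurd (by linarith) hj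
    · intro i _ hij
      simp [Pi.single_eq_of_ne hij]
    · simp
  · ext v
    have h1 := congrArg (fun φ : TotalSpace n d →L[ℝ] ℝ => φ (totalPoint v 0)) hg
    simpa [fderiv_polyFun_totalPoly] using h1

/-- The map given by the polynomials `f_j(x) - ‖y_j‖²`. -/
def _root_.HypRAG.totalMap (f : Fin L → MvPolynomial (Fin n) ℝ) (d : Fin L → ℕ)
    (z : TotalSpace n d) (j : Fin L) : ℝ :=
  polyFun (totalPoly f d j) z

lemma _root_.HypRAG.contDiff_totalMap (f : Fin L → MvPolynomial (Fin n) ℝ) (d : Fin L → ℕ) :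
    ContDiff ℝ ω (totalMap f d) :=
  contDiff_pi.2 fun j => contDiff_polyFun (totalPoly f d j)

lemma _root_.HypRAG.fderiv_totalMap (z v : TotalSpace n d) (j : Fin L) :
    fderiv ℝ (totalMap f d) z v j = fderiv ℝ (polyFun (totalPoly f d j)) z v := by
  have : totalMap f d = fun z j => polyFun (totalPoly f d j) z := rfl
  rw [this, fderiv_pi fun j => differentiable_polyFun _ _]
  rfl

lemma surjective_fderiv_totalMap (h : IsRegularDomain D f) {z : TotalSpace n d} (hz : z ∈ totalManifold D f d) :
    Function.Surjective (fderiv ℝ (totalMap f d) z) := by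
  intro w
  obtain ⟨v, hv⟩ := surjective_of_linearIndependent' (h.linearIndependent_fderiv hz) w
  exact ⟨v, funext fun j => (fderiv_totalMap z v j).trans (congrFun hv j)⟩

lemma mem_totalManifold_iff_totalMap (h : IsRegularDomain D f) {z : TotalSpace n d} :
    z ∈ totalManifold D f d ↔ totalMap f d z = 0 := by
  rw [h.totalManifold_eq_zeroSet, funext_iff]
  rfl

lemma mem_tangentSpaceAt_iff (h : IsRegularDomain D f) {z : TotalSpace n d} (hz : z ∈ totalManifold D f d)
    {v : TotalSpace n d} :
    v ∈ tangentSpaceAt (totalManifold D f d) z ↔ fderiv ℝ (totalMap f d) z v = 0 := by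
  rw [tangentSpaceAt_eq_ker (U := univ) univ_mem (contDiff_totalMap f d).contDiffAt
    (h.surjective_fderiv_totalMap hz) ?_ hz]
  · rfl
  · ext z
    simp [h.mem_totalManifold_iff_totalMap]

/-- The image of the tangent space in the base. -/
lemma exists_tangent_iff (h : IsRegularDomain D f) {z : TotalSpace n d} (hz : z ∈ totalManifold D f d)
    {u : EuclideanSpace ℝ (Fin n)} :
    (∃ v ∈ tangentSpaceAt (totalManifold D f d) z, baseProj v = u) ↔
      ∀ j, polyFun (f j) (baseProj z) = 0 → fderiv ℝ (polyFun (f j)) (baseProj z) u = 0 := by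
  constructor
  · rintro ⟨v, hv, rfl⟩ j hj
    have h1 := congrFun ((h.mem_tangentSpaceAt_iff hz).1 hv) j
    rw [fderiv_totalMap, fderiv_polyFun_totalPoly] at h1
    simpa [h.fibreCoord_eq_zero hz hj] using h1
  · intro hu
    -- Rescaling y_j at the rate df_j(u) / (2 f_j) keeps ‖y_j‖² = f_j to first order. Where f_j = 0
    -- the vector y_j vanishes and nothing is needed beyond df_j(u) = 0.
    refine ⟨totalPoint u fun j => (fderiv ℝ (polyFun (f j)) (baseProj z) u /
      (2 * polyFun (f j) (baseProj z))) • fibreCoord z j,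
      (h.mem_tangentSpaceAt_iff hz).2 (funext fun j => ?_), rfl⟩
    rw [fderiv_totalMap, fderiv_polyFun_totalPoly]
    simp only [baseProj_totalPoint, fibreCoord_totalPoint, Pi.smul_apply, smul_eq_mul,
      Pi.zero_apply]
    have h1 : ∀ c, ∑ a, fibreCoord z j a * (c * fibreCoord z j a) =
        c * polyFun (f j) (baseProj z) := by
      intro c
      rw [h.mem_totalManifold_iff.1 hz j, Finset.mul_sum]
      exact Finset.sum_congr rfl fun a _ => by ring
    rw [h1]
    by_cases hj : polyFun (f j) (baseProj z) = 0
    · rw [hu j hj, hj]; simp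
    · field_simp; ring

lemma not_mem_of_polyFun_eq_zero (h : IsRegularDomain D f) {x : EuclideanSpace ℝ (Fin n)} {j : Fin L}
    (hj : polyFun (f j) x = 0) : x ∉ D := by
  rw [h.eq_inter]
  exact fun hx => (hx j).ne' hj

lemma exists_polyFun_eq_zero (h : IsRegularDomain D f) {x : EuclideanSpace ℝ (Fin n)} (hx : x ∈ closure D) (hxD : x ∉ D) :
    ∃ j, polyFun (f j) x = 0 := by
  rw [h.closure_eq] at hx
  rw [h.eq_inter] at hxD
  simp only [mem_ofPred_eq, not_forall, not_lt] at hxD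
  obtain ⟨j, hj⟩ := hxD
  exact ⟨j, le_antisymm hj (hx j)⟩

lemma fderiv_ne_zero (h : IsRegularDomain D f) {x : EuclideanSpace ℝ (Fin n)} (hx : x ∈ closure D) {j : Fin L}
    (hj : polyFun (f j) x = 0) : fderiv ℝ (polyFun (f j)) x ≠ 0 := by
  intro h0
  have := h.indep x hx (Pi.single j 1) (fun i hi => ?_) ?_
  · have := congrFun this j
    simp at this
  · exact Pi.single_eq_of_ne (fun hij => hi (by rw [hij]; exact hj)) _
  · refine Finset.sum_eq_zero fun i _ => ?_
    by_cases hij : i = j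
    · rw [hij, h0, smul_zero]
    · rw [Pi.single_eq_of_ne hij, zero_smul]

lemma exists_totalManifold (h : IsRegularDomain D f) (hd : ∀ j, 0 < d j) {x : EuclideanSpace ℝ (Fin n)}
    (hx : x ∈ closure D) : ∃ z ∈ totalManifold D f d, baseProj z = x := by
  refine ⟨totalPoint x fun j => Pi.single ⟨0, hd j⟩ (radius f j x), ?_, rfl⟩
  rw [h.mem_totalManifold_iff]
  intro j
  rw [h.closure_eq] at hx
  rw [baseProj_totalPoint, fibreCoord_totalPoint, Finset.sum_eq_single ⟨0, hd j⟩]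
  · rw [Pi.single_eq_same, radius, Real.sq_sqrt (hx j)]
  · intro a _ ha
    rw [Pi.single_eq_of_ne ha, zero_pow two_ne_zero]
  · simp

lemma image_baseProj (h : IsRegularDomain D f) (hd : ∀ j, 0 < d j) :
    baseProj '' totalManifold D f d = closure D := by
  ext x
  constructor
  · rintro ⟨z, hz, rfl⟩
    exact hz.1
  · intro hx
    exact h.exists_totalManifold hd hx

/-- The image of the tangent space is the common kernel of the vanishing df_j, which is everything
unless some f_j vanishes; a vanishing f_j has nonzero differential there. -/
lemma mem_singularSet_baseProj_iff (h : IsRegularDomain D f) {m : ℕ} (hm : n ≤ m) {z : TotalSpace n d} :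
    z ∈ singularSet (totalManifold D f d) m baseProj ↔
      z ∈ totalManifold D f d ∧ baseProj z ∉ D := by
  simp only [singularSet, mem_ofPred_eq]
  refine and_congr_right fun hz => ?_
  rw [finrank_euclideanSpace, Fintype.card_fin, min_eq_right hm, fderiv_baseProj]
  set W := (tangentSpaceAt (totalManifold D f d) z).map
    ((baseProjL : TotalSpace n d →L[ℝ] EuclideanSpace ℝ (Fin n)) :
      TotalSpace n d →ₗ[ℝ] EuclideanSpace ℝ (Fin n)) with hW
  have hmem : ∀ u, u ∈ W ↔ ∀ j, polyFun (f j) (baseProj z) = 0 →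
      fderiv ℝ (polyFun (f j)) (baseProj z) u = 0 := fun u => by
    rw [← h.exists_tangent_iff hz]
    rfl
  have hlt : Module.finrank ℝ W < n ↔ W ≠ ⊤ := by
    rw [← not_le, not_iff_not]
    constructor
    · intro hle
      refine Submodule.eq_top_of_finrank_eq (le_antisymm (Submodule.finrank_le _) ?_)
      rwa [finrank_euclideanSpace, Fintype.card_fin]
    · intro htop
      rw [htop, finrank_top, finrank_euclideanSpace, Fintype.card_fin]
  rw [hlt]
  constructor
  · intro hne hzD
    apply hne
    rw [eq_top_iff]
    intro u _
    rw [hmem]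
    exact fun j hj => absurd hzD (h.not_mem_of_polyFun_eq_zero hj)
  · intro hzD htop
    obtain ⟨j, hj⟩ := h.exists_polyFun_eq_zero hz.1 hzD
    refine h.fderiv_ne_zero hz.1 hj ?_
    ext u
    exact (hmem u).1 (htop ▸ Submodule.mem_top) j hj

/-- A point of the total space is singular for a linear function of the base if and only if the
function vanishes on the common kernel of the differentials of the vanishing `f_j`. -/
lemma mem_singularSet_linear_iff (h : IsRegularDomain D f) {m : ℕ} (hm : 0 < m) (φ : EuclideanSpace ℝ (Fin n) →L[ℝ] ℝ)
    {z : TotalSpace n d} :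
    z ∈ singularSet (totalManifold D f d) m (fun z => φ (baseProj z)) ↔
      z ∈ totalManifold D f d ∧ ∀ u, (∀ j, polyFun (f j) (baseProj z) = 0 →
        fderiv ℝ (polyFun (f j)) (baseProj z) u = 0) → φ u = 0 := by
  simp only [singularSet, mem_ofPred_eq]
  refine and_congr_right fun hz => ?_
  have hf : fderiv ℝ (fun z : TotalSpace n d => φ (baseProj z)) z = φ.comp baseProjL :=
    (φ.comp baseProjL).hasFDerivAt.fderiv
  rw [Module.finrank_self, min_eq_right (Nat.succ_le_of_lt hm), hf, Nat.lt_one_iff,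
    Submodule.finrank_eq_zero, Submodule.eq_bot_iff]
  constructor
  · intro hle u hu
    obtain ⟨v, hv, rfl⟩ := (h.exists_tangent_iff hz).2 hu
    exact hle _ (Submodule.mem_map_of_mem hv)
  · rintro hu _ ⟨v, hv, rfl⟩
    exact hu (baseProj v) ((h.exists_tangent_iff hz).1 ⟨v, hv, rfl⟩)

/-- The equations A = c are adjoined to those of M. Prescribed derivatives are attained by solving
first for the equations of M and then correcting by a tangent vector of M that lifts a suitable u.
The case r = n gives the fibres of the projection, r = 1 those of the first coordinate. -/
lemma isSmoothSubmanifold_inter (h : IsRegularDomain D f) {m r : ℕ} (hm : n + ∑ j, d j = m + L) (hr : r ≤ m)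
    (A : EuclideanSpace ℝ (Fin n) →L[ℝ] Fin r → ℝ) (c : Fin r → ℝ)
    (hA : ∀ z ∈ totalManifold D f d, A (baseProj z) = c → ∀ w, ∃ u,
      (∀ j, polyFun (f j) (baseProj z) = 0 → fderiv ℝ (polyFun (f j)) (baseProj z) u = 0) ∧
        A u = w) :
    IsSmoothSubmanifold (totalManifold D f d ∩ {z | A (baseProj z) = c}) (m - r) := by
  set g : TotalSpace n d → Fin L ⊕ Fin r → ℝ := fun z =>
    Sum.elim (totalMap f d z) fun i => A (baseProj z) i - c i with hg
  have hgc : ContDiff ℝ ∞ g := by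
    refine contDiff_pi.2 ?_
    rintro (j | i)
    · exact (contDiff_polyFun (totalPoly f d j)).of_le le_top
    · have : ContDiff ℝ ∞ fun z : TotalSpace n d => (A.comp baseProjL) z i - c i :=
        (contDiff_pi.1 (A.comp baseProjL).contDiff i).sub contDiff_const
      exact this
  refine isSmoothSubmanifold_of_levelSet hgc ?_ ?_ ?_
  · rintro z ⟨hz, hzc⟩ w
    obtain ⟨v₁, hv₁⟩ := h.surjective_fderiv_totalMap hz (w ∘ Sum.inl)
    obtain ⟨u, hu, hAu⟩ := hA z hz hzc (w ∘ Sum.inr - A (baseProj v₁))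
    obtain ⟨v₂, hv₂, rfl⟩ := (h.exists_tangent_iff hz).2 hu
    rw [h.mem_tangentSpaceAt_iff hz] at hv₂
    refine ⟨v₁ + v₂, ?_⟩
    have hcoord : ∀ p v, fderiv ℝ g z v p = fderiv ℝ (fun z => g z p) z v := fun p v => by
      rw [show g = fun z p => g z p from rfl,
        fderiv_pi fun p => (contDiff_pi.1 hgc p).differentiable (by simp) z]
      rfl
    funext p
    rw [hcoord]
    rcases p with j | i
    · change fderiv ℝ (polyFun (totalPoly f d j)) z (v₁ + v₂) = _
      rw [← fderiv_totalMap, map_add, hv₁, hv₂]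
      simp
    · have h1 : HasFDerivAt (fun z : TotalSpace n d => g z (Sum.inr i))
          ((ContinuousLinearMap.proj i).comp (A.comp baseProjL)) z :=
        ((ContinuousLinearMap.proj (R := ℝ) (φ := fun _ : Fin r => ℝ) i).comp
          (A.comp baseProjL)).hasFDerivAt.sub_const (c i)
      rw [h1.fderiv]
      have h2 := congrFun hAu i
      simp only [Pi.sub_apply, Function.comp_apply] at h2
      simp only [ContinuousLinearMap.comp_apply, ContinuousLinearMap.proj_apply, map_add,
        baseProjL_apply, h2]
      ring
  · intro z
    rw [mem_inter_iff, h.mem_totalManifold_iff_totalMap]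
    constructor
    · rintro ⟨h1, h2⟩
      funext p
      rcases p with j | i
      · exact congrFun h1 j
      · exact sub_eq_zero.2 (congrFun h2 i)
    · intro h1
      exact ⟨funext fun j => congrFun h1 (Sum.inl j),
        funext fun i => sub_eq_zero.1 (congrFun h1 (Sum.inr i))⟩
  · simp only [Fintype.card_sum, Fintype.card_fin, finrank_euclideanSpace, Fintype.card_sigma]
    omega

end IsRegularDomain
end
end HypRAG

namespace HypRAG

/-! ## Topology of sphere bundles -/

/-- The unit sphere of `ℝ^d`, in coordinates. -/
def unitSphere (d : ℕ) : Set (Fin d → ℝ) := {y | ∑ a, y a ^ 2 = 1}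

lemma unitSphere_eq_image (d : ℕ) :
    unitSphere d = WithLp.ofLp '' Metric.sphere (0 : EuclideanSpace ℝ (Fin d)) 1 := by
  ext y
  constructor
  · intro hy
    refine ⟨WithLp.toLp 2 y, ?_, rfl⟩
    rw [mem_sphere_zero_iff_norm, EuclideanSpace.norm_eq]
    simp only [Real.norm_eq_abs, sq_abs]
    rw [show ∑ i, y i ^ 2 = 1 from hy, Real.sqrt_one]
  · rintro ⟨y, hy, rfl⟩
    rw [mem_sphere_zero_iff_norm, EuclideanSpace.norm_eq, Real.sqrt_eq_one] at hy
    have : ∑ a, y a ^ 2 = 1 := by simpa using hy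
    exact this

lemma isCompact_unitSphere (d : ℕ) : IsCompact (unitSphere d) := by
  rw [unitSphere_eq_image]
  exact (isCompact_sphere _ _).image (PiLp.continuous_ofLp 2 _)

lemma isConnected_unitSphere {d : ℕ} (hd : 2 ≤ d) : IsConnected (unitSphere d) := by
  rw [unitSphere_eq_image]
  refine (isConnected_sphere ?_ _ zero_le_one).image _ (PiLp.continuous_ofLp 2 _).continuousOn
  rw [← Module.finrank_eq_rank, finrank_euclideanSpace, Fintype.card_fin]
  exact_mod_cast hd

section

variable {n L : ℕ} {d : Fin L → ℕ}

/-- Scaling unit vectors by the radii is surjective even where radii vanish, because any unit vector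
serves there. Connectedness and compactness thus come from a genuine product. -/
lemma sphereBundle_eq_image (hd : ∀ j, 2 ≤ d j) (B : Set (EuclideanSpace ℝ (Fin n)))
    (r : Fin L → EuclideanSpace ℝ (Fin n) → ℝ) :
    sphereBundle d B r = (fun p : EuclideanSpace ℝ (Fin n) × ∀ j, Fin (d j) → ℝ =>
      totalPoint p.1 fun j => r j p.1 • p.2 j) '' (B ×ˢ univ.pi fun j => unitSphere (d j)) := by
  ext z
  constructor
  · rintro ⟨hz, hy⟩
    have : ∀ j, ∃ w ∈ unitSphere (d j), r j (baseProj z) • w = fibreCoord z j := by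
      intro j
      by_cases h0 : r j (baseProj z) = 0
      · obtain ⟨w, hw⟩ := (isConnected_unitSphere (hd j)).nonempty
        refine ⟨w, hw, ?_⟩
        have h1 := hy j
        rw [h0, zero_pow two_ne_zero,
          Finset.sum_eq_zero_iff_of_nonneg fun a _ => sq_nonneg _] at h1
        rw [h0, zero_smul]
        funext a
        exact (pow_eq_zero_iff two_ne_zero |>.1 (h1 a (Finset.mem_univ _))).symm
      · refine ⟨(r j (baseProj z))⁻¹ • fibreCoord z j, ?_, smul_inv_smul₀ h0 _⟩
        simp only [unitSphere, mem_ofPred_eq, Pi.smul_apply, smul_eq_mul, mul_pow,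
          ← Finset.mul_sum, hy j]
        rw [← mul_pow, inv_mul_cancel₀ h0, one_pow]
    choose w hw hw' using this
    exact ⟨(baseProj z, w), ⟨hz, fun j _ => hw j⟩, totalSpace_ext rfl hw'⟩
  · rintro ⟨⟨x, w⟩, ⟨hx, hw⟩, rfl⟩
    refine ⟨hx, fun j => ?_⟩
    have hj : ∑ a, w j a ^ 2 = 1 := hw j (mem_univ _)
    simp only [fibreCoord_totalPoint, baseProj_totalPoint, Pi.smul_apply, smul_eq_mul, mul_pow,
      ← Finset.mul_sum, hj, mul_one]

lemma continuous_totalPoint_smul {r : Fin L → EuclideanSpace ℝ (Fin n) → ℝ}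
    (hr : ∀ j, Continuous (r j)) :
    Continuous fun p : EuclideanSpace ℝ (Fin n) × (∀ j, Fin (d j) → ℝ) =>
      (totalPoint p.1 fun j => r j p.1 • p.2 j : TotalSpace n d) :=
  continuous_totalPoint continuous_fst (continuous_pi fun j =>
    ((hr j).comp continuous_fst).smul ((continuous_apply j).comp continuous_snd))

lemma isConnected_sphereBundle (hd : ∀ j, 2 ≤ d j) {B : Set (EuclideanSpace ℝ (Fin n))}
    {r : Fin L → EuclideanSpace ℝ (Fin n) → ℝ} (hr : ∀ j, Continuous (r j))
    (hB : IsConnected B) : IsConnected (sphereBundle d B r) := by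
  rw [sphereBundle_eq_image hd]
  refine (hB.prod ⟨?_, ?_⟩).image _ (continuous_totalPoint_smul hr).continuousOn
  · exact univ_pi_nonempty_iff.2 fun j => (isConnected_unitSphere (hd j)).nonempty
  · exact isPreconnected_univ_pi fun j => (isConnected_unitSphere (hd j)).isPreconnected

lemma isCompact_sphereBundle (hd : ∀ j, 2 ≤ d j) {B : Set (EuclideanSpace ℝ (Fin n))}
    {r : Fin L → EuclideanSpace ℝ (Fin n) → ℝ} (hr : ∀ j, Continuous (r j))
    (hB : IsCompact B) : IsCompact (sphereBundle d B r) := by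
  rw [sphereBundle_eq_image hd]
  exact (hB.prod (isCompact_univ_pi fun j => isCompact_unitSphere (d j))).image
    (continuous_totalPoint_smul hr)

lemma image_baseProj_sphereBundle (hd : ∀ j, 2 ≤ d j) {B : Set (EuclideanSpace ℝ (Fin n))}
    {r : Fin L → EuclideanSpace ℝ (Fin n) → ℝ} : baseProj '' sphereBundle d B r = B := by
  rw [sphereBundle_eq_image hd, image_image]
  ext x
  constructor
  · rintro ⟨p, ⟨hp, -⟩, rfl⟩
    exact hp
  · intro hx
    choose w hw using fun j => (isConnected_unitSphere (hd j)).nonempty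
    exact ⟨(x, w), ⟨hx, fun j _ => hw j⟩, rfl⟩

/-- The decomposition of a point. -/
def CellDecomp.point {X : Type} [TopologicalSpace X] [T1Space X] (p : X) :
    CellDecomp ({p} : Set X) where
  ι := Unit
  κ _ := Empty
  fin _ := inferInstance
  χ _ _ := p
  cont _ := continuous_const
  cover x := by
    constructor
    · rintro rfl
      exact ⟨(), fun a => a.elim, fun a => a.elim, rfl⟩
    · rintro ⟨-, -, -, rfl⟩
      rfl
  inj _ z _ w _ _ := funext fun a => a.elim
  disj _ _ _ _ _ _ _ := rfl
  bdry _ z _ hz := absurd (fun a => a.elim) hz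
  locfin _ := ⟨univ, Filter.univ_mem, Set.toFinite _⟩

lemma sum_sub_one (hd : ∀ j, 2 ≤ d j) : ∑ j, (d j - 1) + L = ∑ j, d j := by
  have : ∑ j : Fin L, (d j - 1) + ∑ _j : Fin L, 1 = ∑ j, d j := by
    rw [← Finset.sum_add_distrib]
    exact Finset.sum_congr rfl fun j _ => by have := hd j; omega
  simpa using this

/-- A product of spheres with positive radii is diffeomorphic to a product of unit spheres. -/
lemma areDiffeomorphic_sphereProduct (hd : ∀ j, 2 ≤ d j) {p : EuclideanSpace ℝ (Fin n)}
    {r : Fin L → EuclideanSpace ℝ (Fin n) → ℝ} (hr : ∀ j, 0 < r j p) :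
    AreDiffeomorphic (sphereBundle d {p} r) (sphereProduct fun j => d j - 1) := by
  have hd' : ∀ j, d j - 1 + 1 = d j := fun j => by have := hd j; omega
  let φ : TotalSpace n d → EuclideanSpace ℝ (Σ j : Fin L, Fin (d j - 1 + 1)) := fun z =>
    WithLp.toLp 2 fun q => (r q.1 p)⁻¹ * z (Sum.inr ⟨q.1, Fin.cast (hd' q.1) q.2⟩)
  let ψ : EuclideanSpace ℝ (Σ j : Fin L, Fin (d j - 1 + 1)) → TotalSpace n d := fun y =>
    WithLp.toLp 2 (Sum.elim (fun i => p i)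
      fun q => r q.1 p * y ⟨q.1, Fin.cast (hd' q.1).symm q.2⟩)
  have hsum : ∀ j (g : Fin (d j) → ℝ), ∑ a : Fin (d j - 1 + 1), g (Fin.cast (hd' j) a) =
      ∑ a, g a := fun j g => (finCongr (hd' j)).sum_comp g
  have hsum' : ∀ j (g : Fin (d j - 1 + 1) → ℝ), ∑ a : Fin (d j), g (Fin.cast (hd' j).symm a) =
      ∑ a, g a := fun j g => (finCongr (hd' j).symm).sum_comp g
  refine ⟨φ, ψ, univ, univ, isOpen_univ, subset_univ _, ?_, isOpen_univ, subset_univ _, ?_, ?_, ?_,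
    ?_, ?_⟩
  · refine ContDiff.contDiffOn (contDiff_euclidean.2 fun q => ?_)
    have : ContDiff ℝ ∞ fun z : TotalSpace n d =>
      (r q.1 p)⁻¹ * z (Sum.inr ⟨q.1, Fin.cast (hd' q.1) q.2⟩) := by fun_prop
    exact this
  · refine ContDiff.contDiffOn (contDiff_euclidean.2 ?_)
    rintro (i | q)
    · exact contDiff_const
    · have : ContDiff ℝ ∞ fun y : EuclideanSpace ℝ (Σ j : Fin L, Fin (d j - 1 + 1)) =>
        r q.1 p * y ⟨q.1, Fin.cast (hd' q.1).symm q.2⟩ := by fun_prop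
      exact this
  · rintro z ⟨hz, hy⟩ j
    change ∑ a : Fin (d j - 1 + 1), ((r j p)⁻¹ * fibreCoord z j (Fin.cast (hd' j) a)) ^ 2 = 1
    rw [hsum j fun a => ((r j p)⁻¹ * fibreCoord z j a) ^ 2]
    simp only [mul_pow, ← Finset.mul_sum, hy j]
    rw [hz, ← mul_pow, inv_mul_cancel₀ (hr j).ne', one_pow]
  · intro y hy
    refine ⟨rfl, fun j => ?_⟩
    have h1 : ∑ a, y ⟨j, a⟩ ^ 2 = 1 := hy j
    change ∑ a : Fin (d j), (r j p * y ⟨j, Fin.cast (hd' j).symm a⟩) ^ 2 = r j p ^ 2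
    rw [hsum' j fun a => (r j p * y ⟨j, a⟩) ^ 2]
    simp only [mul_pow, ← Finset.mul_sum, h1, mul_one]
  · rintro z ⟨hz, -⟩
    refine totalSpace_ext hz.symm fun j => ?_
    funext a
    exact mul_inv_cancel_left₀ (hr j).ne' (fibreCoord z j a)
  · intro y _
    ext ⟨j, a⟩
    exact inv_mul_cancel_left₀ (hr j).ne' (y ⟨j, a⟩)

/-- The relation `hm` makes m - n the sum of the sphere dimensions d_j - 1. The bound 2 ≤ d_j makes
the spheres connected, hence M connected. -/
lemma IsRegularDomain.isMapOver {D : Set (EuclideanSpace ℝ (Fin n))}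
    {f : Fin L → MvPolynomial (Fin n) ℝ} (h : IsRegularDomain D f) (hconn : IsConnected (closure D))
    (hd : ∀ j, 2 ≤ d j) {m : ℕ} (hm : n + ∑ j, d j = m + L) :
    IsMapOver D m (totalPoly f d) (totalManifold D f d) baseProj := by
  have hd0 : ∀ j, 0 < d j := fun j => two_pos.trans_le (hd j)
  have hsum := sum_sub_one hd
  have hle : n ≤ m := by omega
  have hM : totalManifold D f d = sphereBundle d (closure D) (radius f) := by
    have := h.totalManifold_inter_preimage (d := d) univ
    simpa using this
  have hMc : IsConnected (totalManifold D f d) := by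
    rw [hM]
    exact isConnected_sphereBundle hd (continuous_radius f) hconn
  constructor
  · exact hle
  · exact hMc
  · refine ⟨L, ?_, totalPoly f d, ?_, fun p hp => h.linearIndependent_fderiv hp⟩
    · simp only [Fintype.card_sum, Fintype.card_fin, Fintype.card_sigma]
      omega
    · rw [h.totalManifold_eq_zeroSet]
      exact ⟨subset_rfl, fun p _ => connectedComponentIn_subset _ _⟩
  -- M is the whole zero set and is connected, so it is its own component.
  · obtain ⟨p, hp⟩ := hMc.nonempty
    rw [h.totalManifold_eq_zeroSet] at hMc hp ⊢
    exact ⟨p, hp, (hMc.isPreconnected.connectedComponentIn hp).symm⟩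
  · exact ⟨fun i => MvPolynomial.X (Sum.inl i), fun x _ i => by simp [polyFun, baseProj]⟩
  · exact h.image_baseProj hd0
  · ext x
    simp only [mem_image, h.mem_singularSet_baseProj_iff hle]
    constructor
    · rintro ⟨z, ⟨hz, hzD⟩, rfl⟩
      exact ⟨hz.1, hzD⟩
    · rintro ⟨hx, hxD⟩
      obtain ⟨z, hz, rfl⟩ := h.exists_totalManifold hd0 hx
      exact ⟨z, ⟨hz, hxD⟩, rfl⟩
  · intro p
    rw [h.totalManifold_inter_preimage]
    by_cases hp : p ∈ closure D
    · rw [inter_eq_self_of_subset_right (singleton_subset_iff.2 hp)]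
      refine hasCWDimLE_sphereBundle hd0 (CellDecomp.point p) _ (continuous_radius f)
        (fun _ j => ?_) (N := 0) (fun _ => ?_) (by omega)
      · rcases (Real.sqrt_nonneg (polyFun (f j) p)).eq_or_lt with h0 | h0
        · exact Or.inr fun _ _ => h0.symm
        · exact Or.inl fun _ _ => h0
      · change Nat.card Empty ≤ 0
        simp
    · have : sphereBundle d (closure D ∩ {p}) (radius f) = ∅ := by
        rw [eq_empty_iff_forall_notMem]
        rintro z ⟨⟨hz, rfl⟩, -⟩
        exact hp hz
      rw [this]
      exact CellDecomp.empty.hasCWDimLE fun i => i.elim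
  · intro p hp
    constructor
    · have := h.isSmoothSubmanifold_inter (d := d) hm hle
        (EuclideanSpace.equiv (Fin n) ℝ : EuclideanSpace ℝ (Fin n) →L[ℝ] Fin n → ℝ) (fun i => p i)
        fun z _ hzp w => ⟨WithLp.toLp 2 w, fun j hj => ?_, rfl⟩
      · convert this using 2
        ext z
        rw [mem_preimage, mem_singleton_iff, mem_ofPred_eq]
        constructor
        · rintro rfl; rfl
        · intro hz; ext i; exact congrFun hz i
      · have : baseProj z = p := by ext i; exact congrFun hzp i
        exact absurd (this ▸ hp) (h.not_mem_of_polyFun_eq_zero hj)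
    · refine ⟨L, fun j => d j - 1, ?_⟩
      rw [h.totalManifold_inter_preimage,
        inter_eq_self_of_subset_right (singleton_subset_iff.2 (subset_closure hp))]
      refine areDiffeomorphic_sphereProduct hd fun j => Real.sqrt_pos.2 ?_
      rw [h.eq_inter] at hp
      exact hp j

end

end HypRAG

namespace HypRAG

open Topology Filter

/-! ## Hyperbolic cylinders -/

/-- A component of the hyperbola `(x_1 - a)(x_k - b) = c`, on the side `σ (x_k - b) > 0`, together
with the sign `ε` of a function `ε ((x_1 - a)(x_k - b) - c)` and an auxiliary factor
`g₀ + g₁ (x_1 - a)(x_k - b)`. -/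
structure HypCurve (n : ℕ) where
  /-- The second coordinate. -/
  k : Fin n
  /-- The vertical asymptote. -/
  a : ℝ
  /-- The horizontal asymptote. -/
  b : ℝ
  /-- The constant of the hyperbola. -/
  c : ℝ
  /-- The side of the component. -/
  σ : ℝ
  /-- The sign of the defining function. -/
  ε : ℝ
  /-- The constant term of the auxiliary factor. -/
  g₀ : ℝ
  /-- The linear term of the auxiliary factor. -/
  g₁ : ℝ

namespace HypCurve

variable {n : ℕ} (hn : 0 < n) (H : HypCurve n)

/-- The quadratic function `(x_1 - a)(x_k - b)`. -/
def q (x : EuclideanSpace ℝ (Fin n)) : ℝ := (firstCoord hn x - H.a) * (x H.k - H.b)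

/-- The function `ε ((x_1 - a)(x_k - b) - c)`. -/
def ell (x : EuclideanSpace ℝ (Fin n)) : ℝ := H.ε * (H.q hn x - H.c)

/-- The auxiliary factor. -/
def factor (x : EuclideanSpace ℝ (Fin n)) : ℝ := H.g₀ + H.g₁ * H.q hn x

/-- The component of the hyperbola times a Euclidean space. -/
def surface : Set (EuclideanSpace ℝ (Fin n)) :=
  {x | H.q hn x = H.c ∧ 0 < H.σ * (x H.k - H.b)}

/-- The polynomial `(x_1 - a)(x_k - b)`. -/
def qPoly : MvPolynomial (Fin n) ℝ :=
  (MvPolynomial.X ⟨0, hn⟩ - MvPolynomial.C H.a) * (MvPolynomial.X H.k - MvPolynomial.C H.b)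

/-- The polynomial `(x_1 - a)(x_k - b) - c`. -/
def quadric : MvPolynomial (Fin n) ℝ := H.qPoly hn - MvPolynomial.C H.c

/-- The defining polynomial. -/
def poly : MvPolynomial (Fin n) ℝ :=
  MvPolynomial.C H.ε * H.quadric hn * (MvPolynomial.C H.g₀ + MvPolynomial.C H.g₁ * H.qPoly hn)

/-- The non-degeneracy conditions. -/
structure Nondegenerate : Prop where
  k_ne : H.k ≠ ⟨0, hn⟩
  c_ne : H.c ≠ 0
  σ_cases : H.σ = 1 ∨ H.σ = -1
  ε_cases : H.ε = 1 ∨ H.ε = -1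
  factor_pos : 0 < H.g₀ + H.g₁ * H.c

lemma polyFun_quadric (x : EuclideanSpace ℝ (Fin n)) :
    polyFun (H.quadric hn) x = H.q hn x - H.c := by
  simp [polyFun, quadric, qPoly, q, firstCoord]

lemma polyFun_poly (x : EuclideanSpace ℝ (Fin n)) :
    polyFun (H.poly hn) x = H.ell hn x * H.factor hn x := by
  simp [polyFun, poly, quadric, qPoly, q, ell, factor, firstCoord]

/-- The differential of `(x_1 - a)(x_k - b)`. -/
def dq (x : EuclideanSpace ℝ (Fin n)) : EuclideanSpace ℝ (Fin n) →L[ℝ] ℝ :=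
  (firstCoord hn x - H.a) • EuclideanSpace.proj H.k +
    (x H.k - H.b) • EuclideanSpace.proj (⟨0, hn⟩ : Fin n)

lemma dq_apply (x v : EuclideanSpace ℝ (Fin n)) :
    H.dq hn x v = (firstCoord hn x - H.a) * v H.k + (x H.k - H.b) * firstCoord hn v := by
  simp [dq, firstCoord]

lemma hasFDerivAt_q (x : EuclideanSpace ℝ (Fin n)) : HasFDerivAt (H.q hn) (H.dq hn x) x := by
  have h1 : HasFDerivAt (fun x : EuclideanSpace ℝ (Fin n) => firstCoord hn x - H.a)
      (EuclideanSpace.proj (⟨0, hn⟩ : Fin n) : EuclideanSpace ℝ (Fin n) →L[ℝ] ℝ) x :=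
    (EuclideanSpace.proj (⟨0, hn⟩ : Fin n) :
      EuclideanSpace ℝ (Fin n) →L[ℝ] ℝ).hasFDerivAt.sub_const H.a
  have h2 : HasFDerivAt (fun x : EuclideanSpace ℝ (Fin n) => x H.k - H.b)
      (EuclideanSpace.proj H.k : EuclideanSpace ℝ (Fin n) →L[ℝ] ℝ) x :=
    (EuclideanSpace.proj H.k : EuclideanSpace ℝ (Fin n) →L[ℝ] ℝ).hasFDerivAt.sub_const H.b
  exact h1.mul h2

lemma continuous_q : Continuous (H.q hn) := by
  unfold q firstCoord
  fun_prop

lemma continuous_ell : Continuous (H.ell hn) :=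
  continuous_const.mul ((H.continuous_q hn).sub continuous_const)

lemma fderiv_quadric (x : EuclideanSpace ℝ (Fin n)) :
    fderiv ℝ (polyFun (H.quadric hn)) x = H.dq hn x := by
  rw [show polyFun (H.quadric hn) = fun x => H.q hn x - H.c from funext (H.polyFun_quadric hn)]
  exact ((H.hasFDerivAt_q hn x).sub_const H.c).fderiv

lemma fderiv_poly {x : EuclideanSpace ℝ (Fin n)} (hx : H.q hn x = H.c) :
    fderiv ℝ (polyFun (H.poly hn)) x = (H.ε * (H.g₀ + H.g₁ * H.c)) • H.dq hn x := by
  rw [show polyFun (H.poly hn) = fun x => H.ell hn x * H.factor hn x from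
    funext (H.polyFun_poly hn)]
  have h := H.hasFDerivAt_q hn x
  have h1 : HasFDerivAt (H.ell hn) (H.ε • H.dq hn x) x := (h.sub_const H.c).const_mul H.ε
  have h2 : HasFDerivAt (H.factor hn) (H.g₁ • H.dq hn x) x := (h.const_mul H.g₁).const_add H.g₀
  rw [(h1.fun_mul h2).fderiv]
  ext v
  simp [ell, factor, hx]
  ring

variable {H hn}

lemma Nondegenerate.ell_eq_zero_iff (hH : H.Nondegenerate hn) {x : EuclideanSpace ℝ (Fin n)} :
    H.ell hn x = 0 ↔ H.q hn x = H.c := by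
  unfold ell
  rcases hH.ε_cases with h | h <;> rw [h] <;> constructor <;> intro h' <;> linarith

lemma Nondegenerate.first_ne (hH : H.Nondegenerate hn) {x : EuclideanSpace ℝ (Fin n)}
    (hx : H.q hn x = H.c) : firstCoord hn x - H.a ≠ 0 := by
  intro h
  apply hH.c_ne
  rw [← hx, q, h, zero_mul]

lemma Nondegenerate.second_ne (hH : H.Nondegenerate hn) {x : EuclideanSpace ℝ (Fin n)}
    (hx : H.q hn x = H.c) : x H.k - H.b ≠ 0 := by
  intro h
  apply hH.c_ne
  rw [← hx, q, h, mul_zero]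

lemma Nondegenerate.ε_mul_ne_zero (hH : H.Nondegenerate hn) :
    H.ε * (H.g₀ + H.g₁ * H.c) ≠ 0 := by
  refine mul_ne_zero ?_ hH.factor_pos.ne'
  rcases hH.ε_cases with h | h <;> rw [h] <;> norm_num

lemma Nondegenerate.isHyperbolaCylinder (hH : H.Nondegenerate hn) :
    IsHyperbolaCylinder hn (H.surface hn) := by
  refine ⟨H.a, H.b, H.c, H.k, hH.c_ne, hH.k_ne, ?_⟩
  rcases hH.σ_cases with h | h
  · left
    ext x
    simp [surface, q, h]
  · right
    ext x
    simp [surface, q, h]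

lemma surface_subset_quadric : H.surface hn ⊆ hyperZeroSet (H.quadric hn) := by
  intro x hx
  simp only [hyperZeroSet, mem_ofPred_eq, polyFun_quadric]
  rw [hx.1, sub_self]

lemma surface_subset_poly : H.surface hn ⊆ hyperZeroSet (H.poly hn) := by
  intro x hx
  simp only [hyperZeroSet, mem_ofPred_eq, polyFun_poly, ell]
  rw [hx.1, sub_self, mul_zero, zero_mul]

lemma continuous_side : Continuous fun x : EuclideanSpace ℝ (Fin n) => H.σ * (x H.k - H.b) := by
  fun_prop

lemma Nondegenerate.side_ne (hH : H.Nondegenerate hn) {x : EuclideanSpace ℝ (Fin n)}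
    (hx : H.q hn x = H.c) : H.σ * (x H.k - H.b) ≠ 0 := by
  refine mul_ne_zero ?_ (hH.second_ne hx)
  rcases hH.σ_cases with h | h <;> rw [h] <;> norm_num

/-- As c ≠ 0, the quadric misses the hyperplane x_k = b, which separates the two branches. -/
lemma Nondegenerate.component_quadric_subset (hH : H.Nondegenerate hn)
    {x : EuclideanSpace ℝ (Fin n)} (hx : x ∈ H.surface hn) :
    connectedComponentIn (hyperZeroSet (H.quadric hn)) x ⊆ H.surface hn := by
  refine connectedComponentIn_subset_of_separation (U := {x : EuclideanSpace ℝ (Fin n) | 0 < H.σ * (x H.k - H.b)})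
    (V := {x : EuclideanSpace ℝ (Fin n) | H.σ * (x H.k - H.b) < 0}) (isOpen_lt continuous_const H.continuous_side)
    (isOpen_lt H.continuous_side continuous_const) ?_ ?_ ?_ (surface_subset_quadric hx) hx.2
  · exact Set.disjoint_left.2 fun y h1 h2 => lt_asymm (mem_ofPred_eq.mp h1) (mem_ofPred_eq.mp h2)
  · intro y hy
    simp only [hyperZeroSet, mem_ofPred_eq, polyFun_quadric] at hy
    exact (hH.side_ne (sub_eq_zero.1 hy)).lt_or_gt.symm
  · rintro y ⟨hy, hy'⟩
    simp only [hyperZeroSet, mem_ofPred_eq, polyFun_quadric] at hy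
    exact ⟨sub_eq_zero.1 hy, hy'⟩

lemma Nondegenerate.isUnionOfComponents (hH : H.Nondegenerate hn) :
    IsUnionOfComponents (H.surface hn) (hyperZeroSet (H.poly hn)) := by
  refine ⟨surface_subset_poly, fun x hx => ?_⟩
  -- The auxiliary factor depends on q alone and is positive at q = c, so its zeros have |q - c| ≥
  -- δ. The level δ/2 separates them from the quadric.
  obtain ⟨δ, hδ, hsep⟩ : ∃ δ > 0, ∀ y : ℝ, |y - H.c| < δ → H.g₀ + H.g₁ * y ≠ 0 := by
    have : ContinuousAt (fun y : ℝ => H.g₀ + H.g₁ * y) H.c := by fun_prop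
    obtain ⟨δ, hδ, h⟩ := Metric.eventually_nhds_iff.1
      (this.eventually (lt_mem_nhds hH.factor_pos))
    exact ⟨δ, hδ, fun y hy => (h (by rwa [Real.dist_eq])).ne'⟩
  have hqc : Continuous fun x => |H.q hn x - H.c| := ((H.continuous_q hn).sub continuous_const).abs
  refine connectedComponentIn_subset_of_separation
    (U := {x : EuclideanSpace ℝ (Fin n) | 0 < H.σ * (x H.k - H.b)} ∩ {x | |H.q hn x - H.c| < δ / 2})
    (V := {x : EuclideanSpace ℝ (Fin n) | H.σ * (x H.k - H.b) < 0} ∪ {x | δ / 2 < |H.q hn x - H.c|})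
    ((isOpen_lt continuous_const H.continuous_side).inter (isOpen_lt hqc continuous_const))
    ((isOpen_lt H.continuous_side continuous_const).union (isOpen_lt continuous_const hqc))
    ?_ ?_ ?_ (surface_subset_poly hx) ⟨hx.2, ?_⟩
  · rw [Set.disjoint_left]
    rintro y ⟨h1, h2⟩ (h3 | h3)
    · exact lt_asymm (mem_ofPred_eq.mp h1) (mem_ofPred_eq.mp h3)
    · exact lt_asymm (mem_ofPred_eq.mp h2) (mem_ofPred_eq.mp h3)
  · intro y hy
    simp only [hyperZeroSet, mem_ofPred_eq, polyFun_poly] at hy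
    rcases mul_eq_zero.1 hy with h | h
    · have h := hH.ell_eq_zero_iff.1 h
      rcases (hH.side_ne h).lt_or_gt with h' | h'
      · exact Or.inr (Or.inl h')
      · exact Or.inl ⟨h', by simp [h, hδ]⟩
    · refine Or.inr (Or.inr ?_)
      rw [mem_ofPred_eq]
      by_contra hlt
      exact hsep (H.q hn y) (by linarith) h
  · rintro y ⟨hy, hy', hy''⟩
    simp only [hyperZeroSet, mem_ofPred_eq, polyFun_poly] at hy
    rcases mul_eq_zero.1 hy with h | h
    · exact ⟨hH.ell_eq_zero_iff.1 h, hy'⟩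
    · refine absurd h (hsep (H.q hn y) ?_)
      rw [mem_ofPred_eq] at hy''
      linarith
  · rw [mem_ofPred_eq, hx.1]
    simpa using half_pos hδ

lemma totalDegree_quadric_le : (H.quadric hn).totalDegree ≤ 2 := by
  have h1 : ∀ (i : Fin n) (r : ℝ),
      (MvPolynomial.X i - MvPolynomial.C r : MvPolynomial (Fin n) ℝ).totalDegree ≤ 1 := by
    intro i r
    refine (MvPolynomial.totalDegree_sub_C_le _ _).trans ?_
    rw [MvPolynomial.totalDegree_X]
  refine (MvPolynomial.totalDegree_sub_C_le _ _).trans ?_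
  exact (MvPolynomial.totalDegree_mul _ _).trans (Nat.add_le_add (h1 _ _) (h1 _ _))

/-- Replacing the first coordinate. -/
def setFirst (hn : 0 < n) (s : ℝ) (x : EuclideanSpace ℝ (Fin n)) : EuclideanSpace ℝ (Fin n) :=
  WithLp.toLp 2 (Function.update (fun i => x i) ⟨0, hn⟩ s)

/-- The surface is the graph x_1 = a + c / (x_k - b) over an open half-space in the remaining
coordinates. -/
lemma Nondegenerate.isPreconnected_surface (hH : H.Nondegenerate hn) :
    IsPreconnected (H.surface hn) := by
  set Ω : Set (EuclideanSpace ℝ (Fin n)) := {x | 0 < H.σ * (x H.k - H.b)} with hΩ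
  have hconv : Convex ℝ Ω := by
    intro x hx y hy s t hs ht hst
    rw [hΩ, mem_ofPred_eq] at hx hy ⊢
    have : H.σ * ((s • x + t • y) H.k - H.b) =
        s * (H.σ * (x H.k - H.b)) + t * (H.σ * (y H.k - H.b)) := by
      simp only [PiLp.add_apply, PiLp.smul_apply, smul_eq_mul]
      linear_combination (H.σ * H.b) * hst
    rw [this]
    rcases hs.eq_or_lt with rfl | hs
    · have : t = 1 := by linarith
      subst this
      simpa using hy
    · have := mul_pos hs hx
      have := mul_nonneg ht hy.le
      linarith
  have hkb : ∀ x ∈ Ω, x H.k - H.b ≠ 0 := fun x hx h => by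
    rw [hΩ, mem_ofPred_eq, h, mul_zero] at hx
    exact lt_irrefl _ hx
  have himg : H.surface hn = (fun x => setFirst hn (H.a + H.c / (x H.k - H.b)) x) '' Ω := by
    ext x
    constructor
    · rintro ⟨hq, hx⟩
      refine ⟨x, hx, ?_⟩
      have h1 : H.a + H.c / (x H.k - H.b) = firstCoord hn x := by
        rw [← hq, q, mul_div_cancel_right₀ _ (hH.second_ne hq)]
        ring
      ext i
      simp only [setFirst, h1, firstCoord, Function.update_apply]
      split_ifs with h <;> simp [h]
    · rintro ⟨x, hx, rfl⟩
      have h1 : (setFirst hn (H.a + H.c / (x H.k - H.b)) x) H.k = x H.k := by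
        simp [setFirst, hH.k_ne]
      refine ⟨?_, ?_⟩
      · rw [q, h1]
        simp only [setFirst, firstCoord, Function.update_self, add_sub_cancel_left]
        exact div_mul_cancel₀ _ (hkb x hx)
      · rw [h1]
        exact hx
  rw [himg]
  refine hconv.isPreconnected.image _ ?_
  refine (PiLp.continuous_toLp 2 _).comp_continuousOn (continuousOn_pi.2 fun i => ?_)
  by_cases hi : i = ⟨0, hn⟩
  · subst hi
    simp only [Function.update_self]
    refine continuousOn_const.add (continuousOn_const.div ?_ hkb)
    exact Continuous.continuousOn (by fun_prop)
  · simp only [Function.update_of_ne hi]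
    exact Continuous.continuousOn (by fun_prop)

lemma Nondegenerate.isComponent_quadric (hH : H.Nondegenerate hn) (hne : (H.surface hn).Nonempty) :
    IsComponent (H.surface hn) (hyperZeroSet (H.quadric hn)) := by
  obtain ⟨x, hx⟩ := hne
  exact ⟨x, surface_subset_quadric hx, Subset.antisymm
    (hH.isPreconnected_surface.subset_connectedComponentIn hx surface_subset_quadric)
    (hH.component_quadric_subset hx)⟩

end HypCurve

end HypRAG

/-! ### Arrangements of hyperbolic cylinders: connectedness, closure, independence of differentials
-/

namespace HypRAG

open Topology Filter

section

variable {n L : ℕ} (hn : 0 < n) (H : Fin L → HypCurve n) (lo hi : ℝ)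
  (cen : ℝ → EuclideanSpace ℝ (Fin n))

/-- The points over `[lo, hi]` at which all functions `ε ((x_1 - a)(x_k - b) - c)` are
nonnegative. -/
def region : Set (EuclideanSpace ℝ (Fin n)) :=
  {x | firstCoord hn x ∈ Icc lo hi ∧ ∀ j, 0 ≤ (H j).ell hn x}

/-- The points at which all defining polynomials are positive. -/
def domain : Set (EuclideanSpace ℝ (Fin n)) := {x | ∀ j, 0 < polyFun ((H j).poly hn) x}

/-- Replacing a coordinate. -/
def setCoord (k : Fin n) (y : ℝ) (x : EuclideanSpace ℝ (Fin n)) : EuclideanSpace ℝ (Fin n) :=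
  WithLp.toLp 2 (Function.update (fun i => x i) k y)

/-- The section of the hyperbolic cylinder `S_j` over the first coordinate which has the
coordinates of `cen` in the other directions. -/
def pieceSection (j : Fin L) (s : ℝ) : EuclideanSpace ℝ (Fin n) :=
  setCoord (H j).k ((H j).b + (H j).c / (s - (H j).a)) (cen s)

/-- A family of hyperbolic cylinders bounding a region over `[lo, hi]` which contains the curve
`cen`. -/
structure IsArrangement : Prop where
  lt : lo < hi
  pos : 0 < L
  nondeg : ∀ j, (H j).Nondegenerate hn
  cen_cont : Continuous cen
  cen_first : ∀ s, firstCoord hn (cen s) = s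
  mem_region : ∀ x, (∀ j, 0 ≤ (H j).ell hn x * (H j).factor hn x) → x ∈ region hn H lo hi
  factor_pos : ∀ x ∈ region hn H lo hi, ∀ j, 0 < (H j).factor hn x
  cen_nonneg : ∀ s ∈ Icc lo hi, ∀ j, 0 ≤ (H j).ell hn (cen s)
  cen_pos : ∀ s ∈ Ioo lo hi, ∀ j, 0 < (H j).ell hn (cen s)
  -- One curve closes the region at both ends. With `cen_end`, which makes a slice degenerate in any
  -- coordinate whose function vanishes at the centre, this keeps the open domain off `lo` and `hi`.
  cen_zero : ∃ j, (H j).ell hn (cen lo) = 0 ∧ (H j).ell hn (cen hi) = 0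
  cen_end : ∀ x ∈ region hn H lo hi, ∀ j, (H j).ell hn (cen (firstCoord hn x)) = 0 →
    x (H j).k = cen (firstCoord hn x) (H j).k
  side : ∀ x ∈ region hn H lo hi, ∀ j, (H j).q hn x = (H j).c → x ∈ (H j).surface hn
  piece : ∀ j, ∃ J : Set ℝ, J.OrdConnected ∧ J.Nonempty ∧
    (∀ s ∈ J, s ≠ (H j).a ∧ pieceSection H cen j s ∈ region hn H lo hi) ∧
    ∀ x ∈ region hn H lo hi, x ∈ (H j).surface hn → firstCoord hn x ∈ J
  -- Up to sign, the determinant of the two differentials in the common plane.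
  crossing : ∀ i j, i ≠ j → (H i).k = (H j).k → ∀ x ∈ (H i).surface hn, x ∈ (H j).surface hn →
    (firstCoord hn x - (H i).a) * (x (H j).k - (H j).b) -
      (firstCoord hn x - (H j).a) * (x (H i).k - (H i).b) ≠ 0
  crossing_unique : ∀ i j i' j', i ≠ j → (H i).k = (H j).k → i' ≠ j' → (H i').k = (H j').k →
    ∀ x ∈ (H i).surface hn, x ∈ (H j).surface hn → x ∈ (H i').surface hn → x ∈ (H j').surface hn →
    i' = i ∨ i' = j
  bounded : ∃ R, ∀ x ∈ region hn H lo hi, ∀ k, R ≤ x k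

end

namespace HypCurve

variable {n : ℕ} {hn : 0 < n} {H : HypCurve n}

lemma ell_congr {x y : EuclideanSpace ℝ (Fin n)} (h : firstCoord hn x = firstCoord hn y)
    (h' : x H.k = y H.k) : H.ell hn x = H.ell hn y := by
  unfold ell q
  rw [h, h']

/-- The function is bilinear up to lower terms, hence affine once the first coordinate is fixed. All
convexity of slices rests on this. -/
lemma ell_combo {x y : EuclideanSpace ℝ (Fin n)} (h : firstCoord hn x = firstCoord hn y)
    {s t : ℝ} (hst : s + t = 1) :
    H.ell hn (s • x + t • y) = s * H.ell hn x + t * H.ell hn y := by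
  have h1 : firstCoord hn (s • x + t • y) = firstCoord hn y := by
    have : firstCoord hn (s • x + t • y) = s * firstCoord hn x + t * firstCoord hn y := by
      simp [firstCoord]
    rw [this, h, ← add_mul, hst, one_mul]
  unfold ell q
  rw [h1, h]
  simp only [PiLp.add_apply, PiLp.smul_apply, smul_eq_mul]
  linear_combination (H.ε * ((firstCoord hn y - H.a) * H.b + H.c)) * hst

end HypCurve

section

variable {n : ℕ} {hn : 0 < n}

lemma firstCoord_combo {x y : EuclideanSpace ℝ (Fin n)} (h : firstCoord hn x = firstCoord hn y)
    {s t : ℝ} (hst : s + t = 1) : firstCoord hn (s • x + t • y) = firstCoord hn x := by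
  have : firstCoord hn (s • x + t • y) = s * firstCoord hn x + t * firstCoord hn y := by
    simp [firstCoord]
  rw [this, ← h, ← add_mul, hst, one_mul]

lemma continuous_firstCoord : Continuous (firstCoord hn) := by
  unfold firstCoord
  fun_prop

lemma firstCoord_setCoord {k : Fin n} (hk : k ≠ ⟨0, hn⟩) (y : ℝ) (x : EuclideanSpace ℝ (Fin n)) :
    firstCoord hn (setCoord k y x) = firstCoord hn x := by
  simp [firstCoord, setCoord, hk.symm]

@[simp] lemma setCoord_same (k : Fin n) (y : ℝ) (x : EuclideanSpace ℝ (Fin n)) :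
    setCoord k y x k = y := by
  simp [setCoord]

lemma setCoord_of_ne {k i : Fin n} (h : i ≠ k) (y : ℝ) (x : EuclideanSpace ℝ (Fin n)) :
    setCoord k y x i = x i := by
  simp [setCoord, h]

/-- A set containing a curve over a connected set and, with each point, the segment to the
curve. -/
lemma isConnected_of_section {E : Type} [NormedAddCommGroup E] [NormedSpace ℝ E] {W : Set E}
    {J : Set ℝ} {γ : ℝ → E} {φ : E → ℝ} (hJ : IsPreconnected J) (hne : J.Nonempty)
    (hγ : ContinuousOn γ J) (hγW : ∀ s ∈ J, γ s ∈ W)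
    (h : ∀ x ∈ W, φ x ∈ J ∧ segment ℝ x (γ (φ x)) ⊆ W) : IsConnected W := by
  obtain ⟨s₀, hs₀⟩ := hne
  refine ⟨⟨γ s₀, hγW s₀ hs₀⟩, isPreconnected_of_forall (γ s₀) fun x hx => ?_⟩
  refine ⟨segment ℝ x (γ (φ x)) ∪ γ '' J, union_subset (h x hx).2 (image_subset_iff.2 hγW),
    Or.inr ⟨s₀, hs₀, rfl⟩, Or.inl (left_mem_segment ℝ _ _), ?_⟩
  exact IsPreconnected.union (γ (φ x)) (right_mem_segment ℝ _ _) ⟨_, (h x hx).1, rfl⟩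
    (convex_segment _ _).isPreconnected (hJ.image γ hγ)

end

namespace IsArrangement

variable {n L : ℕ} {hn : 0 < n} {H : Fin L → HypCurve n} {lo hi : ℝ}
  {cen : ℝ → EuclideanSpace ℝ (Fin n)}

lemma cen_mem (h : IsArrangement hn H lo hi cen) {s : ℝ} (hs : s ∈ Icc lo hi) :
    cen s ∈ region hn H lo hi :=
  ⟨by rwa [h.cen_first], h.cen_nonneg s hs⟩

lemma region_eq (h : IsArrangement hn H lo hi cen) :
    region hn H lo hi = {x | ∀ j, 0 ≤ polyFun ((H j).poly hn) x} := by
  ext x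
  simp only [mem_ofPred_eq, HypCurve.polyFun_poly]
  exact ⟨fun hx j => mul_nonneg (hx.2 j) (h.factor_pos x hx j).le, h.mem_region x⟩

lemma poly_eq_zero_iff (h : IsArrangement hn H lo hi cen) {x : EuclideanSpace ℝ (Fin n)}
    (hx : x ∈ region hn H lo hi) (j : Fin L) :
    polyFun ((H j).poly hn) x = 0 ↔ x ∈ (H j).surface hn := by
  rw [HypCurve.polyFun_poly, mul_eq_zero, or_iff_left (h.factor_pos x hx j).ne',
    (h.nondeg j).ell_eq_zero_iff]
  exact ⟨h.side x hx j, fun hx => hx.1⟩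

lemma mem_domain_iff (h : IsArrangement hn H lo hi cen) {x : EuclideanSpace ℝ (Fin n)} :
    x ∈ domain hn H ↔ x ∈ region hn H lo hi ∧ ∀ j, 0 < (H j).ell hn x := by
  constructor
  · intro hx
    have hr : x ∈ region hn H lo hi := by
      rw [h.region_eq]
      exact fun j => (hx j).le
    refine ⟨hr, fun j => ?_⟩
    have := hx j
    rw [HypCurve.polyFun_poly] at this
    exact pos_of_mul_pos_left this (h.factor_pos x hr j).le
  · rintro ⟨hr, hx⟩ j
    rw [HypCurve.polyFun_poly]
    exact mul_pos (hx j) (h.factor_pos x hr j)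

/-- Over an end, the curve of `cen_zero` vanishes at the centre; `cen_end` then puts x at the centre
in that plane, so the function vanishes at x as well. -/
lemma first_mem_Ioo (h : IsArrangement hn H lo hi cen) {x : EuclideanSpace ℝ (Fin n)}
    (hx : x ∈ domain hn H) : firstCoord hn x ∈ Ioo lo hi := by
  obtain ⟨hr, hpos⟩ := h.mem_domain_iff.1 hx
  obtain ⟨j, hlo, hhi⟩ := h.cen_zero
  have key : (H j).ell hn (cen (firstCoord hn x)) ≠ 0 := by
    intro h0
    have := hpos j
    rw [HypCurve.ell_congr (h.cen_first _).symm (h.cen_end x hr j h0), h0] at this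
    exact lt_irrefl _ this
  refine ⟨lt_of_le_of_ne hr.1.1 fun he => key ?_, lt_of_le_of_ne hr.1.2 fun he => key ?_⟩
  · rw [← he, hlo]
  · rw [he, hhi]

lemma cen_mem_domain (h : IsArrangement hn H lo hi cen) {s : ℝ} (hs : s ∈ Ioo lo hi) :
    cen s ∈ domain hn H :=
  h.mem_domain_iff.2 ⟨h.cen_mem (Ioo_subset_Icc_self hs), h.cen_pos s hs⟩

lemma combo_mem_region {x y : EuclideanSpace ℝ (Fin n)}
    (hx : x ∈ region hn H lo hi) (hy : y ∈ region hn H lo hi)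
    (hxy : firstCoord hn x = firstCoord hn y) {s t : ℝ} (hs : 0 ≤ s) (ht : 0 ≤ t)
    (hst : s + t = 1) : s • x + t • y ∈ region hn H lo hi := by
  refine ⟨by rw [firstCoord_combo hxy hst]; exact hx.1, fun j => ?_⟩
  rw [HypCurve.ell_combo hxy hst]
  exact add_nonneg (mul_nonneg hs (hx.2 j)) (mul_nonneg ht (hy.2 j))

lemma isConnected_domain (h : IsArrangement hn H lo hi cen) : IsConnected (domain hn H) := by
  refine isConnected_of_section (φ := firstCoord hn) isPreconnected_Ioo (nonempty_Ioo.2 h.lt)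
    h.cen_cont.continuousOn (fun s hs => h.cen_mem_domain hs) fun x hx => ⟨h.first_mem_Ioo hx, ?_⟩
  rintro _ ⟨s, t, hs, ht, hst, rfl⟩
  have hc := h.cen_mem_domain (h.first_mem_Ioo hx)
  rw [h.mem_domain_iff] at hx hc ⊢
  have hxy := (h.cen_first (firstCoord hn x)).symm
  refine ⟨combo_mem_region hx.1 hc.1 hxy hs ht hst, fun j => ?_⟩
  rw [HypCurve.ell_combo hxy hst]
  rcases hs.eq_or_lt with rfl | hs
  · rw [zero_mul, zero_add, show t = 1 by linarith, one_mul]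
    exact hc.2 j
  · exact add_pos_of_pos_of_nonneg (mul_pos hs (hx.2 j)) (mul_nonneg ht (hc.2 j).le)

lemma isClosed_region : IsClosed (region hn H lo hi) := by
  refine (isClosed_Icc.preimage continuous_firstCoord).inter ?_
  change IsClosed {x | ∀ j, 0 ≤ (H j).ell hn x}
  rw [ofPred_forall]
  exact isClosed_iInter fun j => isClosed_le continuous_const ((H j).continuous_ell hn)

/-- A point of the region is first moved slightly towards the centre of its slice, which makes
positive every function that is positive at the centre. The remaining functions become positive by
translating along the central curve to an interior value of the first coordinate. -/
lemma closure_domain (h : IsArrangement hn H lo hi cen) :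
    closure (domain hn H) = region hn H lo hi := by
  apply Subset.antisymm
  · exact closure_minimal (fun x hx => (h.mem_domain_iff.1 hx).1) isClosed_region
  intro x hx
  set s₀ := firstCoord hn x with hs₀
  have hvert : ∀ t ∈ Ioo (0 : ℝ) 1, (1 - t) • x + t • cen s₀ ∈ closure (domain hn H) := by
    intro t ht
    set y := (1 - t) • x + t • cen s₀ with hy
    have hy0 : firstCoord hn y = s₀ := firstCoord_combo (h.cen_first s₀).symm (by ring)
    have hyell : ∀ j, (H j).ell hn y = (1 - t) * (H j).ell hn x + t * (H j).ell hn (cen s₀) :=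
      fun j => HypCurve.ell_combo (h.cen_first s₀).symm (by ring)
    let γ : ℝ → EuclideanSpace ℝ (Fin n) := fun s => y + (cen s - cen s₀)
    have hγ : Continuous γ := continuous_const.add (h.cen_cont.sub continuous_const)
    have hγ₀ : γ s₀ = y := by simp [γ]
    have hγ1 : ∀ s, firstCoord hn (γ s) = s := by
      intro s
      have : firstCoord hn (γ s) = firstCoord hn y + (firstCoord hn (cen s) -
        firstCoord hn (cen s₀)) := rfl
      rw [this, h.cen_first, h.cen_first, hy0]
      ring
    have hmem : s₀ ∈ closure (Ioo lo hi) := by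
      rw [closure_Ioo h.lt.ne]
      exact hx.1
    have hev : ∀ᶠ s in 𝓝[Ioo lo hi] s₀, γ s ∈ domain hn H := by
      have h1 : ∀ j, ∀ᶠ s in 𝓝[Ioo lo hi] s₀, 0 < (H j).ell hn (γ s) := by
        intro j
        -- If the function vanishes at the centre, `y` agrees with the centre in its plane, so `γ`
        -- agrees with `cen` there and `cen_pos` applies. Otherwise the function is already positive
        -- at `y` and stays so nearby.
        rcases (h.cen_nonneg s₀ hx.1 j).eq_or_lt with h0 | h0
        · filter_upwards [self_mem_nhdsWithin] with s hs
          have hk := h.cen_end x hx j h0.symm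
          have : (H j).ell hn (γ s) = (H j).ell hn (cen s) := by
            refine HypCurve.ell_congr (by rw [hγ1, h.cen_first]) ?_
            simp only [γ, hy, PiLp.add_apply, PiLp.smul_apply, PiLp.sub_apply, smul_eq_mul, hk]
            ring
          rw [this]
          exact h.cen_pos s hs j
        · have hc : ContinuousAt (fun s => (H j).ell hn (γ s)) s₀ :=
            (((H j).continuous_ell hn).comp hγ).continuousAt
          refine (hc.eventually (lt_mem_nhds ?_)).filter_mono nhdsWithin_le_nhds
          change 0 < (H j).ell hn (γ s₀)
          rw [hγ₀, hyell]
          exact add_pos_of_nonneg_of_pos (mul_nonneg (by linarith [ht.2]) (hx.2 j))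
            (mul_pos ht.1 h0)
      filter_upwards [eventually_all.2 h1, self_mem_nhdsWithin] with s hs hs'
      exact h.mem_domain_iff.2 ⟨⟨by rw [hγ1]; exact Ioo_subset_Icc_self hs', fun j => (hs j).le⟩, hs⟩
    rw [mem_closure_iff_nhdsWithin_neBot] at hmem
    rw [← hγ₀]
    exact mem_closure_of_tendsto (hγ.continuousAt.tendsto.mono_left nhdsWithin_le_nhds) hev
  have hlim : Tendsto (fun t : ℝ => (1 - t) • x + t • cen s₀) (𝓝[Ioo 0 1] 0) (𝓝 x) := by
    have : Continuous fun t : ℝ => (1 - t) • x + t • cen s₀ := by fun_prop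
    have h0 := this.tendsto 0
    simp only [sub_zero, one_smul, zero_smul, add_zero] at h0
    exact h0.mono_left nhdsWithin_le_nhds
  have hmem : (0 : ℝ) ∈ closure (Ioo 0 1) := by
    rw [closure_Ioo zero_ne_one]
    exact ⟨le_rfl, zero_le_one⟩
  rw [mem_closure_iff_nhdsWithin_neBot] at hmem
  rw [← closure_closure]
  exact mem_closure_of_tendsto hlim (eventually_of_mem self_mem_nhdsWithin hvert)

lemma isOpen_domain : IsOpen (domain hn H) := by
  unfold domain
  simp only [ofPred_forall]
  exact isOpen_iInter_of_finite fun j => isOpen_lt continuous_const (continuous_polyFun _)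

/-- The differentials of the quadratic functions are linearly independent at the common points of
the hyperbolic cylinders. -/
lemma indep_dq (h : IsArrangement hn H lo hi cen) {x : EuclideanSpace ℝ (Fin n)} {g : Fin L → ℝ}
    (hg : ∀ j, g j ≠ 0 → x ∈ (H j).surface hn) (hsum : ∑ j, g j • (H j).dq hn x = 0) :
    g = 0 := by
  have happ : ∀ v, ∑ j, g j * (H j).dq hn x v = 0 := fun v => by
    have := congrArg (fun φ : EuclideanSpace ℝ (Fin n) →L[ℝ] ℝ => φ v) hsum
    simpa using this
  have hk : ∀ k : Fin n, k ≠ ⟨0, hn⟩ →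
      ∑ j, g j * (if (H j).k = k then firstCoord hn x - (H j).a else 0) = 0 := by
    intro k hk
    refine (Finset.sum_congr rfl fun j _ => ?_).trans (happ (EuclideanSpace.single k 1))
    rw [HypCurve.dq_apply]
    simp [firstCoord, hk.symm]
  -- In the direction of x_k the differential is x_1 - a ≠ 0, so a curve that is alone in its plane
  -- must have coefficient zero.
  have hpair : ∀ j, g j ≠ 0 → ∃ i, i ≠ j ∧ (H i).k = (H j).k ∧ g i ≠ 0 := by
    intro j hj
    by_contra hcon
    push Not at hcon
    have h1 := hk (H j).k (h.nondeg j).k_ne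
    rw [Finset.sum_eq_single j] at h1
    · simp only [if_true] at h1
      rcases mul_eq_zero.1 h1 with h2 | h2
      · exact hj h2
      · exact (h.nondeg j).first_ne (hg j hj).1 h2
    · intro i _ hij
      by_cases hik : (H i).k = (H j).k
      · rw [hcon i hij hik, zero_mul]
      · rw [if_neg hik, mul_zero]
    · simp
  by_contra hne
  obtain ⟨j, hj⟩ := Function.ne_iff.1 hne
  obtain ⟨i, hij, hik, hi⟩ := hpair j hj
  -- Any further nonzero coefficient would belong to another crossing pair at the same point. Only
  -- one pair is left, and its determinant is nonzero.
  have hother : ∀ l, l ≠ i ∧ l ≠ j → g l = 0 := by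
    rintro l ⟨hli, hlj⟩
    by_contra hl
    obtain ⟨l', hl', hlk, hgl'⟩ := hpair l hl
    rcases h.crossing_unique i j l l' hij hik hl'.symm hlk.symm x (hg i hi) (hg j hj) (hg l hl)
      (hg l' hgl') with h1 | h1
    · exact hli h1
    · exact hlj h1
  have h1 := hk (H j).k (h.nondeg j).k_ne
  rw [Fintype.sum_eq_add i j hij fun l hl => by rw [hother l hl, zero_mul]] at h1
  simp only [hik, if_true] at h1
  have h2 := happ (EuclideanSpace.single ⟨0, hn⟩ 1)
  rw [Fintype.sum_eq_add i j hij fun l hl => by rw [hother l hl, zero_mul],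
    HypCurve.dq_apply, HypCurve.dq_apply] at h2
  simp only [firstCoord, PiLp.single_apply, (h.nondeg i).k_ne, (h.nondeg j).k_ne, if_true,
    if_false, mul_zero, mul_one, zero_add] at h2
  have hdet := h.crossing i j hij hik x (hg i hi) (hg j hj)
  refine (mul_ne_zero hj hdet) ?_
  change g i * (x (H i).k - (H i).b) + g j * (x (H j).k - (H j).b) = 0 at h2
  have h3 : (firstCoord hn x - (H i).a) * (g i * (x (H i).k - (H i).b) +
    g j * (x (H j).k - (H j).b)) = 0 := by rw [h2, mul_zero]
  linear_combination h3 - (x (H i).k - (H i).b) * h1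

/-- At a boundary point a vanishing polynomial has differential a nonzero multiple of that of its
quadratic function, so `indep_dq` transfers. -/
lemma isRegularDomain (h : IsArrangement hn H lo hi cen) :
    IsRegularDomain (domain hn H) fun j => (H j).poly hn where
  eq_inter := rfl
  closure_eq := by rw [h.closure_domain, h.region_eq]
  indep p hp g hg hsum := by
    rw [h.closure_domain] at hp
    have hS : ∀ j, g j ≠ 0 → p ∈ (H j).surface hn := fun j hj =>
      (h.poly_eq_zero_iff hp j).1 (by_contra fun h0 => hj (hg j h0))
    have hz := h.indep_dq (x := p)
      (g := fun j => g j * ((H j).ε * ((H j).g₀ + (H j).g₁ * (H j).c)))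
      (fun j hj => hS j (left_ne_zero_of_mul hj)) (by
        rw [← hsum]
        refine Finset.sum_congr rfl fun j _ => ?_
        by_cases hj : g j = 0
        · rw [hj, zero_mul, zero_smul, zero_smul]
        · rw [HypCurve.fderiv_poly _ _ (hS j hj).1, smul_smul])
    funext j
    have := congrFun hz j
    exact (mul_eq_zero.1 this).resolve_right (h.nondeg j).ε_mul_ne_zero

end IsArrangement

end HypRAG

/-! ### The NC conditions and the boundary pieces -/

namespace HypRAG

open Topology Filter

/-- In a regular domain, the values of the differentials of the vanishing functions can be
prescribed. -/
lemma IsRegularDomain.exists_fderiv_eq {n L : ℕ} {D : Set (EuclideanSpace ℝ (Fin n))}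
    {f : Fin L → MvPolynomial (Fin n) ℝ} (h : IsRegularDomain D f)
    {p : EuclideanSpace ℝ (Fin n)} (hp : p ∈ closure D) (w : Fin L → ℝ) :
    ∃ v, ∀ j, polyFun (f j) p = 0 → fderiv ℝ (polyFun (f j)) p v = w j := by
  classical
  have hli : LinearIndependent ℝ fun j : {j // polyFun (f j) p = 0} =>
      fderiv ℝ (polyFun (f j)) p := by
    rw [Fintype.linearIndependent_iff]
    intro g hg j
    have := h.indep p hp (fun i => if hi : polyFun (f i) p = 0 then g ⟨i, hi⟩ else 0)
      (fun i hi => dif_neg hi) (by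
        rw [← hg, ← Finset.sum_subset (Finset.subset_univ {i | polyFun (f i) p = 0}),
          Finset.sum_subtype _ (p := fun i => polyFun (f i) p = 0) (by simp)]
        · exact Finset.sum_congr rfl fun i _ => by rw [dif_pos i.2]
        · intro i _ hi
          rw [dif_neg (by simpa using hi), zero_smul])
    simpa [j.2] using congrFun this j
  obtain ⟨v, hv⟩ := surjective_of_linearIndependent' hli fun j => w j
  exact ⟨v, fun j hj => congrFun hv ⟨j, hj⟩⟩

/-- The part of the boundary of a regular domain in a hypersurface is a submanifold with
corners. -/
lemma IsRegularDomain.isSubmanifoldWithCorners {n L : ℕ} (hn : 0 < n)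
    {D : Set (EuclideanSpace ℝ (Fin n))} {f : Fin L → MvPolynomial (Fin n) ℝ}
    (h : IsRegularDomain D f) (j : Fin L) :
    IsSubmanifoldWithCorners {x ∈ closure D | polyFun (f j) x = 0} (n - 1) := by
  classical
  rintro p ⟨hp, hpj⟩
  set A : Finset (Fin L) := {i | i ≠ j ∧ polyFun (f i) p = 0} with hA
  have hAmem : ∀ i, i ∈ A ↔ i ≠ j ∧ polyFun (f i) p = 0 := fun i => by simp [hA]
  let e : Fin A.card ≃ A := A.equivFin.symm
  let G : EuclideanSpace ℝ (Fin n) → EuclideanSpace ℝ (Fin 1) := fun x =>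
    WithLp.toLp 2 fun _ => polyFun (f j) x
  let K : EuclideanSpace ℝ (Fin n) → EuclideanSpace ℝ (Fin A.card) := fun x =>
    WithLp.toLp 2 fun i => polyFun (f (e i)) x
  have hG : ContDiff ℝ ∞ G :=
    contDiff_euclidean.2 fun _ => (contDiff_polyFun (f j)).of_le le_top
  have hK : ContDiff ℝ ∞ K :=
    contDiff_euclidean.2 fun i => (contDiff_polyFun (f (e i))).of_le le_top
  have hGd : ∀ v, fderiv ℝ G p v = WithLp.toLp 2 fun _ => fderiv ℝ (polyFun (f j)) p v := by
    intro v
    ext i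
    have h1 := (EuclideanSpace.proj i : EuclideanSpace ℝ (Fin 1) →L[ℝ] ℝ).hasFDerivAt.comp p
      (hG.differentiable (by simp) p).hasFDerivAt
    exact (congrArg (fun φ : EuclideanSpace ℝ (Fin n) →L[ℝ] ℝ => φ v) h1.fderiv).symm
  have hKd : ∀ v, fderiv ℝ K p v =
      WithLp.toLp 2 fun i => fderiv ℝ (polyFun (f (e i))) p v := by
    intro v
    ext i
    have h1 := (EuclideanSpace.proj i : EuclideanSpace ℝ (Fin A.card) →L[ℝ] ℝ).hasFDerivAt.comp p
      (hK.differentiable (by simp) p).hasFDerivAt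
    exact (congrArg (fun φ : EuclideanSpace ℝ (Fin n) →L[ℝ] ℝ => φ v) h1.fderiv).symm
  -- In this neighbourhood the functions not vanishing at p stay positive and drop out of the local
  -- description.
  refine ⟨{x | ∀ i, polyFun (f i) p ≠ 0 → 0 < polyFun (f i) x}, ?_, ?_, 1, A.card, ?_, G, K,
    hG.contDiffOn, hK.contDiffOn, ?_, ?_⟩
  · simp only [ofPred_forall]
    exact isOpen_iInter_of_finite fun i => isOpen_iInter_of_finite fun _ =>
      isOpen_lt continuous_const (continuous_polyFun _)
  · intro i hi
    rw [h.closure_eq] at hp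
    exact lt_of_le_of_ne (hp i) hi.symm
  · rw [finrank_euclideanSpace, Fintype.card_fin]
    omega
  · rintro ⟨α, β⟩
    obtain ⟨v, hv⟩ := h.exists_fderiv_eq hp fun i =>
      if hi : i ∈ A then β (e.symm ⟨i, hi⟩) else α 0
    refine ⟨v, Prod.ext ?_ ?_⟩
    · dsimp only
      rw [hGd]
      ext i
      have hjA : j ∉ A := fun hj => ((hAmem j).1 hj).1 rfl
      change fderiv ℝ (polyFun (f j)) p v = α i
      rw [hv j hpj, dif_neg hjA, Subsingleton.elim i 0]
    · dsimp only
      rw [hKd]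
      ext i
      change fderiv ℝ (polyFun (f (e i))) p v = β i
      rw [hv _ ((hAmem _).1 (e i).2).2, dif_pos (e i).2, Subtype.coe_eta, e.symm_apply_apply]
  · ext x
    rw [h.closure_eq]
    constructor
    · rintro ⟨⟨hx, hxj⟩, hxU⟩
      exact ⟨hxU, by ext; exact hxj, fun i => hx (e i)⟩
    · rintro ⟨hxU, hxj, hxA⟩
      have hxj : polyFun (f j) x = 0 := congrArg (fun y : EuclideanSpace ℝ (Fin 1) => y 0) hxj
      refine ⟨⟨fun i => ?_, hxj⟩, hxU⟩
      by_cases hij : i = j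
      · rw [hij, hxj]
      by_cases hi : polyFun (f i) p = 0
      · have := hxA (e.symm ⟨i, (hAmem i).2 ⟨hij, hi⟩⟩)
        change 0 ≤ polyFun (f (e (e.symm _))) x at this
        rwa [e.apply_symm_apply] at this
      · exact (hxU i hi).le

namespace IsArrangement

variable {n L : ℕ} {hn : 0 < n} {H : Fin L → HypCurve n} {lo hi : ℝ}
  {cen : ℝ → EuclideanSpace ℝ (Fin n)}

lemma linearIndependent_dq (h : IsArrangement hn H lo hi cen) (Λ : Finset (Fin L))
    {p : EuclideanSpace ℝ (Fin n)} (hp : p ∈ ⋂ j ∈ Λ, (H j).surface hn) :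
    LinearIndependent ℝ fun j : Λ => (H j).dq hn p := by
  classical
  rw [Fintype.linearIndependent_iff]
  intro g hg j
  simp only [mem_iInter] at hp
  have := h.indep_dq (x := p) (g := fun i => if hi : i ∈ Λ then g ⟨i, hi⟩ else 0)
    (fun i hi => hp i (by by_contra hi'; exact hi (dif_neg hi'))) (by
      rw [← hg, ← Finset.sum_subset (Finset.subset_univ Λ), ← Finset.sum_coe_sort Λ]
      · exact Finset.sum_congr rfl fun i _ => by rw [dif_pos i.2]
      · intro i _ hi
        rw [dif_neg hi, zero_smul])
  simpa using congrFun this j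

lemma mem_iInter_surface_iff {Λ : Finset (Fin L)} {x : EuclideanSpace ℝ (Fin n)}
    (hx : ∀ j ∈ Λ, 0 < (H j).σ * (x (H j).k - (H j).b)) :
    x ∈ ⋂ j ∈ Λ, (H j).surface hn ↔ ∀ j ∈ Λ, (H j).q hn x - (H j).c = 0 := by
  simp only [mem_iInter, sub_eq_zero]
  exact ⟨fun h j hj => (h j hj).1, fun h j hj => ⟨h j hj, hx j hj⟩⟩

/-- On the open set where every x_k is on the side of its branch, the intersection is the regular
common zero set of the quadrics. -/
lemma tangentSpaceAt_iInter (h : IsArrangement hn H lo hi cen) (Λ : Finset (Fin L))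
    {p : EuclideanSpace ℝ (Fin n)} (hp : p ∈ ⋂ j ∈ Λ, (H j).surface hn)
    {v : EuclideanSpace ℝ (Fin n)} :
    v ∈ tangentSpaceAt (⋂ j ∈ Λ, (H j).surface hn) p ↔ ∀ j ∈ Λ, (H j).dq hn p v = 0 := by
  let F : EuclideanSpace ℝ (Fin n) → Λ → ℝ := fun x j => polyFun ((H j).quadric hn) x
  have hF : ContDiff ℝ ω F := contDiff_pi.2 fun j => contDiff_polyFun _
  have hFd : ∀ v j, fderiv ℝ F p v j = (H j).dq hn p v := by
    intro v j
    rw [← HypCurve.fderiv_quadric, show F = fun x j => F x j from rfl,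
      fderiv_pi fun j => differentiable_polyFun _ _]
    rfl
  have hU : IsOpen {x : EuclideanSpace ℝ (Fin n) |
      ∀ j ∈ Λ, 0 < (H j).σ * (x (H j).k - (H j).b)} := by
    simp only [ofPred_forall]
    exact isOpen_biInter_finset fun j _ => isOpen_lt continuous_const (HypCurve.continuous_side)
  rw [tangentSpaceAt_eq_ker (hU.mem_nhds ?_) hF.contDiffAt ?_ ?_ hp]
  · change fderiv ℝ F p v = 0 ↔ _
    rw [funext_iff]
    simp only [hFd]
    exact ⟨fun h j hj => h ⟨j, hj⟩, fun h j => h j j.2⟩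
  · simp only [mem_iInter] at hp
    exact fun j hj => (hp j hj).2
  · intro w
    obtain ⟨v, hv⟩ := surjective_of_linearIndependent' (h.linearIndependent_dq Λ hp) w
    exact ⟨v, funext fun j => (hFd v j).trans (congrFun hv j)⟩
  · ext x
    constructor
    · rintro ⟨hx, hxU⟩
      refine ⟨hxU, funext fun j => ?_⟩
      exact (HypCurve.polyFun_quadric _ _ _).trans ((mem_iInter_surface_iff hxU).1 hx j j.2)
    · rintro ⟨hxU, hx⟩
      refine ⟨(mem_iInter_surface_iff hxU).2 fun j hj => ?_, hxU⟩
      rw [← HypCurve.polyFun_quadric]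
      exact congrFun hx ⟨j, hj⟩

/-- The quadrics serve as equations. A component of their common zero set lies in a component of
each single quadric, hence in each branch. -/
lemma isNonsingularAlgebraic_iInter (h : IsArrangement hn H lo hi cen) (Λ : Finset (Fin L))
    (hne : (⋂ j ∈ Λ, (H j).surface hn).Nonempty) :
    ∃ d, d + Λ.card = n ∧ IsNonsingularAlgebraic (⋂ j ∈ Λ, (H j).surface hn) d := by
  obtain ⟨p, hp⟩ := hne
  have hcard : Λ.card ≤ n := by
    have hli := h.linearIndependent_dq Λ hp
    have hsur := surjective_of_linearIndependent' hli
    have := LinearMap.finrank_le_finrank_of_surjective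
      (f := LinearMap.pi fun j : Λ => ((H j).dq hn p : EuclideanSpace ℝ (Fin n) →ₗ[ℝ] ℝ)) hsur
    simpa using this
  refine ⟨n - Λ.card, by omega, Λ.card, by rw [Fintype.card_fin]; omega,
    fun i => (H (Λ.equivFin.symm i)).quadric hn, ⟨?_, ?_⟩, ?_⟩
  · intro x hx i
    rw [mem_iInter₂] at hx
    exact HypCurve.surface_subset_quadric (hx _ (Λ.equivFin.symm i).2)
  · intro x hx
    refine subset_iInter₂ fun j hj => ?_
    rw [mem_iInter₂] at hx
    refine (connectedComponentIn_mono x ?_).trans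
      ((h.nondeg j).component_quadric_subset (hx j hj))
    intro y hy
    have hy' : polyFun ((H j).quadric hn) y = 0 := by
      simpa using hy (Λ.equivFin ⟨j, hj⟩)
    exact hy'
  · intro x hx
    simp only [HypCurve.fderiv_quadric]
    exact (h.linearIndependent_dq Λ hx).comp _ Λ.equivFin.symm.injective

lemma isNC (h : IsArrangement hn H lo hi cen) :
    IsNC (domain hn H) (fun j => (H j).poly hn) fun j => (H j).surface hn where
  pos := h.pos
  isOpen := isOpen_domain
  isConnected := h.isConnected_domain
  eq_inter := rfl
  closure_eq := h.isRegularDomain.closure_eq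
  components j := (h.nondeg j).isUnionOfComponents
  nonsingular j p hp := by
    rw [HypCurve.fderiv_poly _ _ hp.1]
    refine smul_ne_zero (h.nondeg j).ε_mul_ne_zero fun h0 => ?_
    have := HypCurve.dq_apply hn (H j) p (EuclideanSpace.single (H j).k 1)
    rw [h0] at this
    simp only [_root_.zero_apply, PiLp.single_apply, if_true, mul_one, firstCoord,
      (h.nondeg j).k_ne.symm, if_false, mul_zero, add_zero] at this
    exact (h.nondeg j).first_ne hp.1 this.symm
  disjoint_rest j := by
    rw [h.closure_domain, Set.disjoint_left]
    rintro x ⟨hx, hxS⟩ hxr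
    exact hxS ((h.poly_eq_zero_iff hxr j).1 hx)
  inter_nonsingular Λ _ := by
    rcases (⋂ j ∈ Λ, (H j).surface hn).eq_empty_or_nonempty with h0 | h0
    · exact Or.inl h0
    · exact Or.inr (h.isNonsingularAlgebraic_iInter Λ h0)
  transversal Λ _ p hp := by
    ext v
    rw [h.tangentSpaceAt_iInter Λ hp]
    simp only [Submodule.mem_iInf]
    refine forall₂_congr fun j hj => ?_
    have h1 := h.tangentSpaceAt_iInter {j} (p := p) (v := v) (by
      rw [mem_iInter₂] at hp
      simpa using hp j hj)
    simp only [Finset.mem_singleton, iInter_iInter_eq_left, forall_eq] at h1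
    exact h1.symm

lemma surface_inter_closure (h : IsArrangement hn H lo hi cen) (j : Fin L) :
    (H j).surface hn ∩ closure (domain hn H) =
      {x ∈ closure (domain hn H) | polyFun ((H j).poly hn) x = 0} := by
  ext x
  rw [h.closure_domain]
  constructor
  · rintro ⟨h1, h2⟩
    exact ⟨h2, (h.poly_eq_zero_iff h2 j).2 h1⟩
  · rintro ⟨h1, h2⟩
    exact ⟨(h.poly_eq_zero_iff h1 j).1 h2, h1⟩

lemma firstCoord_pieceSection (h : IsArrangement hn H lo hi cen) (j : Fin L) (s : ℝ) :
    firstCoord hn (pieceSection H cen j s) = s := by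
  rw [pieceSection, firstCoord_setCoord (h.nondeg j).k_ne, h.cen_first]

lemma q_pieceSection (h : IsArrangement hn H lo hi cen) (j : Fin L) {s : ℝ} (hs : s ≠ (H j).a) :
    (H j).q hn (pieceSection H cen j s) = (H j).c := by
  rw [HypCurve.q, h.firstCoord_pieceSection, pieceSection, setCoord_same, add_sub_cancel_left]
  exact mul_div_cancel₀ _ (sub_ne_zero.2 hs)

/-- Over the interval J the piece contains the curve `pieceSection`. The segment from a point of the
piece to it stays in the slice, and the j-th function, affine there and zero at both ends, vanishes
along it. -/
lemma isConnected_piece (h : IsArrangement hn H lo hi cen) (j : Fin L) :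
    IsConnected ((H j).surface hn ∩ closure (domain hn H)) := by
  obtain ⟨J, hJ, hne, hsec, hmem⟩ := h.piece j
  rw [h.closure_domain]
  refine isConnected_of_section (γ := pieceSection H cen j) (φ := firstCoord hn)
    hJ.isPreconnected hne ?_ (fun s hs => ⟨h.side _ (hsec s hs).2 j
      (h.q_pieceSection j (hsec s hs).1), (hsec s hs).2⟩) fun x hx => ⟨hmem x hx.2 hx.1, ?_⟩
  · refine (PiLp.continuous_toLp 2 _).comp_continuousOn (continuousOn_pi.2 fun i => ?_)
    by_cases hi : i = (H j).k
    · subst hi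
      simp only [Function.update_self]
      exact continuousOn_const.add (continuousOn_const.div (by fun_prop)
        fun s hs => sub_ne_zero.2 (hsec s hs).1)
    · simp only [Function.update_of_ne hi]
      have : Continuous fun x : EuclideanSpace ℝ (Fin n) => x i := by fun_prop
      exact (this.comp h.cen_cont).continuousOn
  · rintro _ ⟨s, t, hs, ht, hst, rfl⟩
    obtain ⟨hsa, hreg⟩ := hsec _ (hmem x hx.2 hx.1)
    have hxy := (h.firstCoord_pieceSection j (firstCoord hn x)).symm
    have hr := combo_mem_region hx.2 hreg hxy hs ht hst
    refine ⟨h.side _ hr j ?_, hr⟩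
    rw [← (h.nondeg j).ell_eq_zero_iff, HypCurve.ell_combo hxy hst,
      (h.nondeg j).ell_eq_zero_iff.2 hx.1.1,
      (h.nondeg j).ell_eq_zero_iff.2 (h.q_pieceSection j hsa)]
    ring

lemma isSurroundedBy (h : IsArrangement hn H lo hi cen) :
    IsSurroundedBy (domain hn H) fun j => (H j).surface hn where
  boundary_eq := by
    simp only [h.surface_inter_closure]
    ext x
    simp only [mem_iUnion]
    constructor
    · rintro ⟨hx, hxD⟩
      obtain ⟨j, hj⟩ := h.isRegularDomain.exists_polyFun_eq_zero hx hxD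
      exact ⟨j, hx, hj⟩
    · rintro ⟨j, hx, hj⟩
      exact ⟨hx, h.isRegularDomain.not_mem_of_polyFun_eq_zero hj⟩
  piece_connected := h.isConnected_piece
  piece_submanifold j := by
    rw [h.surface_inter_closure]
    exact h.isRegularDomain.isSubmanifoldWithCorners hn j
  degree_le_two j := ⟨_, HypCurve.totalDegree_quadric_le, (h.nondeg j).isComponent_quadric
    ((h.isConnected_piece j).nonempty.mono inter_subset_left)⟩

end IsArrangement

end HypRAG

/-! ### Slices, fibres and singular values of the first coordinate -/

namespace HypRAG

open Topology Filter

/-- The points of the region over a value of the first coordinate. -/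
def slice {n L : ℕ} (hn : 0 < n) (H : Fin L → HypCurve n) (lo hi s : ℝ) :
    Set (EuclideanSpace ℝ (Fin n)) := region hn H lo hi ∩ firstCoord hn ⁻¹' {s}

namespace IsArrangement

variable {n L : ℕ} {hn : 0 < n} {H : Fin L → HypCurve n} {lo hi : ℝ}
  {cen : ℝ → EuclideanSpace ℝ (Fin n)}

lemma cen_mem_slice (h : IsArrangement hn H lo hi cen) {s : ℝ} (hs : s ∈ Icc lo hi) :
    cen s ∈ slice hn H lo hi s :=
  ⟨h.cen_mem hs, h.cen_first s⟩

lemma isConnected_slice (h : IsArrangement hn H lo hi cen) {s : ℝ} (hs : s ∈ Icc lo hi) :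
    IsConnected (slice hn H lo hi s) := by
  refine ⟨⟨_, h.cen_mem_slice hs⟩, Convex.isPreconnected ?_⟩
  rintro x ⟨hx, hxs⟩ y ⟨hy, hys⟩ a b ha hb hab
  have hxy : firstCoord hn x = firstCoord hn y := by
    rw [mem_preimage, mem_singleton_iff] at hxs hys
    rw [hxs, hys]
  exact ⟨combo_mem_region hx hy hxy ha hb hab, by
    rw [mem_preimage, firstCoord_combo hxy hab]; exact hxs⟩

lemma isClosed_slice {s : ℝ} : IsClosed (slice hn H lo hi s) :=
  isClosed_region.inter (isClosed_singleton.preimage continuous_firstCoord)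

/-- The interval of the `k`-th coordinates in a slice. -/
def _root_.HypRAG.coordInterval (hn : 0 < n) (H : Fin L → HypCurve n) (s : ℝ) (k : Fin n) : Set ℝ :=
  {y | (k = ⟨0, hn⟩ → y = s) ∧
    ∀ j, (H j).k = k → 0 ≤ (H j).ε * ((s - (H j).a) * (y - (H j).b) - (H j).c)}

/-- Each function involves the first coordinate and one other, so fixing the first decouples the
conditions and the slice is a product of intervals. -/
lemma slice_eq {s : ℝ} (hs : s ∈ Icc lo hi) :
    slice hn H lo hi s = {x | ∀ k, x k ∈ coordInterval hn H s k} := by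
  ext x
  constructor
  · rintro ⟨hx, hxs⟩ k
    have hxs : firstCoord hn x = s := hxs
    refine ⟨fun hk => by rw [hk]; exact hxs, ?_⟩
    rintro j rfl
    rw [← hxs]
    exact hx.2 j
  · intro hx
    have hxs : firstCoord hn x = s := (hx ⟨0, hn⟩).1 rfl
    refine ⟨⟨by rwa [hxs], fun j => ?_⟩, hxs⟩
    have := (hx (H j).k).2 j rfl
    rw [← hxs] at this
    exact this

lemma isClosed_coordInterval {s : ℝ} {k : Fin n} : IsClosed (coordInterval hn H s k) := by
  have : coordInterval hn H s k = {y | k = ⟨0, hn⟩ → y = s} ∩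
      ⋂ j, ⋂ (_ : (H j).k = k), {y | 0 ≤ (H j).ε * ((s - (H j).a) * (y - (H j).b) - (H j).c)} := by
    ext y
    simp [coordInterval]
  rw [this]
  refine IsClosed.inter ?_ (isClosed_iInter fun j => isClosed_iInter fun _ =>
    isClosed_le continuous_const (by fun_prop))
  by_cases hk : k = ⟨0, hn⟩
  · simp only [hk, forall_const]
    exact isClosed_eq continuous_id continuous_const
  · simp [hk]

lemma ordConnected_coordInterval {s : ℝ} {k : Fin n} :
    (coordInterval hn H s k).OrdConnected := by
  refine Convex.ordConnected ?_
  rintro x ⟨hx, hx'⟩ y ⟨hy, hy'⟩ a b ha hb hab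
  refine ⟨fun hk => ?_, fun j hj => ?_⟩
  · rw [hx hk, hy hk, smul_eq_mul, smul_eq_mul, ← add_mul, hab, one_mul]
  · have h1 := mul_nonneg ha (hx' j hj)
    have h2 := mul_nonneg hb (hy' j hj)
    simp only [smul_eq_mul]
    have : (H j).ε * ((s - (H j).a) * (a * x + b * y - (H j).b) - (H j).c) =
        a * ((H j).ε * ((s - (H j).a) * (x - (H j).b) - (H j).c)) +
        b * ((H j).ε * ((s - (H j).a) * (y - (H j).b) - (H j).c)) := by
      linear_combination ((H j).ε * ((s - (H j).a) * (H j).b + (H j).c)) * hab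
    rw [this]
    linarith

lemma setCoord_mem_slice {s : ℝ} (hs : s ∈ Icc lo hi)
    {x : EuclideanSpace ℝ (Fin n)} (hx : x ∈ slice hn H lo hi s) {k : Fin n} {y : ℝ}
    (hy : y ∈ coordInterval hn H s k) : setCoord k y x ∈ slice hn H lo hi s := by
  rw [slice_eq hs] at hx ⊢
  intro i
  by_cases hi : i = k
  · subst hi
    rwa [setCoord_same]
  · rw [setCoord_of_ne hi]
    exact hx i

/-- In the interior of a coordinate interval, the defining functions are positive. -/
lemma ell_pos_of_between (h : IsArrangement hn H lo hi cen) {s : ℝ} (hs : s ∈ Icc lo hi)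
    {x : EuclideanSpace ℝ (Fin n)} (hx : x ∈ slice hn H lo hi s) (j : Fin L) {y₁ y₂ : ℝ}
    (hy₁ : y₁ ∈ coordInterval hn H s (H j).k) (hy₂ : y₂ ∈ coordInterval hn H s (H j).k)
    (h₁ : y₁ < x (H j).k) (h₂ : x (H j).k < y₂) : 0 < (H j).ell hn x := by
  have hxs : firstCoord hn x = s := hx.2
  -- If the function vanished at the centre, `cen_end` would give all points of the slice the same
  -- k-th coordinate, against y₁ < x_k.
  have hc0 : 0 < (H j).ell hn (cen s) := by
    refine lt_of_le_of_ne (h.cen_nonneg s hs j) fun h0 => ?_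
    have hm₁ := setCoord_mem_slice hs hx hy₁
    have e₁ := h.cen_end x hx.1 j (by rw [hxs]; exact h0.symm)
    have e₂ := h.cen_end _ hm₁.1 j (by rw [show firstCoord hn _ = s from hm₁.2]; exact h0.symm)
    rw [setCoord_same, show firstCoord hn _ = s from hm₁.2] at e₂
    rw [hxs] at e₁
    linarith
  -- x_k lies between the centre and y₁ or y₂, with positive weight on the centre; the function is
  -- affine, positive at the centre and nonnegative at the other end.
  have key : ∀ y ∈ coordInterval hn H s (H j).k, ∀ θ : ℝ, 0 ≤ θ → θ < 1 →
      x (H j).k = (1 - θ) * cen s (H j).k + θ * y → 0 < (H j).ell hn x := by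
    intro y hy θ hθ hθ' hxy
    have hm := setCoord_mem_slice hs (h.cen_mem_slice hs) hy
    have hfirst : firstCoord hn (cen s) = firstCoord hn (setCoord (H j).k y (cen s)) := by
      rw [h.cen_first, firstCoord_setCoord (h.nondeg j).k_ne, h.cen_first]
    have : (H j).ell hn x = (H j).ell hn ((1 - θ) • cen s + θ • setCoord (H j).k y (cen s)) := by
      refine HypCurve.ell_congr ?_ ?_
      · rw [firstCoord_combo hfirst (by ring), h.cen_first, hxs]
      · simp [hxy]
    rw [this, HypCurve.ell_combo hfirst (by ring)]
    exact add_pos_of_pos_of_nonneg (mul_pos (by linarith) hc0) (mul_nonneg hθ (hm.1.2 j))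
  rcases le_total (x (H j).k) (cen s (H j).k) with hle | hle
  · have hpos : 0 < cen s (H j).k - y₁ := by linarith
    refine key y₁ hy₁ ((cen s (H j).k - x (H j).k) / (cen s (H j).k - y₁))
      (div_nonneg (by linarith) hpos.le) ((div_lt_one hpos).2 (by linarith)) ?_
    field_simp
    ring
  · have hpos : 0 < y₂ - cen s (H j).k := by linarith
    refine key y₂ hy₂ ((x (H j).k - cen s (H j).k) / (y₂ - cen s (H j).k))
      (div_nonneg (by linarith) hpos.le) ((div_lt_one hpos).2 (by linarith)) ?_
    field_simp
    ring

/-- The product of decompositions of the coordinate intervals; the first is a point, which gives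
dimension at most n - 1. On a cell the k-th coordinate is either constant or strictly inside its
interval, so each radius keeps its sign. These are the hypotheses of `hasCWDimLE_sphereBundle`. -/
lemma exists_cellDecomp_slice (h : IsArrangement hn H lo hi cen) {s : ℝ} (hs : s ∈ Icc lo hi) :
    ∃ K : CellDecomp (slice hn H lo hi s), (∀ i, Nat.card (K.κ i) ≤ n - 1) ∧
      ∀ i j, (∀ z ∈ openCube (K.κ i), 0 < radius (fun j => (H j).poly hn) j (K.χ i z)) ∨
        ∀ z ∈ openCube (K.κ i), radius (fun j => (H j).poly hn) j (K.χ i z) = 0 := by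
  have hex : ∀ k, ∃ K : CellDecomp (coordInterval hn H s k),
      (∀ i, Nat.card (K.κ i) ≤ if k = ⟨0, hn⟩ then 0 else 1) ∧ ∀ i,
      ((∀ z w, K.χ i z = K.χ i w) ∨ ∀ z ∈ openCube (K.κ i), ∃ y₁ ∈ coordInterval hn H s k,
        ∃ y₂ ∈ coordInterval hn H s k, y₁ < K.χ i z ∧ K.χ i z < y₂) := by
    intro k
    by_cases hk : k = ⟨0, hn⟩
    · have : coordInterval hn H s k = {s} := by
        ext y
        constructor
        · exact fun hy => hy.1 hk
        · rintro rfl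
          exact ⟨fun _ => rfl, fun j hj => absurd (hj.trans hk) (h.nondeg j).k_ne⟩
      rw [this]
      refine ⟨CellDecomp.point s, fun i => ?_, fun i => Or.inl fun _ _ => rfl⟩
      change Nat.card Empty ≤ _
      simp
    · have hcen := h.cen_mem_slice hs
      have hmem := hcen
      rw [slice_eq hs] at hmem
      obtain ⟨R, hR⟩ := h.bounded
      obtain ⟨K, hK⟩ := CellDecomp.exists_interval (isClosed_coordInterval (hn := hn) (H := H))
        (ordConnected_coordInterval (s := s) (k := k)) ⟨_, hmem k⟩ ⟨R, fun y hy => by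
          have := hR _ (setCoord_mem_slice hs hcen hy).1 k
          rwa [setCoord_same] at this⟩
      exact ⟨K, fun i => by rw [if_neg hk]; exact (hK i).1, fun i => (hK i).2⟩
  choose K hcard hK using hex
  rw [slice_eq hs]
  refine ⟨CellDecomp.pi K, fun i => ?_, fun i j => ?_⟩
  · change Nat.card (Σ k, (K k).κ (i k)) ≤ _
    have hfin : ∀ k, Finite ((K k).κ (i k)) := fun k => @Finite.of_fintype _ ((K k).fin (i k))
    rw [Nat.card_sigma]
    refine (Finset.sum_le_sum fun k _ => hcard k (i k)).trans ?_
    rw [← Finset.sum_filter_add_sum_filter_not _ (fun k => k = (⟨0, hn⟩ : Fin n))]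
    rw [Finset.sum_congr rfl (g := fun _ => 0) fun k hk => if_pos (Finset.mem_filter.1 hk).2,
      Finset.sum_congr rfl (g := fun _ => 1) fun k hk => if_neg (Finset.mem_filter.1 hk).2]
    rw [Finset.sum_const_zero, zero_add, ← Finset.card_eq_sum_ones,
      show Finset.univ.filter (fun k => ¬ k = (⟨0, hn⟩ : Fin n)) = Finset.univ.erase ⟨0, hn⟩ by
        ext; simp, Finset.card_erase_of_mem (Finset.mem_univ _), Finset.card_univ, Fintype.card_fin]
  · have hmem : ∀ z ∈ openCube ((CellDecomp.pi K).κ i), (CellDecomp.pi K).χ i z ∈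
        slice hn H lo hi s := fun z hz => by
      rw [slice_eq hs]
      exact ((CellDecomp.pi K).cover _).2 ⟨i, z, hz, rfl⟩
    have hrad : ∀ z ∈ openCube ((CellDecomp.pi K).κ i),
        0 < (H j).ell hn ((CellDecomp.pi K).χ i z) →
        0 < radius (fun j => (H j).poly hn) j ((CellDecomp.pi K).χ i z) := fun z hz hpos => by
      refine Real.sqrt_pos.2 ?_
      rw [HypCurve.polyFun_poly]
      exact mul_pos hpos (h.factor_pos _ (hmem z hz).1 j)
    rcases hK (H j).k (i (H j).k) with hconst | hbtw
    · by_cases hz0 : ∃ z ∈ openCube ((CellDecomp.pi K).κ i),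
          0 < (H j).ell hn ((CellDecomp.pi K).χ i z)
      · obtain ⟨z, hz, hpos⟩ := hz0
        refine Or.inl fun w hw => hrad w hw ?_
        have : (H j).ell hn ((CellDecomp.pi K).χ i w) = (H j).ell hn ((CellDecomp.pi K).χ i z) :=
          HypCurve.ell_congr ((show _ = s from (hmem w hw).2).trans
            (show _ = s from (hmem z hz).2).symm) (hconst _ _)
        rwa [this]
      · push Not at hz0
        refine Or.inr fun z hz => Real.sqrt_eq_zero'.2 ?_
        rw [HypCurve.polyFun_poly]
        exact mul_nonpos_of_nonpos_of_nonneg (hz0 z hz) (h.factor_pos _ (hmem z hz).1 j).le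
    · refine Or.inl fun z hz => hrad z hz ?_
      obtain ⟨y₁, hy₁, y₂, hy₂, h₁, h₂⟩ := hbtw (fun a => z ⟨(H j).k, a⟩) fun a => hz ⟨_, a⟩
      exact h.ell_pos_of_between hs (hmem z hz) j hy₁ hy₂ h₁ h₂

variable {d : Fin L → ℕ}

lemma fibre_eq (h : IsArrangement hn H lo hi cen) (s : ℝ) :
    totalManifold (domain hn H) (fun j => (H j).poly hn) d ∩
      (fun z => firstCoord hn (baseProj z)) ⁻¹' {s} =
    sphereBundle d (slice hn H lo hi s) (radius fun j => (H j).poly hn) := by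
  rw [slice, ← h.closure_domain]
  exact h.isRegularDomain.totalManifold_inter_preimage (firstCoord hn ⁻¹' {s})

/-- The singular values of the first coordinate are the crossing values in the region. -/
lemma mem_image_singularSet_iff (h : IsArrangement hn H lo hi cen) (hd : ∀ j, 0 < d j) {m : ℕ}
    (hm : 0 < m) {s : ℝ} :
    s ∈ (fun z => firstCoord hn (baseProj z)) ''
        singularSet (totalManifold (domain hn H) (fun j => (H j).poly hn) d) m
          (fun z => firstCoord hn (baseProj z)) ↔
      ∃ x ∈ slice hn H lo hi s, ∃ i j, i ≠ j ∧ (H i).k = (H j).k ∧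
        x ∈ (H i).surface hn ∧ x ∈ (H j).surface hn := by
  classical
  have hreg := h.isRegularDomain
  have key : ∀ x ∈ region hn H lo hi, (∀ u, (∀ j, polyFun ((H j).poly hn) x = 0 →
      fderiv ℝ (polyFun ((H j).poly hn)) x u = 0) → firstCoord hn u = 0) ↔
      ∃ i j, i ≠ j ∧ (H i).k = (H j).k ∧ x ∈ (H i).surface hn ∧ x ∈ (H j).surface hn := by
    intro x hx
    have hdq : ∀ u, (∀ j, polyFun ((H j).poly hn) x = 0 →
        fderiv ℝ (polyFun ((H j).poly hn)) x u = 0) ↔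
        ∀ j, x ∈ (H j).surface hn → (H j).dq hn x u = 0 := by
      intro u
      refine forall_congr' fun j => ?_
      rw [h.poly_eq_zero_iff hx]
      refine forall_congr' fun hj => ?_
      rw [HypCurve.fderiv_poly _ _ hj.1, _root_.smul_apply, smul_eq_mul, mul_eq_zero,
        or_iff_right (h.nondeg j).ε_mul_ne_zero]
    simp only [hdq]
    constructor
    · intro hu
      by_contra hcon
      push Not at hcon
      -- Without a crossing at x each plane contains at most one curve through x. Its slope is taken
      -- as u_k, so u is tangent to all curves while u_1 = 1 (the default value).
      let u : EuclideanSpace ℝ (Fin n) := WithLp.toLp 2 fun k =>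
        if hk : ∃ j, (H j).k = k ∧ x ∈ (H j).surface hn then
          -(x k - (H hk.choose).b) / (firstCoord hn x - (H hk.choose).a)
        else 1
      have hu0 : firstCoord hn u = 1 := by
        refine dif_neg ?_
        rintro ⟨j, hj, -⟩
        exact (h.nondeg j).k_ne hj
      have hz := hu u fun j hj => ?_
      · rw [hu0] at hz
        exact one_ne_zero hz
      · have hk : ∃ i, (H i).k = (H j).k ∧ x ∈ (H i).surface hn := ⟨j, rfl, hj⟩
        have hij : hk.choose = j := by
          by_contra hne
          exact hcon _ _ hne hk.choose_spec.1 hk.choose_spec.2 hj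
        have huk : u (H j).k = -(x (H j).k - (H j).b) / (firstCoord hn x - (H j).a) := by
          have : u (H j).k = -(x (H j).k - (H hk.choose).b) /
            (firstCoord hn x - (H hk.choose).a) := dif_pos hk
          rw [this, hij]
        rw [HypCurve.dq_apply, huk, hu0, mul_div_cancel₀ _ ((h.nondeg j).first_ne hj.1)]
        ring
    -- Two independent linear conditions on (u_1, u_k) force u_1 = 0.
    · rintro ⟨i, j, hij, hk, hi, hj⟩ u hu
      have h1 := hu i hi
      have h2 := hu j hj
      rw [HypCurve.dq_apply] at h1 h2
      have hdet := h.crossing i j hij hk x hi hj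
      refine (mul_eq_zero.1 ?_).resolve_left hdet
      rw [hk] at h1 ⊢
      linear_combination (firstCoord hn x - (H i).a) * h2 - (firstCoord hn x - (H j).a) * h1
  have hsing := fun z => hreg.mem_singularSet_linear_iff (d := d) hm
    (EuclideanSpace.proj (⟨0, hn⟩ : Fin n)) (z := z)
  constructor
  · rintro ⟨z, hz, rfl⟩
    obtain ⟨hzM, hz⟩ := (hsing z).1 hz
    have hr : baseProj z ∈ region hn H lo hi := by
      rw [← h.closure_domain]
      exact hzM.1
    exact ⟨baseProj z, ⟨hr, rfl⟩, (key _ hr).1 hz⟩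
  · rintro ⟨x, ⟨hx, rfl⟩, hpair⟩
    obtain ⟨z, hzM, rfl⟩ := hreg.exists_totalManifold hd (by rwa [h.closure_domain])
    exact ⟨z, (hsing z).2 ⟨hzM, (key _ hx).2 hpair⟩, rfl⟩

lemma isSmoothSubmanifold_fibre (h : IsArrangement hn H lo hi cen)
    {m : ℕ} (hm0 : 0 < m) (hm : n + ∑ j, d j = m + L) {s : ℝ}
    (hs : s ∉ (fun z => firstCoord hn (baseProj z)) ''
        singularSet (totalManifold (domain hn H) (fun j => (H j).poly hn) d) m
          (fun z => firstCoord hn (baseProj z))) :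
    IsSmoothSubmanifold (totalManifold (domain hn H) (fun j => (H j).poly hn) d ∩
      (fun z => firstCoord hn (baseProj z)) ⁻¹' {s}) (m - 1) := by
  have := h.isRegularDomain.isSmoothSubmanifold_inter (d := d) hm hm0
    (ContinuousLinearMap.pi fun _ : Fin 1 => EuclideanSpace.proj (⟨0, hn⟩ : Fin n)) (fun _ => s)
    fun z hz hzs w => ?_
  · convert this using 2
    ext z
    rw [mem_preimage, mem_singleton_iff, mem_ofPred_eq]
    exact ⟨fun hz => funext fun _ => hz, fun hz => congrFun hz 0⟩
  · have hzs' : firstCoord hn (baseProj z) = s := congrFun hzs 0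
    have hns : z ∉ singularSet (totalManifold (domain hn H) (fun j => (H j).poly hn) d) m
        (fun z => firstCoord hn (baseProj z)) := fun hz => hs ⟨z, hz, hzs'⟩
    have hsing := h.isRegularDomain.mem_singularSet_linear_iff (d := d) hm0
      (EuclideanSpace.proj (⟨0, hn⟩ : Fin n)) (z := z)
    have hns' := fun hall => hns (hsing.2 ⟨hz, hall⟩)
    -- Regularity provides an admissible direction with nonzero first coordinate, and rescaling it
    -- attains any prescribed value.
    by_contra hcon
    apply hns'
    intro u hu
    by_contra hu0
    apply hcon
    refine ⟨(w 0 / u ⟨0, hn⟩) • u, fun j hj => by rw [map_smul, hu j hj, smul_zero], ?_⟩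
    funext i
    have hu0 : u ⟨0, hn⟩ ≠ 0 := hu0
    rw [Subsingleton.elim i 0]
    change w 0 / u ⟨0, hn⟩ * u ⟨0, hn⟩ = w 0
    field_simp

/-- Only two facts about the arrangement remain to be supplied: its crossing values, and over which
intervals the slices are bounded above. A lower bound is part of `IsArrangement`; compactness passes
up through the sphere bundle and down through its projection. -/
lemma realizesData (h : IsArrangement hn H lo hi cen) (hd : ∀ j, 2 ≤ d j) {m : ℕ}
    (hm : n + ∑ j, d j = m + L) {l : ℕ} (hl : 1 < l) {t : Fin l → ℝ} {lab : Fin (l - 1) → Fin 2}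
    (ht : StrictMono t) (hlo : lo = t ⟨0, by omega⟩) (hhi : hi = t ⟨l - 1, by omega⟩)
    (hsing : ∀ s, (∃ x ∈ slice hn H lo hi s, ∃ i j, i ≠ j ∧ (H i).k = (H j).k ∧
        x ∈ (H i).surface hn ∧ x ∈ (H j).surface hn) ↔ s ∈ range t)
    (hcomp : ∀ j : Fin (l - 1), ∀ s ∈ Ioo (t ⟨j, by omega⟩) (t ⟨j + 1, by omega⟩), lab j = 0 →
      ∃ R, ∀ x ∈ slice hn H lo hi s, ∀ k, x k ≤ R)
    (hncomp : ∀ j : Fin (l - 1), ∀ s ∈ Ioo (t ⟨j, by omega⟩) (t ⟨j + 1, by omega⟩), lab j = 1 →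
      ∃ k, ∀ R, ∃ x ∈ slice hn H lo hi s, R < x k) :
    RealizesData hl t lab m (totalManifold (domain hn H) (fun j => (H j).poly hn) d)
      fun z => firstCoord hn (baseProj z) := by
  have hd0 : ∀ j, 0 < d j := fun j => two_pos.trans_le (hd j)
  have hsum := sum_sub_one hd
  have hm0 : 0 < m := by omega
  have himg : (fun z => firstCoord hn (baseProj z)) ''
      totalManifold (domain hn H) (fun j => (H j).poly hn) d = Icc lo hi := by
    ext s
    constructor
    · rintro ⟨z, hz, rfl⟩
      have := hz.1
      rw [h.closure_domain] at this
      exact this.1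
    · intro hs
      obtain ⟨z, hz, hzs⟩ := h.isRegularDomain.exists_totalManifold hd0
        (x := cen s) (by rw [h.closure_domain]; exact h.cen_mem hs)
      refine ⟨z, hz, ?_⟩
      change firstCoord hn (baseProj z) = s
      rw [hzs, h.cen_first]
  have hsub : ∀ j : Fin (l - 1), ∀ s ∈ Ioo (t ⟨j, by omega⟩) (t ⟨j + 1, by omega⟩),
      s ∈ Icc lo hi := by
    intro j s hs
    rw [hlo, hhi]
    exact ⟨(ht.monotone (Fin.mk_le_mk.2 (Nat.zero_le _))).trans hs.1.le,
      hs.2.le.trans (ht.monotone (Fin.mk_le_mk.2 (by omega)))⟩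
  have hcrit : (fun z => firstCoord hn (baseProj z)) ''
        singularSet (totalManifold (domain hn H) (fun j => (H j).poly hn) d) m
          (fun z => firstCoord hn (baseProj z)) = range t := by
    ext s
    rw [h.mem_image_singularSet_iff hd0 hm0, hsing]
  constructor
  · exact ⟨MvPolynomial.X (Sum.inl ⟨0, hn⟩), fun x _ => by simp [polyFun, baseProj, firstCoord]⟩
  · rw [himg, hlo, hhi]
  · exact hcrit
  · intro s hs
    rw [himg] at hs
    rw [h.fibre_eq]
    exact isConnected_sphereBundle hd (continuous_radius _) (h.isConnected_slice hs)
  · intro s hs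
    rw [himg] at hs
    rw [h.fibre_eq]
    obtain ⟨K, hK, hr⟩ := h.exists_cellDecomp_slice hs
    exact hasCWDimLE_sphereBundle hd0 K _ (continuous_radius _) hr hK (by omega)
  · intro j s hs
    refine h.isSmoothSubmanifold_fibre hm0 hm ?_
    rw [hcrit]
    rintro ⟨i, rfl⟩
    have h1 := ht.lt_iff_lt.1 hs.1
    have h2 := ht.lt_iff_lt.1 hs.2
    rw [Fin.lt_def] at h1 h2
    simp only at h1 h2
    omega
  · intro j s hs hlab
    rw [h.fibre_eq]
    refine isCompact_sphereBundle hd (continuous_radius _) ?_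
    obtain ⟨R, hR⟩ := hcomp j s hs hlab
    obtain ⟨R', hR'⟩ := h.bounded
    refine Metric.isCompact_of_isClosed_isBounded isClosed_slice ?_
    have hK : IsCompact (WithLp.toLp 2 '' (univ.pi fun _ : Fin n => Icc R' R)) :=
      (isCompact_univ_pi fun _ => isCompact_Icc).image (PiLp.continuous_toLp 2 _)
    refine hK.isBounded.subset fun x hx => ⟨fun k => x k, fun k _ => ?_, rfl⟩
    exact ⟨hR' x hx.1 k, hR x hx k⟩
  · intro j s hs hlab hK
    rw [h.fibre_eq] at hK
    obtain ⟨k, hk⟩ := hncomp j s hs hlab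
    have h1 := hK.image continuous_baseProj
    rw [image_baseProj_sphereBundle hd] at h1
    have h2 := h1.image (f := fun x : EuclideanSpace ℝ (Fin n) => x k) (by fun_prop)
    obtain ⟨R, hR⟩ := h2.bddAbove
    obtain ⟨x, hx, hlt⟩ := hk R
    exact absurd (hR ⟨x, hx, rfl⟩) hlt.not_ge

end IsArrangement

end HypRAG

namespace HypRAG

/-! ## The arrangement of hyperbolas -/

/-- The data of the arrangement: in the plane of the first and the `k`-th coordinate, `k ≥ 2`
(numbered from `0`), there is a corner over `τ k` and the region is unbounded over
`[τ k, β k]`. -/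
structure HypData (n : ℕ) where
  /-- The minimum of the first coordinate. -/
  lo : ℝ
  /-- The maximum of the first coordinate. -/
  hi : ℝ
  /-- The corner values. -/
  τ : Fin n → ℝ
  /-- The ends of the intervals over which the region is unbounded. -/
  β : Fin n → ℝ
  two_le : 2 ≤ n
  lo_lt_hi : lo < hi
  lo_le_τ : ∀ k, lo ≤ τ k
  τ_lt_hi : ∀ k, τ k < hi
  τ_le_β : ∀ k, τ k ≤ β k
  τ_inj : ∀ k k', lo < τ k → τ k = τ k' → k = k'

namespace HypData

variable {n : ℕ} (P : HypData n)

/-- The curves of the arrangement: two curves in the plane of the first two coordinates, which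
cross over `lo` and `hi`, and in each other plane lower curves which cross over `τ k`, and upper
curves which are asymptotic to the lines over `τ k` and `β k`. -/
inductive Curve : Type
  | lensUpper : Curve
  | lensLower : Curve
  | lowerLeft (k : Fin n) (hk : 2 ≤ k.1) : Curve
  | lowerRight (k : Fin n) (hk : 2 ≤ k.1) (h : P.lo < P.τ k) : Curve
  | upperLeft (k : Fin n) (hk : 2 ≤ k.1) (h : P.lo < P.τ k) : Curve
  | upperRight (k : Fin n) (hk : 2 ≤ k.1) (h : P.β k < P.hi) : Curve

lemma pos (P : HypData n) : 0 < n := two_pos.trans_le P.two_le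

/-- The index of the second coordinate. -/
def one : Fin n := ⟨1, P.two_le⟩

instance : Finite P.Curve := by
  let φ : P.Curve → Fin 6 × Fin n
    | .lensUpper => (0, P.one)
    | .lensLower => (1, P.one)
    | .lowerLeft k _ => (2, k)
    | .lowerRight k _ _ => (3, k)
    | .upperLeft k _ _ => (4, k)
    | .upperRight k _ _ => (5, k)
  refine Finite.of_injective φ ?_
  rintro (_ | _ | ⟨k, _⟩ | ⟨k, _, _⟩ | ⟨k, _, _⟩ | ⟨k, _, _⟩)
    (_ | _ | ⟨k', _⟩ | ⟨k', _, _⟩ | ⟨k', _, _⟩ | ⟨k', _, _⟩) h <;> simp_all [φ]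

/-- The vertical offset of the curves. -/
def width : ℝ := P.hi - P.lo + 1

/-- The hyperbola underlying a curve. -/
def hyp : P.Curve → HypCurve n
  -- The entries are k, a, b, c, σ, ε, g₀, g₁. Only the lens curves need a non-constant auxiliary
  -- factor, to exclude the other side of their asymptotes; once s lies in [lo, hi] the linear
  -- inequalities of the other planes need none.
  | .lensUpper => ⟨P.one, P.lo - 1, P.hi + 1, -P.width, -1, -1, (P.width + 1) ^ 2, 1⟩
  | .lensLower => ⟨P.one, P.hi + 1, P.lo - 1, -P.width, 1, -1, (P.width + 1) ^ 2, 1⟩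
  | .lowerLeft k _ => ⟨k, P.τ k - P.width, 0, -1, -1, 1, 1, 0⟩
  | .lowerRight k _ _ => ⟨k, P.τ k + P.width, 0, 1, -1, -1, 1, 0⟩
  | .upperLeft k _ _ => ⟨k, P.τ k, 0, -P.width, 1, 1, 1, 0⟩
  | .upperRight k _ _ => ⟨k, P.β k, 0, P.width, 1, -1, 1, 0⟩

/-- The central curve. -/
def center (s : ℝ) : EuclideanSpace ℝ (Fin n) :=
  WithLp.toLp 2 fun k => if k.1 ≤ 1 then s else 0

/-- The region bounded by the curves. -/
def Region (x : EuclideanSpace ℝ (Fin n)) : Prop :=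
  firstCoord P.pos x ∈ Icc P.lo P.hi ∧ ∀ c, 0 ≤ (P.hyp c).ell P.pos x

lemma one_lt_width : 1 < P.width := by
  have := P.lo_lt_hi
  unfold width
  linarith

lemma one_ne : P.one ≠ ⟨0, P.pos⟩ := by simp [one]

lemma ne_zero_of_two_le {k : Fin n} (hk : 2 ≤ k.1) : k ≠ ⟨0, P.pos⟩ := by
  rintro rfl
  simp at hk

lemma ne_one_of_two_le {k : Fin n} (hk : 2 ≤ k.1) : k ≠ P.one := by
  rintro rfl
  simp [one] at hk

lemma nondegenerate (c : P.Curve) : (P.hyp c).Nondegenerate P.pos := by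
  have hw := P.one_lt_width
  have h2 : 0 < (P.width + 1) ^ 2 + 1 * -P.width := by nlinarith
  rcases c with _ | _ | ⟨k, hk⟩ | ⟨k, hk, h⟩ | ⟨k, hk, h⟩ | ⟨k, hk, h⟩
  · exact ⟨P.one_ne, neg_ne_zero.2 (by linarith), Or.inr rfl, Or.inr rfl, h2⟩
  · exact ⟨P.one_ne, neg_ne_zero.2 (by linarith), Or.inl rfl, Or.inr rfl, h2⟩
  · exact ⟨P.ne_zero_of_two_le hk, by norm_num [hyp], Or.inr rfl, Or.inl rfl, by norm_num [hyp]⟩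
  · exact ⟨P.ne_zero_of_two_le hk, by norm_num [hyp], Or.inr rfl, Or.inr rfl, by norm_num [hyp]⟩
  · exact ⟨P.ne_zero_of_two_le hk, neg_ne_zero.2 (by linarith), Or.inl rfl, Or.inl rfl,
      by norm_num [hyp]⟩
  · exact ⟨P.ne_zero_of_two_le hk, by simp only [hyp]; linarith, Or.inl rfl, Or.inr rfl,
      by norm_num [hyp]⟩

section formulas

variable (x : EuclideanSpace ℝ (Fin n))

lemma ell_lensUpper : (P.hyp .lensUpper).ell P.pos x =
    (firstCoord P.pos x - (P.lo - 1)) * (P.hi + 1 - x P.one) - P.width := by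
  simp only [hyp, HypCurve.ell, HypCurve.q]; ring

lemma ell_lensLower : (P.hyp .lensLower).ell P.pos x =
    (P.hi + 1 - firstCoord P.pos x) * (x P.one - (P.lo - 1)) - P.width := by
  simp only [hyp, HypCurve.ell, HypCurve.q]; ring

lemma ell_lowerLeft (k : Fin n) (hk : 2 ≤ k.1) : (P.hyp (.lowerLeft k hk)).ell P.pos x =
    (firstCoord P.pos x - P.τ k + P.width) * x k + 1 := by
  simp only [hyp, HypCurve.ell, HypCurve.q]; ring

lemma ell_lowerRight (k : Fin n) (hk : 2 ≤ k.1) (h : P.lo < P.τ k) :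
    (P.hyp (.lowerRight k hk h)).ell P.pos x =
      (P.τ k + P.width - firstCoord P.pos x) * x k + 1 := by
  simp only [hyp, HypCurve.ell, HypCurve.q]; ring

lemma ell_upperLeft (k : Fin n) (hk : 2 ≤ k.1) (h : P.lo < P.τ k) :
    (P.hyp (.upperLeft k hk h)).ell P.pos x =
      P.width - (P.τ k - firstCoord P.pos x) * x k := by
  simp only [hyp, HypCurve.ell, HypCurve.q]; ring

lemma ell_upperRight (k : Fin n) (hk : 2 ≤ k.1) (h : P.β k < P.hi) :
    (P.hyp (.upperRight k hk h)).ell P.pos x =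
      P.width - (firstCoord P.pos x - P.β k) * x k := by
  simp only [hyp, HypCurve.ell, HypCurve.q]; ring

lemma factor_lensUpper : (P.hyp .lensUpper).factor P.pos x =
    (P.width + 1) ^ 2 - (firstCoord P.pos x - (P.lo - 1)) * (P.hi + 1 - x P.one) := by
  simp only [hyp, HypCurve.factor, HypCurve.q]; ring

lemma factor_lensLower : (P.hyp .lensLower).factor P.pos x =
    (P.width + 1) ^ 2 - (P.hi + 1 - firstCoord P.pos x) * (x P.one - (P.lo - 1)) := by
  simp only [hyp, HypCurve.factor, HypCurve.q]; ring

lemma factor_eq_one {c : P.Curve} (hU : c ≠ .lensUpper) (hL : c ≠ .lensLower) :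
    (P.hyp c).factor P.pos x = 1 := by
  rcases c with _ | _ | _ | _ | _ | _
  · exact absurd rfl hU
  · exact absurd rfl hL
  all_goals simp [hyp, HypCurve.factor]

end formulas

section lens

lemma bounds_of_lens {s x : ℝ} (hs : s ∈ Icc P.lo P.hi)
    (hU : 0 ≤ (s - (P.lo - 1)) * (P.hi + 1 - x) - P.width)
    (hL : 0 ≤ (P.hi + 1 - s) * (x - (P.lo - 1)) - P.width) :
    P.lo - 1 < x ∧ x < P.hi + 1 := by
  have hw := P.one_lt_width
  obtain ⟨h1, h2⟩ := hs
  constructor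
  · exact sub_pos.1 (pos_of_mul_pos_right (show 0 < (P.hi + 1 - s) * (x - (P.lo - 1)) by linarith)
      (by linarith))
  · exact sub_pos.1 (pos_of_mul_pos_right (show 0 < (s - (P.lo - 1)) * (P.hi + 1 - x) by linarith)
      (by linarith))

/-- The asymptotes of the two lens curves bound a square of side w + 1; inside it the products are
less than (w + 1)². -/
lemma factor_pos_of_lens {s x : ℝ} (hs : s ∈ Icc P.lo P.hi)
    (hx : P.lo - 1 < x ∧ x < P.hi + 1) :
    0 < (P.width + 1) ^ 2 - (s - (P.lo - 1)) * (P.hi + 1 - x) ∧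
      0 < (P.width + 1) ^ 2 - (P.hi + 1 - s) * (x - (P.lo - 1)) := by
  obtain ⟨h1, h2⟩ := hs
  obtain ⟨h3, h4⟩ := hx
  have hw : P.width = P.hi - P.lo + 1 := rfl
  have hw1 := P.one_lt_width
  constructor
  · have : (s - (P.lo - 1)) * (P.hi + 1 - x) < (P.width + 1) * (P.width + 1) :=
      mul_lt_mul'' (by linarith) (by linarith) (by linarith) (by linarith)
    linarith [sq (P.width + 1)]
  · have : (P.hi + 1 - s) * (x - (P.lo - 1)) < (P.width + 1) * (P.width + 1) :=
      mul_lt_mul'' (by linarith) (by linarith) (by linarith) (by linarith)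
    linarith [sq (P.width + 1)]

lemma bounds_of_mul_nonneg {a b u : ℝ} (hab : a < b) (h : 0 ≤ (u - a) * (b - u)) :
    a ≤ u ∧ u ≤ b := by
  constructor
  · by_contra hu
    push Not at hu
    exact absurd h (not_le.2 (mul_neg_of_neg_of_pos (by linarith) (by linarith)))
  · by_contra hu
    push Not at hu
    exact absurd h (not_le.2 (mul_neg_of_pos_of_neg (by linarith) (by linarith)))

/-- Nonnegativity of function times factor says that both products lie in [w, (w + 1)²]. Outside the
strip between the vertical asymptotes, one product being positive makes the other exceed (w + 1)².
Inside it, a combination of the two inequalities with positive weights is (w + 1)(s - lo)(hi - s),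
which must be nonnegative. -/
lemma lens_of_mul_nonneg {s x : ℝ}
    (hU : 0 ≤ ((s - (P.lo - 1)) * (P.hi + 1 - x) - P.width) *
      ((P.width + 1) ^ 2 - (s - (P.lo - 1)) * (P.hi + 1 - x)))
    (hL : 0 ≤ ((P.hi + 1 - s) * (x - (P.lo - 1)) - P.width) *
      ((P.width + 1) ^ 2 - (P.hi + 1 - s) * (x - (P.lo - 1)))) :
    s ∈ Icc P.lo P.hi ∧ 0 ≤ (s - (P.lo - 1)) * (P.hi + 1 - x) - P.width ∧
      0 ≤ (P.hi + 1 - s) * (x - (P.lo - 1)) - P.width := by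
  have hw : P.width = P.hi - P.lo + 1 := rfl
  have hw1 := P.one_lt_width
  have hwK : P.width < (P.width + 1) ^ 2 := by nlinarith
  obtain ⟨hu1, hu2⟩ := bounds_of_mul_nonneg hwK hU
  obtain ⟨hv1, hv2⟩ := bounds_of_mul_nonneg hwK hL
  have hs : 0 < s - (P.lo - 1) ∧ 0 < P.hi + 1 - s := by
    rcases pos_and_pos_or_neg_and_neg_of_mul_pos 
      (show 0 < (s - (P.lo - 1)) * (P.hi + 1 - x) by linarith only [hu1, hw1]) with
      ⟨h1, h2⟩ | ⟨h1, h2⟩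
    · refine ⟨h1, ?_⟩
      by_contra h3
      have h4 : x - (P.lo - 1) < 0 := by
        by_contra h5
        have := mul_nonpos_of_nonpos_of_nonneg (not_lt.1 h3) (not_lt.1 h5)
        linarith
      have : (P.width + 1) * (P.width + 1) < (s - (P.lo - 1)) * (P.hi + 1 - x) :=
        mul_lt_mul' (by linarith) (by linarith) (by linarith) (by linarith)
      linarith [sq (P.width + 1)]
    · exfalso
      have : (P.width + 1) * (P.width + 1) < (P.hi + 1 - s) * (x - (P.lo - 1)) :=
        mul_lt_mul'' (by linarith) (by linarith) (by linarith) (by linarith)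
      linarith [sq (P.width + 1)]
  have hkey : 0 ≤ (s - P.lo) * (P.hi - s) := by
    have h1 := mul_nonneg hs.2.le (sub_nonneg.2 hu1)
    have h2 := mul_nonneg hs.1.le (sub_nonneg.2 hv1)
    have h3 : (P.width + 1) * ((s - P.lo) * (P.hi - s)) =
        (P.hi + 1 - s) * ((s - (P.lo - 1)) * (P.hi + 1 - x) - P.width) +
        (s - (P.lo - 1)) * ((P.hi + 1 - s) * (x - (P.lo - 1)) - P.width) := by
      rw [hw]; ring
    exact nonneg_of_mul_nonneg_right (by linarith) (show 0 < P.width + 1 by linarith)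
  exact ⟨bounds_of_mul_nonneg P.lo_lt_hi hkey, by linarith, by linarith⟩

end lens

variable {P}

lemma Region.lens {x : EuclideanSpace ℝ (Fin n)} (hx : P.Region x) :
    0 ≤ (firstCoord P.pos x - (P.lo - 1)) * (P.hi + 1 - x P.one) - P.width ∧
      0 ≤ (P.hi + 1 - firstCoord P.pos x) * (x P.one - (P.lo - 1)) - P.width :=
  ⟨by rw [← ell_lensUpper]; exact hx.2 _, by rw [← ell_lensLower]; exact hx.2 _⟩

lemma Region.bounds {x : EuclideanSpace ℝ (Fin n)} (hx : P.Region x) :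
    P.lo - 1 < x P.one ∧ x P.one < P.hi + 1 :=
  P.bounds_of_lens hx.1 hx.lens.1 hx.lens.2

lemma Region.factor_pos {x : EuclideanSpace ℝ (Fin n)} (hx : P.Region x) (c : P.Curve) :
    0 < (P.hyp c).factor P.pos x := by
  have h := P.factor_pos_of_lens hx.1 hx.bounds
  by_cases hU : c = .lensUpper
  · rw [hU, factor_lensUpper]
    exact h.1
  by_cases hL : c = .lensLower
  · rw [hL, factor_lensLower]
    exact h.2
  rw [P.factor_eq_one x hU hL]
  exact one_pos

lemma region_of_mul_nonneg {x : EuclideanSpace ℝ (Fin n)}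
    (hx : ∀ c, 0 ≤ (P.hyp c).ell P.pos x * (P.hyp c).factor P.pos x) : P.Region x := by
  have hU := hx .lensUpper
  have hL := hx .lensLower
  rw [ell_lensUpper, factor_lensUpper] at hU
  rw [ell_lensLower, factor_lensLower] at hL
  obtain ⟨hs, h1, h2⟩ := P.lens_of_mul_nonneg hU hL
  refine ⟨hs, fun c => ?_⟩
  by_cases hcU : c = .lensUpper
  · rw [hcU, ell_lensUpper]
    exact h1
  by_cases hcL : c = .lensLower
  · rw [hcL, ell_lensLower]
    exact h2
  have := hx c
  rwa [P.factor_eq_one x hcU hcL, mul_one] at this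

/-- In the planes other than the first, the slopes of the lower curves are at least `1`. -/
lemma one_le_slopes {s : ℝ} (hs : s ∈ Icc P.lo P.hi) (k : Fin n) :
    1 ≤ s - P.τ k + P.width ∧ 1 ≤ P.τ k + P.width - s := by
  have hw : P.width = P.hi - P.lo + 1 := rfl
  have h1 := P.lo_le_τ k
  have h2 := P.τ_lt_hi k
  constructor <;> linarith [hs.1, hs.2]

lemma Region.neg_one_le {x : EuclideanSpace ℝ (Fin n)} (hx : P.Region x) {k : Fin n}
    (hk : 2 ≤ k.1) : -1 ≤ x k := by
  have h1 := hx.2 (.lowerLeft k hk)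
  rw [ell_lowerLeft] at h1
  by_contra h
  push Not at h
  have := (one_le_slopes hx.1 k).1
  nlinarith

@[simp] lemma firstCoord_center (hn : 0 < n) (s : ℝ) : firstCoord hn (center s) = s := by
  simp [firstCoord, center]

@[simp] lemma center_one (s : ℝ) : (center s : EuclideanSpace ℝ (Fin n)) P.one = s := by
  simp [center, one]

lemma center_of_two_le (s : ℝ) {k : Fin n} (hk : 2 ≤ k.1) :
    (center s : EuclideanSpace ℝ (Fin n)) k = 0 := by
  simp only [center]
  exact if_neg (by omega)

/-- At the central curve the functions are positive, except at the ends of the lens. -/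
lemma ell_center (s : ℝ) (c : P.Curve) :
    (P.hyp c).ell P.pos (center s) = (s - P.lo) * (P.hi - s) ∧ (P.hyp c).k = P.one ∨
      0 < (P.hyp c).ell P.pos (center s) := by
  have hw := P.one_lt_width
  rcases c with _ | _ | ⟨k, hk⟩ | ⟨k, hk, h⟩ | ⟨k, hk, h⟩ | ⟨k, hk, h⟩
  · left
    rw [ell_lensUpper, firstCoord_center, center_one]
    exact ⟨by unfold width; ring, rfl⟩
  · left
    rw [ell_lensLower, firstCoord_center, center_one]
    exact ⟨by unfold width; ring, rfl⟩
  · right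
    rw [ell_lowerLeft, center_of_two_le s hk]
    norm_num
  · right
    rw [ell_lowerRight, center_of_two_le s hk]
    norm_num
  · right
    rw [ell_upperLeft, center_of_two_le s hk]
    linarith
  · right
    rw [ell_upperRight, center_of_two_le s hk]
    linarith

lemma region_center {s : ℝ} (hs : s ∈ Icc P.lo P.hi) : P.Region (center s) := by
  refine ⟨by rwa [firstCoord_center], fun c => ?_⟩
  rcases P.ell_center s c with ⟨h, -⟩ | h
  · rw [h]
    exact mul_nonneg (sub_nonneg.2 hs.1) (sub_nonneg.2 hs.2)
  · exact h.le

lemma ell_center_pos {s : ℝ} (hs : s ∈ Ioo P.lo P.hi) (c : P.Curve) :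
    0 < (P.hyp c).ell P.pos (center s) := by
  rcases P.ell_center s c with ⟨h, -⟩ | h
  · rw [h]
    exact mul_pos (sub_pos.2 hs.1) (sub_pos.2 hs.2)
  · exact h

/-- Only the lens functions can vanish at the centre, and only over a tip, where the two lens
inequalities squeeze the second coordinate to s. -/
lemma Region.eq_center {x : EuclideanSpace ℝ (Fin n)} (hx : P.Region x) {c : P.Curve}
    (h0 : (P.hyp c).ell P.pos (center (firstCoord P.pos x)) = 0) :
    x (P.hyp c).k = center (firstCoord P.pos x) (P.hyp c).k := by
  have hw : P.width = P.hi - P.lo + 1 := rfl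
  have hw1 := P.one_lt_width
  rcases P.ell_center (firstCoord P.pos x) c with ⟨h, hk⟩ | h
  · rw [hk, center_one]
    obtain ⟨hU, hL⟩ := hx.lens
    rw [h, mul_eq_zero] at h0
    rcases h0 with h0 | h0
    · have hs : firstCoord P.pos x = P.lo := by linarith
      rw [hs] at hU hL ⊢
      refine le_antisymm (by linarith) ?_
      by_contra hlt
      push Not at hlt
      nlinarith
    · have hs : firstCoord P.pos x = P.hi := by linarith
      rw [hs] at hU hL ⊢
      refine le_antisymm ?_ (by linarith)
      by_contra hlt
      push Not at hlt
      nlinarith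
  · exact absurd h0 h.ne'

/-- The second branches do not reach the region: the lens lies inside its asymptotic square; a lower
curve has a positive slope factor and negative product; and on an upper curve x_k ≤ 0 would need
|x_k| > 1, whereas x_k ≥ -1. The constant `width` is chosen larger than hi - lo for this. -/
lemma Region.side {x : EuclideanSpace ℝ (Fin n)} (hx : P.Region x) {c : P.Curve}
    (hq : (P.hyp c).q P.pos x = (P.hyp c).c) : x ∈ (P.hyp c).surface P.pos := by
  refine ⟨hq, ?_⟩
  have hw : P.width = P.hi - P.lo + 1 := rfl
  have hw1 := P.one_lt_width
  have hs := hx.1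
  rcases c with _ | _ | ⟨k, hk⟩ | ⟨k, hk, h⟩ | ⟨k, hk, h⟩ | ⟨k, hk, h⟩ <;>
    simp only [hyp, HypCurve.q, sub_zero] at hq ⊢
  · linarith [hx.bounds.2]
  · linarith [hx.bounds.1]
  · have := (one_le_slopes hs k).1
    by_contra hneg
    have : 0 ≤ x k := by linarith
    nlinarith
  · have := (one_le_slopes hs k).2
    by_contra hneg
    have : 0 ≤ x k := by linarith
    nlinarith
  · have h1 := hx.neg_one_le hk
    have h2 := P.lo_le_τ k
    by_contra hneg
    have h3 : x k ≤ 0 := by linarith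
    nlinarith [hs.1, hs.2, mul_nonneg (neg_nonneg.2 h3)
      (show 0 ≤ P.hi - firstCoord P.pos x + (P.τ k - P.lo) by linarith [hs.2])]
  · have h1 := hx.neg_one_le hk
    by_contra hneg
    have h3 : x k ≤ 0 := by linarith
    nlinarith [hs.1, hs.2, mul_nonneg (neg_nonneg.2 h3)
      (show 0 ≤ firstCoord P.pos x - P.lo + (P.hi - P.β k) by linarith [hs.1])]

end HypData

end HypRAG

/-! ### Crossings, boundary pieces and slices of the explicit arrangement -/

namespace HypRAG

namespace HypData

variable {n : ℕ} {P : HypData n}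

lemma index_cases (P : HypData n) (k : Fin n) : k = ⟨0, P.pos⟩ ∨ k = P.one ∨ 2 ≤ k.1 := by
  simp only [Fin.ext_iff, one]
  omega

section crossing

variable {x : EuclideanSpace ℝ (Fin n)}

lemma lens_crossing (hU : x ∈ (P.hyp .lensUpper).surface P.pos)
    (hL : x ∈ (P.hyp .lensLower).surface P.pos) :
    (firstCoord P.pos x = P.lo ∨ firstCoord P.pos x = P.hi) ∧ x P.one = firstCoord P.pos x := by
  have hw : P.width = P.hi - P.lo + 1 := rfl
  have hw1 := P.one_lt_width
  obtain ⟨h1, -⟩ := hU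
  obtain ⟨h2, -⟩ := hL
  simp only [hyp, HypCurve.q] at h1 h2
  have h3 : x P.one = firstCoord P.pos x := by
    have : (P.width + 1) * (x P.one - firstCoord P.pos x) = 0 := by
      rw [hw] at h1 h2 ⊢
      linear_combination h1 - h2
    rcases mul_eq_zero.1 this with h | h <;> linarith
  refine ⟨?_, h3⟩
  rw [h3] at h1
  have : (firstCoord P.pos x - P.lo) * (firstCoord P.pos x - P.hi) = 0 := by
    rw [hw] at h1
    linear_combination h1
  rcases mul_eq_zero.1 this with h | h
  · exact Or.inl (by linarith)
  · exact Or.inr (by linarith)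

lemma lower_crossing {k : Fin n} {hk : 2 ≤ k.1} {h : P.lo < P.τ k}
    (hL : x ∈ (P.hyp (.lowerLeft k hk)).surface P.pos)
    (hR : x ∈ (P.hyp (.lowerRight k hk h)).surface P.pos) :
    firstCoord P.pos x = P.τ k ∧ x k ≠ 0 := by
  obtain ⟨h1, h3⟩ := hL
  obtain ⟨h2, -⟩ := hR
  simp only [hyp, HypCurve.q] at h1 h2 h3
  have hx : x k < 0 := by linarith
  refine ⟨?_, hx.ne⟩
  have : (firstCoord P.pos x - P.τ k) * x k = 0 := by linear_combination (h1 + h2) / 2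
  rcases mul_eq_zero.1 this with h | h <;> linarith

/-- Subtracting the equations gives (β - τ) x_k = -2w, impossible for τ ≤ β and x_k > 0. -/
lemma upper_not_crossing {k : Fin n} {hk : 2 ≤ k.1} {h : P.lo < P.τ k} {h' : P.β k < P.hi}
    (hL : x ∈ (P.hyp (.upperLeft k hk h)).surface P.pos)
    (hR : x ∈ (P.hyp (.upperRight k hk h')).surface P.pos) : False := by
  have hw1 := P.one_lt_width
  have := P.τ_le_β k
  obtain ⟨h1, h3⟩ := hL
  obtain ⟨h2, -⟩ := hR
  simp only [hyp, HypCurve.q] at h1 h2 h3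
  have hx : 0 < x k := by linarith
  have := mul_nonneg (show 0 ≤ P.β k - P.τ k by linarith) hx.le
  linarith

/-- Distinct curves in the same plane cross only over the ends of the lens and over the corner
values. -/
lemma crossing_cases {c c' : P.Curve} (hne : c ≠ c') (hk : (P.hyp c).k = (P.hyp c').k)
    (hx : x ∈ (P.hyp c).surface P.pos) (hx' : x ∈ (P.hyp c').surface P.pos) :
    ((c = .lensUpper ∧ c' = .lensLower ∨ c = .lensLower ∧ c' = .lensUpper) ∧
      (firstCoord P.pos x = P.lo ∨ firstCoord P.pos x = P.hi) ∧ x P.one = firstCoord P.pos x) ∨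
    ∃ (k : Fin n) (hk : 2 ≤ k.1) (h : P.lo < P.τ k),
      (c = .lowerLeft k hk ∧ c' = .lowerRight k hk h ∨
        c = .lowerRight k hk h ∧ c' = .lowerLeft k hk) ∧
      firstCoord P.pos x = P.τ k ∧ x k ≠ 0 := by
  have hσ := hx.2
  have hσ' := hx'.2
  rcases c with _ | _ | ⟨k, hk1⟩ | ⟨k, hk1, h⟩ | ⟨k, hk1, h⟩ | ⟨k, hk1, h⟩
  · rcases c' with _ | _ | _ | _ | _ | _
    · exact absurd rfl hne
    · exact Or.inl ⟨Or.inl ⟨rfl, rfl⟩, lens_crossing hx hx'⟩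
    all_goals exact absurd hk.symm (P.ne_one_of_two_le ‹_›)
  · rcases c' with _ | _ | _ | _ | _ | _
    · exact Or.inl ⟨Or.inr ⟨rfl, rfl⟩, lens_crossing hx' hx⟩
    · exact absurd rfl hne
    all_goals exact absurd hk.symm (P.ne_one_of_two_le ‹_›)
  all_goals
    rcases c' with _ | _ | ⟨k', hk2⟩ | ⟨k', hk2, h'⟩ | ⟨k', hk2, h'⟩ | ⟨k', hk2, h'⟩
    · exact absurd hk (P.ne_one_of_two_le hk1)
    · exact absurd hk (P.ne_one_of_two_le hk1)
  all_goals
    obtain rfl : k = k' := hk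
    simp only [hyp] at hσ hσ'
  · exact absurd rfl hne
  · exact Or.inr ⟨_, _, _, Or.inl ⟨rfl, rfl⟩, lower_crossing hx hx'⟩
  · exfalso; linarith
  · exfalso; linarith
  · exact Or.inr ⟨_, _, _, Or.inr ⟨rfl, rfl⟩, lower_crossing hx' hx⟩
  · exact absurd rfl hne
  · exfalso; linarith
  · exfalso; linarith
  · exfalso; linarith
  · exfalso; linarith
  · exact absurd rfl hne
  · exact (upper_not_crossing hx hx').elim
  · exfalso; linarith
  · exfalso; linarith
  · exact (upper_not_crossing hx' hx).elim
  · exact absurd rfl hne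

/-- Up to sign the determinant is (w + 1)(2s - lo - hi) at a tip of the lens and 2 w x_k at a
corner. -/
lemma crossing_det_ne {c c' : P.Curve} (hne : c ≠ c') (hk : (P.hyp c).k = (P.hyp c').k)
    (hx : x ∈ (P.hyp c).surface P.pos) (hx' : x ∈ (P.hyp c').surface P.pos) :
    (firstCoord P.pos x - (P.hyp c).a) * (x (P.hyp c').k - (P.hyp c').b) -
      (firstCoord P.pos x - (P.hyp c').a) * (x (P.hyp c).k - (P.hyp c).b) ≠ 0 := by
  have hlt := P.lo_lt_hi
  rcases crossing_cases hne hk hx hx' with ⟨h, hs, h1⟩ | ⟨k, hk, h', h, hs, h1⟩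
  · have hW : P.hi - P.lo + 2 ≠ 0 := by linarith
    have key : (P.hi - P.lo + 2) * (2 * firstCoord P.pos x - P.lo - P.hi) ≠ 0 := by
      refine mul_ne_zero hW ?_
      rcases hs with hs | hs <;> rw [hs]
      · exact ne_of_lt (by linarith)
      · exact ne_of_gt (by linarith)
    rcases h with ⟨rfl, rfl⟩ | ⟨rfl, rfl⟩ <;> simp only [hyp] <;> rw [h1] <;> intro h0 <;>
      apply key
    · linear_combination h0
    · linear_combination -h0
  · have hw := P.one_lt_width
    have key : 2 * P.width * x k ≠ 0 := mul_ne_zero (by linarith) h1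
    rcases h with ⟨rfl, rfl⟩ | ⟨rfl, rfl⟩ <;> simp only [hyp] <;> intro h0 <;> apply key
    · linear_combination h0
    · linear_combination -h0

/-- The values lo, hi and the corner values above lo are pairwise distinct, by `τ_lt_hi` and
`τ_inj`, so the first coordinate of the point determines the crossing pair. -/
lemma crossing_unique {c c' d d' : P.Curve} (hne : c ≠ c') (hk : (P.hyp c).k = (P.hyp c').k)
    (hne' : d ≠ d') (hk' : (P.hyp d).k = (P.hyp d').k)
    (hx : x ∈ (P.hyp c).surface P.pos) (hx' : x ∈ (P.hyp c').surface P.pos)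
    (hy : x ∈ (P.hyp d).surface P.pos) (hy' : x ∈ (P.hyp d').surface P.pos) :
    d = c ∨ d = c' := by
  rcases crossing_cases hne hk hx hx' with ⟨h, hs, -⟩ | ⟨k, hk, hτ, h, hs, -⟩ <;>
  rcases crossing_cases hne' hk' hy hy' with ⟨h', hs', -⟩ | ⟨k', hk', hτ', h', hs', -⟩
  · rcases h with ⟨rfl, rfl⟩ | ⟨rfl, rfl⟩ <;> rcases h' with ⟨rfl, rfl⟩ | ⟨rfl, rfl⟩ <;> simp
  · have := P.τ_lt_hi k'
    rcases hs with hs | hs <;> exfalso <;> linarith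
  · have := P.τ_lt_hi k
    rcases hs' with hs' | hs' <;> exfalso <;> linarith
  · obtain rfl := P.τ_inj k k' hτ (hs.symm.trans hs')
    rcases h with ⟨rfl, rfl⟩ | ⟨rfl, rfl⟩ <;> rcases h' with ⟨rfl, rfl⟩ | ⟨rfl, rfl⟩ <;> simp

end crossing

section piece

lemma ell_setCoord_of_ne {k : Fin n} (hk : k ≠ ⟨0, P.pos⟩) {c : P.Curve} (hc : (P.hyp c).k ≠ k)
    (s y : ℝ) : (P.hyp c).ell P.pos (setCoord k y (center s)) =
      (P.hyp c).ell P.pos (center s) :=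
  HypCurve.ell_congr (firstCoord_setCoord hk y _) (setCoord_of_ne hc y _)

lemma region_setCoord_one {s y : ℝ} (hs : s ∈ Icc P.lo P.hi)
    (hU : 0 ≤ (s - (P.lo - 1)) * (P.hi + 1 - y) - P.width)
    (hL : 0 ≤ (P.hi + 1 - s) * (y - (P.lo - 1)) - P.width) :
    P.Region (setCoord P.one y (center s)) := by
  have h1 : firstCoord P.pos (setCoord P.one y (center s)) = s := by
    rw [firstCoord_setCoord P.one_ne, firstCoord_center]
  refine ⟨by rwa [h1], fun c => ?_⟩
  by_cases hc : (P.hyp c).k = P.one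
  · rcases c with _ | _ | ⟨k, hk⟩ | ⟨k, hk, h⟩ | ⟨k, hk, h⟩ | ⟨k, hk, h⟩
    · rwa [ell_lensUpper, h1, setCoord_same]
    · rwa [ell_lensLower, h1, setCoord_same]
    all_goals exact absurd hc (P.ne_one_of_two_le hk)
  · rw [ell_setCoord_of_ne P.one_ne hc]
    exact (region_center hs).2 c

lemma region_setCoord {s y : ℝ} (hs : s ∈ Icc P.lo P.hi) {k : Fin n} (hk : 2 ≤ k.1)
    (hLL : 0 ≤ (s - P.τ k + P.width) * y + 1) (hLR : 0 ≤ (P.τ k + P.width - s) * y + 1)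
    (hUL : P.lo < P.τ k → 0 ≤ P.width - (P.τ k - s) * y)
    (hUR : P.β k < P.hi → 0 ≤ P.width - (s - P.β k) * y) :
    P.Region (setCoord k y (center s)) := by
  have hk0 := P.ne_zero_of_two_le hk
  have h1 : firstCoord P.pos (setCoord k y (center s)) = s := by
    rw [firstCoord_setCoord hk0, firstCoord_center]
  refine ⟨by rwa [h1], fun c => ?_⟩
  by_cases hc : (P.hyp c).k = k
  · rcases c with _ | _ | ⟨k', hk'⟩ | ⟨k', hk', h⟩ | ⟨k', hk', h⟩ | ⟨k', hk', h⟩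
    · exact absurd hc.symm (P.ne_one_of_two_le hk)
    · exact absurd hc.symm (P.ne_one_of_two_le hk)
    all_goals obtain rfl : k' = k := hc
    · rwa [ell_lowerLeft, h1, setCoord_same]
    · rwa [ell_lowerRight, h1, setCoord_same]
    · rw [ell_upperLeft, h1, setCoord_same]
      exact hUL h
    · rw [ell_upperRight, h1, setCoord_same]
      exact hUR h
  · rw [ell_setCoord_of_ne hk0 hc]
    exact (region_center hs).2 c

/-- For -1 ≤ y ≤ 0 the upper inequalities are automatic, as their slopes are at least -w. For y ≥ 0
it is the lower ones that are automatic. -/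
lemma region_setCoord_of_neg {s y : ℝ} (hs : s ∈ Icc P.lo P.hi) {k : Fin n} (hk : 2 ≤ k.1)
    (hy : -1 ≤ y) (hy' : y ≤ 0) (hLL : 0 ≤ (s - P.τ k + P.width) * y + 1)
    (hLR : 0 ≤ (P.τ k + P.width - s) * y + 1) : P.Region (setCoord k y (center s)) := by
  have hw : P.width = P.hi - P.lo + 1 := rfl
  have h1 := P.lo_le_τ k
  have h2 := P.τ_lt_hi k
  have h3 := P.τ_le_β k
  have key : ∀ u : ℝ, -P.width ≤ u → 0 ≤ P.width - u * y := by
    intro u hu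
    have := mul_nonneg (show 0 ≤ u + P.width by linarith) (neg_nonneg.2 hy')
    have := mul_nonneg (show 0 ≤ P.width by linarith [P.one_lt_width]) (show 0 ≤ y + 1 by linarith)
    linarith
  exact region_setCoord hs hk hLL hLR (fun _ => key _ (by linarith [hs.2]))
    (fun _ => key _ (by linarith [hs.1]))

lemma region_setCoord_of_nonneg {s y : ℝ} (hs : s ∈ Icc P.lo P.hi) {k : Fin n} (hk : 2 ≤ k.1)
    (hy : 0 ≤ y) (hUL : P.lo < P.τ k → 0 ≤ P.width - (P.τ k - s) * y)
    (hUR : P.β k < P.hi → 0 ≤ P.width - (s - P.β k) * y) :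
    P.Region (setCoord k y (center s)) := by
  obtain ⟨h1, h2⟩ := one_le_slopes hs k
  have := mul_nonneg (show 0 ≤ s - P.τ k + P.width by linarith) hy
  have := mul_nonneg (show 0 ≤ P.τ k + P.width - s by linarith) hy
  exact region_setCoord hs hk (by linarith) (by linarith) hUL hUR

/-- The values of the first coordinate on the part of a curve in the boundary of the region. -/
def span : P.Curve → Set ℝ
  | .lensUpper => Icc P.lo P.hi
  | .lensLower => Icc P.lo P.hi
  | .lowerLeft k _ => Icc (P.τ k) P.hi
  | .lowerRight k _ _ => Icc P.lo (P.τ k)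
  | .upperLeft k _ _ => Ico P.lo (P.τ k)
  | .upperRight k _ _ => Ioc (P.β k) P.hi

lemma ordConnected_span (c : P.Curve) : (span c).OrdConnected := by
  cases c <;> simp only [span]
  exacts [ordConnected_Icc, ordConnected_Icc, ordConnected_Icc, ordConnected_Icc,
    ordConnected_Ico, ordConnected_Ioc]

lemma nonempty_span (c : P.Curve) : (span c).Nonempty := by
  cases c <;> simp only [span]
  · exact nonempty_Icc.2 P.lo_lt_hi.le
  · exact nonempty_Icc.2 P.lo_lt_hi.le
  · exact nonempty_Icc.2 (P.τ_lt_hi _).le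
  · exact nonempty_Icc.2 (P.lo_le_τ _)
  · exact nonempty_Ico.2 ‹_›
  · exact nonempty_Ioc.2 ‹_›

/-- Over its span each curve is the effective bound in its plane: the inequality of the competing
curve reduces to the sign of (s - lo)(hi - s) for the lens, of s - τ at a corner, and to τ ≤ β for
the upper curves. -/
lemma region_section {c : P.Curve} {s : ℝ} (hs : s ∈ span c) :
    s ≠ (P.hyp c).a ∧ P.Region (setCoord (P.hyp c).k
      ((P.hyp c).b + (P.hyp c).c / (s - (P.hyp c).a)) (center s)) := by
  have hw : P.width = P.hi - P.lo + 1 := rfl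
  have hw1 := P.one_lt_width
  rcases c with _ | _ | ⟨k, hk⟩ | ⟨k, hk, h⟩ | ⟨k, hk, h⟩ | ⟨k, hk, h⟩ <;>
    simp only [span, hyp] at hs ⊢
  · have hu : 0 < s - (P.lo - 1) := by linarith [hs.1]
    refine ⟨by linarith [hu] |> fun h : (P.lo - 1) < s => h.ne', region_setCoord_one hs ?_ ?_⟩
    · refine le_of_eq ?_
      field_simp
      ring
    · have : (P.hi + 1 - s) * (P.hi + 1 + -P.width / (s - (P.lo - 1)) - (P.lo - 1)) - P.width =
          (P.width + 1) * ((s - P.lo) * (P.hi - s)) / (s - (P.lo - 1)) := by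
        rw [hw]
        field_simp
        ring
      rw [this]
      exact div_nonneg (mul_nonneg (by linarith)
        (mul_nonneg (sub_nonneg.2 hs.1) (sub_nonneg.2 hs.2))) hu.le
  · have hu : s - (P.hi + 1) < 0 := by linarith [hs.2]
    have hu' := hu.ne
    refine ⟨by linarith [hu] |> fun h : s < P.hi + 1 => h.ne, region_setCoord_one hs ?_ ?_⟩
    · have : (s - (P.lo - 1)) * (P.hi + 1 - (P.lo - 1 + -P.width / (s - (P.hi + 1)))) - P.width =
          -((P.width + 1) * ((s - P.lo) * (P.hi - s))) / (s - (P.hi + 1)) := by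
        rw [hw]
        field_simp
        ring
      rw [this]
      exact div_nonneg_of_nonpos (neg_nonpos.2 (mul_nonneg (by linarith)
        (mul_nonneg (sub_nonneg.2 hs.1) (sub_nonneg.2 hs.2)))) hu.le
    · refine le_of_eq ?_
      field_simp
      ring
  · have hs' : s ∈ Icc P.lo P.hi := ⟨(P.lo_le_τ k).trans hs.1, hs.2⟩
    obtain ⟨h1, h2⟩ := one_le_slopes hs' k
    have hA : 0 < s - (P.τ k - P.width) := by linarith
    have hy : (s - (P.τ k - P.width)) * (0 + -1 / (s - (P.τ k - P.width))) = -1 := by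
      field_simp
      ring
    set y := 0 + -1 / (s - (P.τ k - P.width))
    have hy0 : y ≤ 0 := by
      by_contra hy0
      have := mul_pos hA (not_le.1 hy0)
      linarith
    refine ⟨fun h => by linarith, region_setCoord_of_neg hs' hk ?_ hy0 (by linarith) ?_⟩
    · have := mul_nonneg (show 0 ≤ s - P.τ k + P.width - 1 by linarith) (neg_nonneg.2 hy0)
      linarith
    · have := mul_nonneg (show 0 ≤ s - P.τ k by linarith [hs.1]) (neg_nonneg.2 hy0)
      linarith
  · have hs' : s ∈ Icc P.lo P.hi := ⟨hs.1, hs.2.trans (P.τ_lt_hi k).le⟩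
    obtain ⟨h1, h2⟩ := one_le_slopes hs' k
    have hA : s - (P.τ k + P.width) < 0 := by linarith
    have hA' := hA.ne
    have hy : (s - (P.τ k + P.width)) * (0 + 1 / (s - (P.τ k + P.width))) = 1 := by
      field_simp
      ring
    set y := 0 + 1 / (s - (P.τ k + P.width))
    have hy0 : y ≤ 0 := by
      by_contra hy0
      have := mul_neg_of_neg_of_pos hA (not_le.1 hy0)
      linarith
    refine ⟨fun h => by linarith, region_setCoord_of_neg hs' hk ?_ hy0 ?_ (by linarith)⟩
    · have := mul_nonneg (show 0 ≤ P.τ k + P.width - s - 1 by linarith) (neg_nonneg.2 hy0)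
      linarith
    · have := mul_nonneg (show 0 ≤ P.τ k - s by linarith [hs.2]) (neg_nonneg.2 hy0)
      linarith
  · have hs' : s ∈ Icc P.lo P.hi := ⟨hs.1, (hs.2.trans (P.τ_lt_hi k)).le⟩
    have hA : s - P.τ k < 0 := by linarith [hs.2]
    have hA' := hA.ne
    have hy : (s - P.τ k) * (0 + -P.width / (s - P.τ k)) = -P.width := by
      field_simp
      ring
    set y := 0 + -P.width / (s - P.τ k)
    have hy0 : 0 ≤ y := by
      by_contra hy0
      have := mul_pos_of_neg_of_neg hA (not_le.1 hy0)
      linarith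
    refine ⟨fun h => by linarith, region_setCoord_of_nonneg hs' hk hy0 (fun _ => by linarith)
      fun _ => ?_⟩
    have := mul_nonneg (show 0 ≤ P.β k - s by linarith [P.τ_le_β k]) hy0
    linarith
  · have hs' : s ∈ Icc P.lo P.hi :=
      ⟨((P.lo_le_τ k).trans (P.τ_le_β k)).trans hs.1.le, hs.2⟩
    have hA : 0 < s - P.β k := by linarith [hs.1]
    have hy : (s - P.β k) * (0 + P.width / (s - P.β k)) = P.width := by
      field_simp
      ring
    set y := 0 + P.width / (s - P.β k)
    have hy0 : 0 ≤ y := by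
      by_contra hy0
      have := mul_neg_of_pos_of_neg hA (not_le.1 hy0)
      linarith
    refine ⟨fun h => by linarith, region_setCoord_of_nonneg hs' hk hy0 (fun _ => ?_)
      fun _ => by linarith⟩
    have := mul_nonneg (show 0 ≤ s - P.τ k by linarith [P.τ_le_β k]) hy0
    linarith

/-- Past the corner a lower curve violates the inequality of the other one; an upper curve with x_k
> 0 exists only on one side of its asymptote. -/
lemma Region.mem_span {x : EuclideanSpace ℝ (Fin n)} (hx : P.Region x) {c : P.Curve}
    (hc : x ∈ (P.hyp c).surface P.pos) : firstCoord P.pos x ∈ span c := by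
  have hw := P.one_lt_width
  rcases c with _ | _ | ⟨k, hk⟩ | ⟨k, hk, h⟩ | ⟨k, hk, h⟩ | ⟨k, hk, h⟩ <;> simp only [span]
  · exact hx.1
  · exact hx.1
  all_goals
    obtain ⟨h1, h2⟩ := hc
    simp only [hyp, HypCurve.q] at h1 h2
  · refine ⟨?_, hx.1.2⟩
    rcases (P.lo_le_τ k).eq_or_lt with h | h
    · exact h ▸ hx.1.1
    have h3 := hx.2 (.lowerRight k hk h)
    rw [ell_lowerRight] at h3
    by_contra hlt
    have := mul_pos (sub_pos.2 (not_le.1 hlt)) (show 0 < -x k by linarith)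
    linarith
  · refine ⟨hx.1.1, ?_⟩
    have h3 := hx.2 (.lowerLeft k hk)
    rw [ell_lowerLeft] at h3
    by_contra hlt
    have := mul_pos (sub_pos.2 (not_le.1 hlt)) (show 0 < -x k by linarith)
    linarith
  · refine ⟨hx.1.1, ?_⟩
    by_contra hlt
    have := mul_nonneg (sub_nonneg.2 (not_lt.1 hlt)) (show 0 ≤ x k by linarith)
    linarith
  · refine ⟨?_, hx.1.2⟩
    by_contra hlt
    have := mul_nonneg (sub_nonneg.2 (not_lt.1 hlt)) (show 0 ≤ x k by linarith)
    linarith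

end piece

/-- The number of curves. -/
abbrev size (P : HypData n) : ℕ := Nat.card P.Curve

/-- An enumeration of the curves. -/
def enum (P : HypData n) : Fin P.size ≃ P.Curve := (Finite.equivFin P.Curve).symm

/-- The family of hyperbolas. -/
def family (P : HypData n) (j : Fin P.size) : HypCurve n := P.hyp (P.enum j)

lemma mem_region_iff {x : EuclideanSpace ℝ (Fin n)} :
    x ∈ region P.pos P.family P.lo P.hi ↔ P.Region x :=
  and_congr_right fun _ => ⟨fun h c => by simpa [family] using h (P.enum.symm c), fun h _ => h _⟩

lemma isArrangement (P : HypData n) : IsArrangement P.pos P.family P.lo P.hi center where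
  lt := P.lo_lt_hi
  pos := by
    have : Nonempty P.Curve := ⟨.lensUpper⟩
    exact Nat.card_pos
  nondeg j := P.nondegenerate _
  cen_cont := by
    refine (PiLp.continuous_toLp 2 _).comp (continuous_pi fun k => ?_)
    split_ifs <;> fun_prop
  cen_first := firstCoord_center P.pos
  mem_region x hx := mem_region_iff.2 <| region_of_mul_nonneg fun c => by
    simpa [family] using hx (P.enum.symm c)
  factor_pos x hx j := (mem_region_iff.1 hx).factor_pos _
  cen_nonneg s hs j := (region_center hs).2 _
  cen_pos s hs j := ell_center_pos hs _
  cen_zero := by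
    refine ⟨P.enum.symm .lensUpper, ?_⟩
    simp only [family, Equiv.apply_symm_apply, ell_lensUpper, firstCoord_center, center_one]
    unfold width
    constructor <;> ring
  cen_end x hx j h0 := (mem_region_iff.1 hx).eq_center h0
  side x hx j hq := (mem_region_iff.1 hx).side hq
  piece j := ⟨span (P.enum j), ordConnected_span _, nonempty_span _,
    fun s hs => ⟨(region_section hs).1, mem_region_iff.2 (region_section hs).2⟩,
    fun x hx hj => (mem_region_iff.1 hx).mem_span hj⟩
  crossing i j hij hk x hx hx' := crossing_det_ne (P.enum.injective.ne hij) hk hx hx'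
  crossing_unique i j i' j' hij hk hij' hk' x h1 h2 h3 h4 :=
    (crossing_unique (P.enum.injective.ne hij) hk (P.enum.injective.ne hij') hk' h1 h2 h3 h4).imp
      (fun h => P.enum.injective h) (fun h => P.enum.injective h)
  bounded := by
    refine ⟨min (P.lo - 1) (-1), fun x hx k => ?_⟩
    have hx := mem_region_iff.1 hx
    rcases P.index_cases k with rfl | rfl | hk
    · exact (min_le_left _ _).trans (by have := hx.1.1; unfold firstCoord at this; linarith)
    · exact (min_le_left _ _).trans hx.bounds.1.le
    · exact (min_le_right _ _).trans (hx.neg_one_le hk)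

section slice

lemma mem_slice_iff {s : ℝ} {x : EuclideanSpace ℝ (Fin n)} :
    x ∈ slice P.pos P.family P.lo P.hi s ↔ P.Region x ∧ firstCoord P.pos x = s := by
  rw [← mem_region_iff]
  rfl

lemma exists_crossing_iff {s : ℝ} :
    (∃ x ∈ slice P.pos P.family P.lo P.hi s, ∃ i j, i ≠ j ∧ (P.family i).k = (P.family j).k ∧
      x ∈ (P.family i).surface P.pos ∧ x ∈ (P.family j).surface P.pos) ↔
    s = P.lo ∨ s = P.hi ∨ ∃ k : Fin n, 2 ≤ k.1 ∧ P.lo < P.τ k ∧ s = P.τ k := by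
  have hlt := P.lo_lt_hi
  constructor
  · rintro ⟨x, hx, i, j, hij, hk, hi, hj⟩
    obtain ⟨-, rfl⟩ := mem_slice_iff.1 hx
    rcases crossing_cases (P.enum.injective.ne hij) hk hi hj with
      ⟨-, h | h, -⟩ | ⟨k, hk, h, -, hs, -⟩
    · exact Or.inl h
    · exact Or.inr (Or.inl h)
    · exact Or.inr (Or.inr ⟨k, hk, h, hs⟩)
  · have key : ∀ {x : EuclideanSpace ℝ (Fin n)} {c c' : P.Curve}, P.Region x →
        firstCoord P.pos x = s → c ≠ c' → (P.hyp c).k = (P.hyp c').k →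
        (P.hyp c).q P.pos x = (P.hyp c).c → (P.hyp c').q P.pos x = (P.hyp c').c →
        ∃ x ∈ slice P.pos P.family P.lo P.hi s, ∃ i j, i ≠ j ∧
          (P.family i).k = (P.family j).k ∧
          x ∈ (P.family i).surface P.pos ∧ x ∈ (P.family j).surface P.pos := by
      intro x c c' hx hs hne hk hc hc'
      refine ⟨x, mem_slice_iff.2 ⟨hx, hs⟩, P.enum.symm c, P.enum.symm c',
        P.enum.symm.injective.ne hne, ?_⟩
      simp only [family, Equiv.apply_symm_apply]
      exact ⟨hk, hx.side hc, hx.side hc'⟩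
    have lens : s = P.lo ∨ s = P.hi → (s - P.lo) * (P.hi - s) = 0 ∧ s ∈ Icc P.lo P.hi := by
      rintro (rfl | rfl)
      · exact ⟨by ring, left_mem_Icc.2 hlt.le⟩
      · exact ⟨by ring, right_mem_Icc.2 hlt.le⟩
    rintro hs
    rw [← or_assoc] at hs
    rcases hs with hs | ⟨k, hk, h, rfl⟩
    · obtain ⟨h0, hs⟩ := lens hs
      refine key (c := .lensUpper) (c' := .lensLower) (region_center hs)
        (firstCoord_center P.pos s) (by simp) rfl ?_ ?_
      · simp only [hyp, HypCurve.q, firstCoord_center, center_one]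
        unfold width
        linear_combination -h0
      · simp only [hyp, HypCurve.q, firstCoord_center, center_one]
        unfold width
        linear_combination -h0
    · have hw := P.one_lt_width
      have hk0 := P.ne_zero_of_two_le hk
      -- The corner is the end point of the left lower curve, at s = τ and x_k = -1/w.
      have hr := (region_section (c := .lowerLeft k hk)
        (left_mem_Icc.2 (P.τ_lt_hi k).le : P.τ k ∈ Icc (P.τ k) P.hi)).2
      refine key (c := .lowerLeft k hk) (c' := .lowerRight k hk h) hr
        ((firstCoord_setCoord hk0 _ _).trans (firstCoord_center P.pos _)) (by simp) rfl ?_ ?_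
      all_goals
        simp only [hyp, HypCurve.q, setCoord_same, firstCoord_setCoord hk0, firstCoord_center]
        have : P.width * P.width⁻¹ = 1 := mul_inv_cancel₀ (by linarith)
        ring_nf
        linarith

/-- Off [τ, β] one of the upper curves bounds x_k by w/(τ - s) or w/(s - β). That curve is present,
because s < τ forces lo < τ and β < s forces β < hi. -/
lemma slice_bounded {s : ℝ} (hs : ∀ k : Fin n, 2 ≤ k.1 → s ∉ Icc (P.τ k) (P.β k)) :
    ∃ R, ∀ x ∈ slice P.pos P.family P.lo P.hi s, ∀ k, x k ≤ R := by
  have key : ∀ k : Fin n, ∃ R, ∀ x ∈ slice P.pos P.family P.lo P.hi s, x k ≤ R := by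
    intro k
    rcases P.index_cases k with rfl | rfl | hk
    · exact ⟨P.hi, fun x hx => (mem_slice_iff.1 hx).1.1.2⟩
    · exact ⟨P.hi + 1, fun x hx => (mem_slice_iff.1 hx).1.bounds.2.le⟩
    by_cases h1 : s < P.τ k
    · refine ⟨P.width / (P.τ k - s), fun x hx => ?_⟩
      obtain ⟨hr, rfl⟩ := mem_slice_iff.1 hx
      have := hr.2 (.upperLeft k hk (hr.1.1.trans_lt h1))
      rw [ell_upperLeft] at this
      rw [le_div_iff₀ (sub_pos.2 h1)]
      linarith
    · have h2 : P.β k < s := by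
        by_contra h2
        exact hs k hk ⟨not_lt.1 h1, not_lt.1 h2⟩
      refine ⟨P.width / (s - P.β k), fun x hx => ?_⟩
      obtain ⟨hr, rfl⟩ := mem_slice_iff.1 hx
      have := hr.2 (.upperRight k hk (h2.trans_le hr.1.2))
      rw [ell_upperRight] at this
      rw [le_div_iff₀ (sub_pos.2 h2)]
      linarith
  choose R hR using key
  refine ⟨∑ k, |R k|, fun x hx k => (hR k x hx).trans ((le_abs_self _).trans ?_)⟩
  exact Finset.single_le_sum (f := fun k => |R k|) (fun i _ => abs_nonneg _) (Finset.mem_univ k)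

lemma slice_unbounded {s : ℝ} (hs : s ∈ Icc P.lo P.hi) {k : Fin n} (hk : 2 ≤ k.1)
    (hsk : s ∈ Icc (P.τ k) (P.β k)) (R : ℝ) :
    ∃ x ∈ slice P.pos P.family P.lo P.hi s, R < x k := by
  have hw := P.one_lt_width
  have hy : 0 ≤ |R| + 1 := by positivity
  refine ⟨setCoord k (|R| + 1) (center s), mem_slice_iff.2 ⟨?_, ?_⟩, ?_⟩
  · have h1 := mul_nonneg (sub_nonneg.2 hsk.1) hy
    have h2 := mul_nonneg (sub_nonneg.2 hsk.2) hy
    exact region_setCoord_of_nonneg hs hk hy (fun _ => by linarith) (fun _ => by linarith)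
  · rw [firstCoord_setCoord (P.ne_zero_of_two_le hk), firstCoord_center]
  · rw [setCoord_same]
    linarith [le_abs_self R]

end slice

end HypData

end HypRAG

/-! ### Assigning the labelled intervals to the planes -/

namespace HypRAG

section data

variable {l n : ℕ}

/-- The number of the interval treated in the plane of the first and the `k`-th coordinate. -/
def planeIndex (l k : ℕ) : ℕ := if 2 ≤ k ∧ k < l then k - 1 else 0

lemma planeIndex_lt (hl : 1 < l) (k : ℕ) : planeIndex l k < l - 1 := by
  unfold planeIndex
  split_ifs <;> omega

/-- The arrangement realizing labelled intervals. -/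
def labelledData (hl : 1 < l) {t : Fin l → ℝ} (ht : StrictMono t) (lab : Fin (l - 1) → Fin 2)
    (hn : 2 ≤ n) : HypData n where
  lo := t ⟨0, by omega⟩
  hi := t ⟨l - 1, by omega⟩
  τ k := t ⟨planeIndex l k, by have := planeIndex_lt hl k; omega⟩
  -- The label is added to the index: label 0 gives β = τ, so unboundedness occurs only over a
  -- singular value; label 1 gives the whole closed interval.
  β k := t ⟨planeIndex l k + (lab ⟨planeIndex l k, planeIndex_lt hl k⟩).1, by
    have := planeIndex_lt hl k; omega⟩
  two_le := hn
  lo_lt_hi := ht (Fin.mk_lt_mk.2 (by omega))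
  lo_le_τ k := ht.monotone (Fin.mk_le_mk.2 (Nat.zero_le _))
  τ_lt_hi k := ht (Fin.mk_lt_mk.2 (planeIndex_lt hl k))
  τ_le_β k := ht.monotone (Fin.mk_le_mk.2 (Nat.le_add_right _ _))
  -- A positive plane index k - 1 determines k. Index 0 is shared by several coordinates, but then τ
  -- = lo and there is no corner.
  τ_inj k k' h h' := by
    have h := Fin.mk_lt_mk.1 (ht.lt_iff_lt.1 h)
    have h' := Fin.mk.inj (ht.injective h')
    unfold planeIndex at h h'
    ext
    split_ifs at h h' <;> omega

variable (hl : 1 < l) {t : Fin l → ℝ} (ht : StrictMono t) (lab : Fin (l - 1) → Fin 2)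
  (hn : 2 ≤ n)

/-- With indices from 0, an interior value t_i is the corner of the plane i + 1, which exists
because i + 1 < l ≤ n; the extreme values are the tips of the lens. -/
lemma labelledData_crossing_iff (hln : l ≤ n) (s : ℝ) :
    (s = (labelledData hl ht lab hn).lo ∨ s = (labelledData hl ht lab hn).hi ∨
      ∃ k : Fin n, 2 ≤ k.1 ∧ (labelledData hl ht lab hn).lo < (labelledData hl ht lab hn).τ k ∧
        s = (labelledData hl ht lab hn).τ k) ↔ s ∈ range t := by
  constructor
  · rintro (rfl | rfl | ⟨k, -, -, rfl⟩) <;> exact mem_range_self _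
  · rintro ⟨⟨i, hi⟩, rfl⟩
    rcases Nat.eq_zero_or_pos i with rfl | h0
    · exact Or.inl rfl
    by_cases h1 : i = l - 1
    · subst h1
      exact Or.inr (Or.inl rfl)
    have hk : planeIndex l (i + 1) = i := by
      unfold planeIndex
      rw [if_pos (by omega), Nat.add_sub_cancel]
    refine Or.inr (Or.inr ⟨⟨i + 1, by omega⟩, by simp only; omega, ?_, ?_⟩)
    · exact ht (Fin.mk_lt_mk.2 (by simp only [hk]; exact h0))
    · simp only [labelledData, hk]

/-- An interval with label `0` is disjoint from the intervals over which the region is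
unbounded. -/
lemma labelledData_notMem {j : Fin (l - 1)} (hj : lab j = 0) {s : ℝ}
    (hs : s ∈ Ioo (t ⟨j, by omega⟩) (t ⟨j + 1, by omega⟩)) (k : Fin n) :
    s ∉ Icc ((labelledData hl ht lab hn).τ k) ((labelledData hl ht lab hn).β k) := by
  rintro ⟨h1, h2⟩
  have h3 := Fin.mk_lt_mk.1 (ht.lt_iff_lt.1 (h1.trans_lt hs.2))
  have h4 := Fin.mk_lt_mk.1 (ht.lt_iff_lt.1 (hs.1.trans_le h2))
  have h5 : planeIndex l k = j := by omega
  have h6 : (⟨planeIndex l k, planeIndex_lt hl k⟩ : Fin (l - 1)) = j := Fin.ext h5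
  rw [h6, hj, h5] at h4
  simp at h4

/-- Over an interval with label `1`, the region is unbounded. -/
lemma exists_labelledData_mem (hln : n = l + 1) {j : Fin (l - 1)} (hj : lab j = 1) {s : ℝ}
    (hs : s ∈ Ioo (t ⟨j, by omega⟩) (t ⟨j + 1, by omega⟩)) :
    ∃ k : Fin n, 2 ≤ k.1 ∧
      s ∈ Icc ((labelledData hl ht lab hn).τ k) ((labelledData hl ht lab hn).β k) := by
  obtain ⟨k, hk, hkj⟩ : ∃ k : Fin n, 2 ≤ k.1 ∧ planeIndex l k = j := by
    unfold planeIndex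
    -- The first interval is treated in the plane k = l, which exists only for n = l + 1; the other
    -- intervals use k = j + 1.
    rcases Nat.eq_zero_or_pos j with h0 | h0
    · exact ⟨⟨l, by omega⟩, hl, by simp [h0]⟩
    · exact ⟨⟨j + 1, by omega⟩, by simp only; omega, by simp only; rw [if_pos (by omega)]; rfl⟩
  refine ⟨k, hk, ?_⟩
  simp only [labelledData, hj, hkj]
  exact Ioo_subset_Icc_self hs

end data

/-- Dimensions at least `2` with a prescribed large sum. -/
lemma exists_dimensions {L n m : ℕ} (hL : 0 < L) (hm : n + L ≤ m) :
    ∃ d : Fin L → ℕ, (∀ j, 2 ≤ d j) ∧ n + ∑ j, d j = m + L := by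
  -- All dimensions are 2, and the first absorbs the excess over the minimal value m = n + L.
  refine ⟨fun j => 2 + if j = ⟨0, hL⟩ then m - (n + L) else 0, fun j => Nat.le_add_right _ _, ?_⟩
  rw [Finset.sum_add_distrib, Finset.sum_ite_eq' Finset.univ]
  simp
  omega

end HypRAG

end

theorem theorem2 (l : ℕ) (hl : 1 < l) (t : Fin l → ℝ) (ht : StrictMono t)
    (lab : Fin (l - 1) → Fin 2) (n : ℕ) (hn0 : 0 < n)
    (hn : n = l + 1 ∨ (n = l ∧ ∀ j, lab j = 0)) :
    ∃ (L : ℕ) (D : Set (EuclideanSpace ℝ (Fin n))) (f : Fin L → MvPolynomial (Fin n) ℝ)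
      (S : Fin L → Set (EuclideanSpace ℝ (Fin n))),
      HypRAG.IsNC D f S ∧ HypRAG.IsSurroundedBy D S ∧
      (∀ j, HypRAG.IsHyperbolaCylinder hn0 (S j)) ∧
      ∃ m₀ : ℕ, ∀ m, m₀ ≤ m → ∃ d : Fin L → ℕ, (∀ j, 0 < d j) ∧ n + ∑ j, d j = m + L ∧
        HypRAG.IsMapOver D m (HypRAG.totalPoly f d) (HypRAG.totalManifold D f d)
          HypRAG.baseProj ∧
        HypRAG.RealizesData hl t lab m (HypRAG.totalManifold D f d)
          (fun z => HypRAG.firstCoord hn0 (HypRAG.baseProj z)) := by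
  have hn2 : 2 ≤ n := by omega
  have hln : l ≤ n := by omega
  set P := HypRAG.labelledData hl ht lab hn2 with hP
  have h := P.isArrangement
  refine ⟨P.size, HypRAG.domain hn0 P.family, fun j => (P.family j).poly hn0,
    fun j => (P.family j).surface hn0, h.isNC, h.isSurroundedBy,
    fun j => (h.nondeg j).isHyperbolaCylinder, n + P.size, fun m hm => ?_⟩
  obtain ⟨d, hd, hdm⟩ := HypRAG.exists_dimensions h.pos hm
  refine ⟨d, fun j => two_pos.trans_le (hd j), hdm,
    h.isRegularDomain.isMapOver h.isConnected_domain.closure hd hdm,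
    h.realizesData hd hdm hl ht rfl rfl (fun s => ?_) (fun j s hs hj => ?_) fun j s hs hj => ?_⟩
  · exact HypRAG.HypData.exists_crossing_iff.trans
      (HypRAG.labelledData_crossing_iff hl ht lab hn2 hln s)
  · exact HypRAG.HypData.slice_bounded fun k _ =>
      HypRAG.labelledData_notMem hl ht lab hn2 hj hs k
  -- For n = l no label is 1, so nothing has to be non-compact.
  · rcases hn with hn | ⟨-, h0⟩
    · obtain ⟨k, hk, hsk⟩ := HypRAG.exists_labelledData_mem hl ht lab hn2 hn hj hs
      refine ⟨k, HypRAG.HypData.slice_unbounded ?_ hk hsk⟩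
      exact ⟨(P.lo_le_τ k).trans hsk.1,
        hs.2.le.trans (ht.monotone (Fin.mk_le_mk.2 (by omega)))⟩
    · rw [h0 j] at hj
      exact absurd hj (by decide)
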